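/- **Setting.** Let $x_0,\dots,x_{m-1},y_0,\dots,y_{m-1}\in\mathbb C^n$ ($m,n\ge 1$; in particular the vectors may be real). For $v\ne 0$ let $|v\rangle=\|v\|^{-1}\sum_k v_k|k\rangle$ (for $v=0$, $|v\rangle$ is any unit vector). Index registers have $\lceil\log_2 m\rceil$ qubits and vector registers have $\lceil\log_2 n\rceil$ qubits. Unitary oracles $O_1,O_2,O_1',O_2'$ are given with $$O_1|i\rangle|0\rangle=|i\rangle|x_i\rangle,\quad O_2|j\rangle|0\rangle=|j\rangle|y_j\rangle,\quad O_1'|i\rangle|0\rangle=|i\rangle|\widetilde{\|x_i\|}\rangle,\quad O_2'|j\rangle|0\rangle=|j\rangle|\widetilde{\|y_j\|}\rangle\qquad(0\le i,j<m),$$ where $\widetilde{\|x_i\|},\widetilde{\|y_j\|}$ are $b$-bit fixed-point numbers (with $s$ binary digits after the point, $s\in\mathbb Z$) that equal $\|x_i\|,\|y_j\|$ up to an error $\eta\ge 0$; $\eta=0$ is the case of exact norms. One query to an oracle, to its inverse, or to either of them controlled by a qubit takes time $T$, an arbitrary one-qubit gate or a CNOT gate takes time $1$, and the running time of a circuit is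 the total time of its steps. **Lemma.** For all $C_0\in\mathbb R$ and $k_0\in\mathbb N$ there are $C\in\mathbb R$ and $k\in\mathbb N$ such that the following holds for all $m,n\ge1$, $b,T\in\mathbb N$, $s\in\mathbb Z$, $h,\varepsilon_0>0$ and $0<\varepsilon<1$ with $T\le C_0(1+\log(mn))^{k_0}$ and $b\le C_0(1+\log(mn))^{k_0}$. There is a quantum circuit with oracle gates, which does not depend on the vectors, the oracles, $\eta$ or the weights $p_{ij}$, whose running time is at most $$C\,\frac{h}{\varepsilon_0}\,\bigl(1+\log(mn/\varepsilon)\bigr)^{k},$$ and such that for all $\eta$, all vectors with $\|x_i\|,\|y_j\|\le h$ and $\|x_i-y_j\|\ge\varepsilon_0$ for all $i,j$ (for instance with $h=\max_i\{\|x_i\|,\|y_i\|\}$ and $\varepsilon_0=\min_{i,j}\|x_i-y_j\|$), all oracles as above, and all $p_{ij}\ge 0$ with $\sum_{i,j}p_{ij}=1$, the circuit maps $$\sum_{i,j=0}^{m-1}\sqrt{p_{ij}}\,|i\rangle|j\rangle|0\rangle|0\rangle\quad\text{to}\quad\sum_{i,j=0}^{m-1}\sqrt{p_{ij}}\,|i\rangle|j\rangle|x_i-y_j\rangle|0\rangle$$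 with error at most $\varepsilon+8\eta/\varepsilon_0$ in Euclidean norm, hence at most $\varepsilon$ if the norms are exact. The last register consists of work qubits. -/

import Mathlib

open scoped Matrix

namespace QAlg

/-! ## States of qubit registers

A register whose qubits are labelled by `Q` has the computational basis `Q → Bool`; a (pure) state is
its family of amplitudes. -/

/-- Amplitude vectors of a register with qubits labelled by `Q`. -/
abbrev State (Q : Type) : Type := (Q → Bool) → ℂ

/-- The computational basis state `|s⟩`. -/
def ket {Q : Type} [Fintype Q] [DecidableEq Q] (s : Q → Bool) : State Q := Pi.single s 1

/-- The tensor product `f ⊗ g` of the states of two registers. -/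
def tensor {Q R : Type} (f : State Q) (g : State R) : State (Q ⊕ R) :=
  fun s => f (s ∘ Sum.inl) * g (s ∘ Sum.inr)

/-- The `d` lowest binary digits of `k` (all the digits when `k < 2 ^ d`). -/
def bits (d k : ℕ) : Fin d → Bool := fun r => k.testBit r

/-- `|k⟩` in a register of `d` qubits. -/
def ketNat (d k : ℕ) : State (Fin d) := ket (bits d k)

/-- The amplitude encoding `∑ k, v k |k⟩` of a vector in a register of `d` qubits. -/
def ketVec {n : ℕ} (d : ℕ) (v : EuclideanSpace ℂ (Fin n)) : State (Fin d) :=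
  ∑ k : Fin n, v k • ketNat d k

/-- The Euclidean norm of an amplitude vector. -/
noncomputable def stateNorm {Q : Type} [Fintype Q] [DecidableEq Q] (f : State Q) : ℝ :=
  ‖(WithLp.toLp 2 f : EuclideanSpace ℂ (Q → Bool))‖

/-! ## Circuits with oracle gates -/

/-- The four oracles: state preparation for the `x i` and the `y j`, and their norms. -/
inductive OracleName : Type
  | vecX | vecY | normX | normY

/-- Sizes (in qubits) of the registers the oracles act on. -/
structure Sizes : Type where
  /-- size of an index register -/
  idx : ℕ
  /-- size of a vector register -/
  vec : ℕ
  /-- size of a register that holds a norm -/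
  num : ℕ

/-- Size of the second (output) register of an oracle. -/
def Sizes.out (σ : Sizes) : OracleName → ℕ
  | .vecX => σ.vec
  | .vecY => σ.vec
  | .normX => σ.num
  | .normY => σ.num

/-- The qubits an oracle acts on: an index register and an output register. -/
abbrev Sizes.Wires (σ : Sizes) (o : OracleName) : Type := Fin σ.idx ⊕ Fin (σ.out o)

/-- A choice of the four oracle unitaries. -/
abbrev Oracles (σ : Sizes) : Type :=
  ∀ o : OracleName, Matrix.unitaryGroup (σ.Wires o → Bool) ℂ

/-- The elementary steps of an algorithm on the qubits `Q`: an arbitrary one-qubit gate, a CNOT gate, or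
a query to one of the oracles on chosen distinct qubits, possibly inverted, and possibly controlled by
one further qubit. -/
inductive Gate (σ : Sizes) (Q : Type) : Type
  | single (q : Q) (U : Matrix.unitaryGroup Bool ℂ)
  | cnot (control target : Q) (hne : control ≠ target)
  | query (o : OracleName) (wires : σ.Wires o ↪ Q) (inverse : Bool)
      (control : Option {q : Q // q ∉ Set.range wires})

/-- A circuit is a list of steps, executed from the head of the list on. -/
abbrev Circuit (σ : Sizes) (Q : Type) : Type := List (Gate σ Q)

section Semantics

variable {σ : Sizes} {Q : Type} [Fintype Q] [DecidableEq Q]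

/-- The operator `U ⊗ 1` on the qubits `Q`, where `U` acts on the qubits `e i`. -/
noncomputable def liftOp {ι : Type} (e : ι ↪ Q) (U : Matrix (ι → Bool) (ι → Bool) ℂ) :
    Matrix (Q → Bool) (Q → Bool) ℂ :=
  open Classical in
  Matrix.of fun s t => if ∀ q, q ∉ Set.range e → s q = t q then U (s ∘ e) (t ∘ e) else 0

/-- The operator `U ⊗ 1` on the qubits `Q`, where `U` acts on the single qubit `q`. -/
def singleOp (q : Q) (U : Matrix Bool Bool ℂ) : Matrix (Q → Bool) (Q → Bool) ℂ :=
  Matrix.of fun s t => if ∀ r, r ≠ q → s r = t r then U (s q) (t q) else 0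

/-- The CNOT operator `|t⟩ ↦ |t with the target bit replaced by target xor control⟩`. -/
def cnotOp (control target : Q) : Matrix (Q → Bool) (Q → Bool) ℂ :=
  Matrix.of fun s t =>
    if s = Function.update t target (xor (t target) (t control)) then 1 else 0

/-- `M` applied on the subspace where the qubit `q` is `1`, the identity where it is `0`. -/
def controlOp (q : Q) (M : Matrix (Q → Bool) (Q → Bool) ℂ) : Matrix (Q → Bool) (Q → Bool) ℂ :=
  Matrix.of fun s t => if t q = true then M s t else (1 : Matrix (Q → Bool) (Q → Bool) ℂ) s t

/-- The operator of one step. -/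
noncomputable def Gate.op (O : Oracles σ) : Gate σ Q → Matrix (Q → Bool) (Q → Bool) ℂ
  | .single q U => singleOp q (U : Matrix Bool Bool ℂ)
  | .cnot c t _ => cnotOp c t
  | .query o e inverse control =>
      let M := liftOp e
        (if inverse then ((O o : Matrix (σ.Wires o → Bool) (σ.Wires o → Bool) ℂ))ᴴ else (O o))
      match control with
      | none => M
      | some q => controlOp (q : Q) M

/-- The result of running a circuit on a state. -/
noncomputable def Circuit.run (O : Oracles σ) : Circuit σ Q → State Q → State Q
  | [], ψ => ψ
  | g :: gs, ψ => Circuit.run O gs (g.op O *ᵥ ψ)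

/-- The running time of one step, when one query takes time `T`. -/
def Gate.time (T : ℕ) : Gate σ Q → ℕ
  | .single _ _ => 1
  | .cnot _ _ _ => 1
  | .query _ _ _ _ => T

/-- The running time of a circuit, when one query takes time `T`. -/
def Circuit.time (T : ℕ) (𝒜 : Circuit σ Q) : ℕ := (𝒜.map (Gate.time T)).sum

end Semantics

/-! ## The oracles for the data -/

/-- The sizes for `m` vectors of dimension `n` and `b`-bit norms. -/
def sizes (m n b : ℕ) : Sizes := ⟨Nat.clog 2 m, Nat.clog 2 n, b⟩

/-- `O |i⟩|0⟩ = |i⟩|v i⟩` for every `i`, where `|v i⟩` is the unit vector in the direction of `v i`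
(any unit vector if `v i = 0`). -/
def PreparesVectors {m n a d : ℕ} (O : Matrix (Fin a ⊕ Fin d → Bool) (Fin a ⊕ Fin d → Bool) ℂ)
    (v : Fin m → EuclideanSpace ℂ (Fin n)) : Prop :=
  ∀ i : Fin m, ∃ u : EuclideanSpace ℂ (Fin n), ‖u‖ = 1 ∧ (‖v i‖ : ℂ) • u = v i ∧
    O *ᵥ tensor (ketNat a i) (ketNat d 0) = tensor (ketNat a i) (ketVec d u)

/-- `O |i⟩|0⟩ = |i⟩|r⟩` for every `i`, where the `b`-bit number `r`, read as a fixed-point number with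
`s` binary digits after the point, is the norm of `v i` up to an error `η` (exactly, if `η = 0`). -/
def ReturnsNorms {m n a b : ℕ} (s : ℤ) (η : ℝ)
    (O : Matrix (Fin a ⊕ Fin b → Bool) (Fin a ⊕ Fin b → Bool) ℂ)
    (v : Fin m → EuclideanSpace ℂ (Fin n)) : Prop :=
  ∀ i : Fin m, ∃ r : ℕ, r < 2 ^ b ∧ |(r : ℝ) * (2 : ℝ) ^ (-s) - ‖v i‖| ≤ η ∧
    O *ᵥ tensor (ketNat a i) (ketNat b 0) = tensor (ketNat a i) (ketNat b r)

/-- The four oracles give access to the vectors `x i`, `y j` and, up to an error `η`, to their norms. -/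
structure GivesAccess {m n b : ℕ} (s : ℤ) (η : ℝ) (O : Oracles (sizes m n b))
    (x y : Fin m → EuclideanSpace ℂ (Fin n)) : Prop where
  vecX : PreparesVectors (a := (sizes m n b).idx) (d := (sizes m n b).vec) (O .vecX).1 x
  vecY : PreparesVectors (a := (sizes m n b).idx) (d := (sizes m n b).vec) (O .vecY).1 y
  normX : ReturnsNorms (a := (sizes m n b).idx) (b := (sizes m n b).num) s η (O .normX).1 x
  normY : ReturnsNorms (a := (sizes m n b).idx) (b := (sizes m n b).num) s η (O .normY).1 y

/-! ## Input and output -/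

/-- The qubits of the algorithm: the registers for `i`, for `j`, for the vector, and `w` work qubits. -/
abbrev Layout (m n w : ℕ) : Type :=
  Fin (Nat.clog 2 m) ⊕ (Fin (Nat.clog 2 m) ⊕ (Fin (Nat.clog 2 n) ⊕ Fin w))

/-- The input `∑ i j, √(p i j) |i⟩|j⟩|0⟩|0⟩`. -/
noncomputable def inputState {m : ℕ} (n w : ℕ) (p : Fin m → Fin m → ℝ) : State (Layout m n w) :=
  ∑ i, ∑ j, (Real.sqrt (p i j) : ℂ) •
    tensor (ketNat _ i) (tensor (ketNat _ j) (tensor (ketNat _ 0) (ketNat _ 0)))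

/-- The desired output `∑ i j, √(p i j) |i⟩|j⟩|x i - y j⟩|0⟩`, where `|x i - y j⟩` is the normalized
difference. -/
noncomputable def outputState {m n : ℕ} (w : ℕ) (p : Fin m → Fin m → ℝ)
    (x y : Fin m → EuclideanSpace ℂ (Fin n)) : State (Layout m n w) :=
  ∑ i, ∑ j, (Real.sqrt (p i j) : ℂ) •
    tensor (ketNat _ i) (tensor (ketNat _ j)
      (tensor (ketVec _ (((‖x i - y j‖⁻¹ : ℝ) : ℂ) • (x i - y j))) (ketNat _ 0)))

/-- The polylogarithmic bound `C (1 + log z) ^ k`; the summand `1` only matters for `z` near `1`. -/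
noncomputable def polylog (C : ℝ) (k : ℕ) (z : ℝ) : ℝ := C * (1 + Real.log z) ^ k

end QAlg

set_option linter.unusedSectionVars false


/-! Fix $i,j$ and write $r_x,r_y$ for the integers returned by the norm oracles. Put a selection bit
and a $B$-bit key into uniform superposition, flip the sign where the bit selects $y$, query the
selected unit vector, and clear a failure flag exactly for $r_x$ (respectively $r_y$) of the $2^B$
keys. After undoing the preparation, the part of the state with all work qubits zero is
$2^{-(B+1)}(r_x u_x - r_y u_y)$, a multiple of the wanted difference up to the error of the norms
(`run_combine_apply`). Its length $\sin\theta$ is at least of order $\varepsilon_0/h$, because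
`exists_key_size` keeps $2^B$ of the order of the largest norm.

It remains to amplify. The angle $\theta$ depends on $(i,j)$ and is not known, so a fixed number of
amplification rounds does not suffice: one circuit has to work for every
$\theta\in[\theta_0,\pi/2]$. The walk, a product of two reflections, rotates the plane of the
prepared state and the target by $2\theta$ (`run_walk_planeVec`), and it is trivial when an extra
qubit is $1$. Interleaving walks with gates on that qubit applies a polynomial $P$ in the walk
(`run_signalCircuit`). After $n$ inverse walks, $z^m$ contributes the angle $(2m+1-2n)\theta$, so
$P$ must satisfy $\sum_m P_m\sin((2m+1-2n)\theta)\approx 1$ and $\sum_m P_m\cos((2m+1-2n)\theta)=0$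
(`run_amplify`).

Such a $P$ comes from a square wave sampled on a grid and smoothed by a power of the Fejér kernel
(`exists_amplifying_polynomial`): degree $O(\theta_0^{-1}\log(1/\delta))$ gives error $\delta$. It
is realisable because $|P|<1$ on the circle: Fejér–Riesz supplies $Q$ with $|P|^2+|Q|^2=1$
(`exists_complement`), and $(P,Q)$ factors into one-qubit unitaries, one per degree
(`exists_signalPair`).

The output and the target are unit vectors with inner product $s\ge 1-\delta$, hence at squared
distance $2-2s$. The circuit never changes the index registers, so errors for different $(i,j)$ are
orthogonal and average with the weights $p_{ij}$ (`stateNorm_superposition_le`). Inexact norms only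
move the target direction (`norm_normalize_sub_normalize_le`). -/

namespace QAlg

/-! ### Algebra of gates, circuits and inner products -/

section GateSemantics

variable {σ : Sizes} {Q : Type} [Fintype Q] [DecidableEq Q]

/-- `M` has no matrix entries between basis states that differ in the qubit `q`. -/
def FixesBit (q : Q) (M : Matrix (Q → Bool) (Q → Bool) ℂ) : Prop :=
  ∀ s t, M s t ≠ 0 → s q = t q

theorem FixesBit.one (q : Q) : FixesBit q (1 : Matrix (Q → Bool) (Q → Bool) ℂ) := by
  intro s t h
  by_contra hne
  exact h (Matrix.one_apply_ne fun e => hne (by rw [e]))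

theorem FixesBit.mul {q : Q} {M N : Matrix (Q → Bool) (Q → Bool) ℂ} (hM : FixesBit q M)
    (hN : FixesBit q N) : FixesBit q (M * N) := by
  intro s t h
  rw [Matrix.mul_apply] at h
  obtain ⟨u, -, hu⟩ := Finset.exists_ne_zero_of_sum_ne_zero h
  rw [hM s u (left_ne_zero_of_mul hu), hN u t (right_ne_zero_of_mul hu)]

theorem FixesBit.mulVec {q : Q} {M : Matrix (Q → Bool) (Q → Bool) ℂ} (hM : FixesBit q M)
    {ψ : State Q} {β : Bool} (hψ : ∀ s, ψ s ≠ 0 → s q = β) :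
    ∀ s, (M *ᵥ ψ) s ≠ 0 → s q = β := by
  intro s h
  rw [Matrix.mulVec, dotProduct] at h
  obtain ⟨u, -, hu⟩ := Finset.exists_ne_zero_of_sum_ne_zero h
  rw [hM s u (left_ne_zero_of_mul hu), hψ u (right_ne_zero_of_mul hu)]

/-- A string that agrees with `s` off the range of `e` is determined by its restriction along `e`,
and every restriction occurs. -/
theorem sum_agree_off {ι : Type} [Fintype ι] [DecidableEq ι] (e : ι ↪ Q) (s : Q → Bool)
    (f : (Q → Bool) → ℂ) (p : (Q → Bool) → Prop) [DecidablePred p]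
    (hp : ∀ t, p t ↔ ∀ q, q ∉ Set.range e → s q = t q) :
    ∑ t, (if p t then f t else 0) = ∑ u : ι → Bool, f (Function.extend e u s) := by
  rw [← Finset.sum_filter]
  symm
  refine Finset.sum_bij (fun u _ => Function.extend e u s) ?_ ?_ ?_ ?_
  · intro u _
    simp only [Finset.mem_filter, Finset.mem_univ, true_and, hp]
    intro q hq
    rw [Function.extend_apply' _ _ _ (by simpa using hq)]
  · intro u _ u' _ h
    funext i
    have := congrFun h (e i)
    rwa [e.injective.extend_apply, e.injective.extend_apply] at this
  · intro t ht
    simp only [Finset.mem_filter, Finset.mem_univ, true_and, hp] at ht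
    refine ⟨t ∘ e, Finset.mem_univ _, ?_⟩
    funext q
    by_cases hq : q ∈ Set.range e
    · obtain ⟨i, rfl⟩ := hq
      rw [e.injective.extend_apply, Function.comp]
    · rw [Function.extend_apply' _ _ _ (by simpa using hq), ht q hq]
  · intros; rfl

theorem extend_comp_emb {ι : Type} (e : ι ↪ Q) (u : ι → Bool) (s : Q → Bool) :
    Function.extend e u s ∘ e = u := by
  funext i; exact e.injective.extend_apply _ _ _

/-- With this local form of the action, products and identities of lifted operators reduce to rules
for `Function.extend`. -/
theorem liftOp_mulVec {ι : Type} [Fintype ι] [DecidableEq ι] (e : ι ↪ Q)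
    (U : Matrix (ι → Bool) (ι → Bool) ℂ) (ψ : State Q) (s : Q → Bool) :
    (liftOp e U *ᵥ ψ) s = ∑ u, U (s ∘ e) u * ψ (Function.extend e u s) := by
  classical
  have := sum_agree_off e s (fun t => U (s ∘ e) (t ∘ e) * ψ t)
    (fun t => ∀ q, q ∉ Set.range e → s q = t q) (fun t => Iff.rfl)
  simp only [extend_comp_emb] at this
  rw [← this, Matrix.mulVec, dotProduct]
  refine Finset.sum_congr rfl fun t _ => ?_
  simp only [liftOp, Matrix.of_apply, ite_mul, zero_mul]

theorem ext_mulVec {M N : Matrix (Q → Bool) (Q → Bool) ℂ} (h : ∀ ψ : State Q, M *ᵥ ψ = N *ᵥ ψ) :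
    M = N := by
  ext s t
  have := congrFun (h (Pi.single t 1)) s
  simpa using this

theorem extend_extend_emb {ι : Type} (e : ι ↪ Q) (u v : ι → Bool) (s : Q → Bool) :
    Function.extend e v (Function.extend e u s) = Function.extend e v s := by
  funext q
  by_cases hq : ∃ i, e i = q
  · obtain ⟨i, rfl⟩ := hq
    rw [e.injective.extend_apply, e.injective.extend_apply]
  · simp only [Function.extend_apply' _ _ _ hq]

theorem extend_self_emb {ι : Type} (e : ι ↪ Q) (s : Q → Bool) :
    Function.extend e (s ∘ e) s = s := by
  funext q
  by_cases hq : ∃ i, e i = q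
  · obtain ⟨i, rfl⟩ := hq
    rw [e.injective.extend_apply, Function.comp]
  · simp only [Function.extend_apply' _ _ _ hq]

theorem liftOp_mul {ι : Type} [Fintype ι] [DecidableEq ι] (e : ι ↪ Q)
    (U V : Matrix (ι → Bool) (ι → Bool) ℂ) : liftOp e U * liftOp e V = liftOp e (U * V) := by
  refine ext_mulVec fun ψ => ?_
  funext s
  rw [← Matrix.mulVec_mulVec, liftOp_mulVec, liftOp_mulVec]
  simp only [liftOp_mulVec, extend_comp_emb, extend_extend_emb, Matrix.mul_apply,
    Finset.sum_mul, Finset.mul_sum, mul_assoc]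
  exact Finset.sum_comm

theorem liftOp_one {ι : Type} [Fintype ι] [DecidableEq ι] (e : ι ↪ Q) :
    liftOp e (1 : Matrix (ι → Bool) (ι → Bool) ℂ) = 1 := by
  refine ext_mulVec fun ψ => ?_
  funext s
  rw [liftOp_mulVec, Matrix.one_mulVec]
  simp [Matrix.one_apply, extend_self_emb]

theorem liftOp_conjTranspose {ι : Type} (e : ι ↪ Q)
    (U : Matrix (ι → Bool) (ι → Bool) ℂ) : (liftOp e U)ᴴ = liftOp e Uᴴ := by
  ext s t
  simp only [liftOp, Matrix.conjTranspose_apply, Matrix.of_apply]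
  by_cases h : ∀ q, q ∉ Set.range e → s q = t q
  · rw [if_pos h, if_pos fun q hq => (h q hq).symm]
  · rw [if_neg h, if_neg fun h' => h fun q hq => (h' q hq).symm, star_zero]

theorem FixesBit.liftOp {ι : Type} (e : ι ↪ Q) (U : Matrix (ι → Bool) (ι → Bool) ℂ) {q : Q}
    (hq : q ∉ Set.range e) : FixesBit q (QAlg.liftOp e U) := by
  intro s t h
  simp only [QAlg.liftOp, Matrix.of_apply, ne_eq, ite_eq_right_iff, not_forall] at h
  exact h.1 q hq

/-- The embedding of a one-element type with value `q`. -/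
def pointEmb (q : Q) : Unit ↪ Q := ⟨fun _ => q, fun _ _ _ => rfl⟩

theorem pointEmb_apply (q : Q) (x : Unit) : pointEmb q x = q := rfl

/-- One-qubit gates thereby inherit the algebra of lifted operators. -/
theorem singleOp_eq_liftOp (q : Q) (U : Matrix Bool Bool ℂ) :
    singleOp q U = liftOp (pointEmb q) (U.submatrix (fun u => u ()) (fun u => u ())) := by
  ext s t
  have : (∀ r, r ≠ q → s r = t r) ↔ (∀ r, r ∉ Set.range (pointEmb q) → s r = t r) := by
    simp [pointEmb_apply, @eq_comm _ q]
  simp only [singleOp, liftOp, Matrix.of_apply, this, Matrix.submatrix_apply, Function.comp]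
  congr

theorem singleOp_mulVec (q : Q) (U : Matrix Bool Bool ℂ) (ψ : State Q) (s : Q → Bool) :
    (singleOp q U *ᵥ ψ) s = ∑ β, U (s q) β * ψ (Function.update s q β) := by
  rw [singleOp_eq_liftOp, liftOp_mulVec, ← (Equiv.funUnique Unit Bool).symm.sum_comp]
  refine Finset.sum_congr rfl fun β _ => ?_
  have : Function.extend (pointEmb q) ((Equiv.funUnique Unit Bool).symm β) s =
      Function.update s q β := by
    funext r
    by_cases hr : r = q
    · subst hr
      rw [Function.update_self]
      exact (pointEmb r).injective.extend_apply _ _ ()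
    · rw [Function.update_of_ne hr, Function.extend_apply' _ _ _ (by
        simpa [pointEmb_apply] using fun e => hr e.symm)]
  rw [this]
  rfl

theorem singleOp_mul (q : Q) (U V : Matrix Bool Bool ℂ) :
    singleOp q U * singleOp q V = singleOp q (U * V) := by
  rw [singleOp_eq_liftOp, singleOp_eq_liftOp, singleOp_eq_liftOp, liftOp_mul]
  congr 1

theorem singleOp_one (q : Q) : singleOp q (1 : Matrix Bool Bool ℂ) = 1 := by
  rw [singleOp_eq_liftOp, ← liftOp_one (pointEmb q)]
  congr 1
  exact Matrix.submatrix_one_equiv (Equiv.funUnique Unit Bool)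

theorem singleOp_conjTranspose (q : Q) (U : Matrix Bool Bool ℂ) :
    (singleOp q U)ᴴ = singleOp q Uᴴ := by
  rw [singleOp_eq_liftOp, singleOp_eq_liftOp, liftOp_conjTranspose]
  rfl

theorem FixesBit.singleOp {q r : Q} (U : Matrix Bool Bool ℂ) (h : q ≠ r) :
    FixesBit q (QAlg.singleOp r U) := by
  rw [singleOp_eq_liftOp]
  exact FixesBit.liftOp _ _ (by simpa [pointEmb_apply] using h.symm)

theorem update_xor_involutive {c t : Q} (h : c ≠ t) :
    Function.Involutive fun s : Q → Bool => Function.update s t (xor (s t) (s c)) := by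
  intro s
  funext r
  by_cases hr : r = t
  · subst hr; simp [Function.update_of_ne h]
  · simp [Function.update_of_ne hr]

/-- The gate permutes the basis by an involution, so its only nonzero entry in row `s` is in the
column of the image of `s`. -/
theorem cnotOp_mulVec {c t : Q} (h : c ≠ t) (ψ : State Q) (s : Q → Bool) :
    (cnotOp c t *ᵥ ψ) s = ψ (Function.update s t (xor (s t) (s c))) := by
  rw [Matrix.mulVec, dotProduct, Finset.sum_eq_single (Function.update s t (xor (s t) (s c)))]
  · have := (update_xor_involutive h s).symm
    simp only [cnotOp, Matrix.of_apply]
    rw [if_pos this, one_mul]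
  · intro u _ hu
    simp only [cnotOp, Matrix.of_apply]
    rw [if_neg, zero_mul]
    intro hs
    exact hu (by rw [hs]; exact ((update_xor_involutive h) u).symm)
  · simp

theorem cnotOp_mul_self {c t : Q} (h : c ≠ t) :
    cnotOp c t * cnotOp c t = (1 : Matrix (Q → Bool) (Q → Bool) ℂ) := by
  refine ext_mulVec fun ψ => ?_
  funext s
  rw [← Matrix.mulVec_mulVec, cnotOp_mulVec h, cnotOp_mulVec h, Matrix.one_mulVec]
  exact congrArg ψ (update_xor_involutive h s)

theorem cnotOp_conjTranspose {c t : Q} (h : c ≠ t) :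
    (cnotOp c t)ᴴ = (cnotOp c t : Matrix (Q → Bool) (Q → Bool) ℂ) := by
  ext s u
  simp only [cnotOp, Matrix.conjTranspose_apply, Matrix.of_apply]
  have : (u = Function.update s t (xor (s t) (s c))) ↔
      (s = Function.update u t (xor (u t) (u c))) :=
    ⟨fun e => by rw [e]; exact (update_xor_involutive h s).symm,
      fun e => by rw [e]; exact (update_xor_involutive h u).symm⟩
  simp only [this]
  split_ifs <;> simp

theorem FixesBit.cnotOp {q t : Q} (c : Q) (h : q ≠ t) : FixesBit q (QAlg.cnotOp c t) := by
  intro s u hs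
  simp only [QAlg.cnotOp, Matrix.of_apply, ne_eq, ite_eq_right_iff, one_ne_zero, imp_false,
    not_not] at hs
  rw [hs, Function.update_of_ne h]

/-- The control is read off the column index. Since `N` preserves the control bit, it still has the
same value when `M` is applied. -/
theorem controlOp_mul {q : Q} {M N : Matrix (Q → Bool) (Q → Bool) ℂ} (hN : FixesBit q N) :
    controlOp q M * controlOp q N = controlOp q (M * N) := by
  ext s t
  by_cases ht : t q = true
  · simp only [controlOp, Matrix.mul_apply, Matrix.of_apply, ht, if_true]
    refine Finset.sum_congr rfl fun u _ => ?_
    by_cases h : N u t = 0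
    · rw [h, mul_zero, mul_zero]
    · rw [hN u t h, ht, if_pos rfl]
  · simp only [controlOp, Matrix.mul_apply, Matrix.of_apply, ht]
    simp [Matrix.one_apply, ht]

theorem controlOp_one (q : Q) :
    controlOp q (1 : Matrix (Q → Bool) (Q → Bool) ℂ) = 1 := by
  ext s t
  simp [controlOp]

/-- Transposition moves the control from the column to the row index; where these differ in the
control bit, both `M` and the identity vanish. -/
theorem controlOp_conjTranspose {q : Q} {M : Matrix (Q → Bool) (Q → Bool) ℂ} (hM : FixesBit q M) :
    (controlOp q M)ᴴ = controlOp q Mᴴ := by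
  ext s t
  simp only [controlOp, Matrix.conjTranspose_apply, Matrix.of_apply]
  have h1 : star ((1 : Matrix (Q → Bool) (Q → Bool) ℂ) t s) = (1 : Matrix _ _ ℂ) s t := by
    rw [← Matrix.conjTranspose_apply, Matrix.conjTranspose_one]
  by_cases hs : s q = t q
  · rw [hs]; split_ifs
    · rfl
    · exact h1
  · have hM0 : M t s = 0 := by by_contra h; exact hs (hM t s h).symm
    have hst : (1 : Matrix (Q → Bool) (Q → Bool) ℂ) s t = 0 :=
      Matrix.one_apply_ne fun h => hs (by rw [h])
    rw [hst] at h1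
    simp only [hM0, hst, apply_ite star, h1, star_zero, ite_self]

theorem FixesBit.controlOp {q r : Q} {M : Matrix (Q → Bool) (Q → Bool) ℂ} (hM : FixesBit q M) :
    FixesBit q (QAlg.controlOp r M) := by
  intro s t h
  simp only [QAlg.controlOp, Matrix.of_apply] at h
  split_ifs at h
  · exact hM s t h
  · exact FixesBit.one q s t h

theorem controlOp_mulVec {q : Q} {M : Matrix (Q → Bool) (Q → Bool) ℂ} (s : Q → Bool) :
    controlOp q M *ᵥ ket s = if s q = true then M *ᵥ ket s else ket s := by
  funext u
  rw [ket, Matrix.mulVec_single_one]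
  split_ifs with h
  · simp [controlOp, h]
  · simp [controlOp, h, Matrix.one_apply, Pi.single_apply]

/-- The inverse step. -/
def Gate.inv : Gate σ Q → Gate σ Q
  | .single q U => .single q (star U)
  | .cnot c t h => .cnot c t h
  | .query o e i c => .query o e (!i) c

theorem Gate.inv_op (O : Oracles σ) (g : Gate σ Q) : g.inv.op O = (g.op O)ᴴ := by
  match g with
  | .single q U => simp [Gate.inv, Gate.op, singleOp_conjTranspose, Matrix.star_eq_conjTranspose]
  | .cnot c t h => simp [Gate.inv, Gate.op, cnotOp_conjTranspose h]
  | .query o e i none =>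
    cases i <;> simp [Gate.inv, Gate.op, liftOp_conjTranspose]
  | .query o e i (some q) =>
    cases i <;> simp [Gate.inv, Gate.op, liftOp_conjTranspose,
      controlOp_conjTranspose (FixesBit.liftOp e _ q.2)]

theorem Gate.op_mul_inv (O : Oracles σ) (g : Gate σ Q) : g.inv.op O * g.op O = 1 := by
  have hO : ∀ o, (O o : Matrix (σ.Wires o → Bool) (σ.Wires o → Bool) ℂ)ᴴ * (O o).1 = 1 :=
    fun o => Matrix.UnitaryGroup.star_mul_self (O o)
  have hO' : ∀ o, (O o : Matrix (σ.Wires o → Bool) (σ.Wires o → Bool) ℂ) * (O o).1ᴴ = 1 :=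
    fun o => mul_eq_one_comm.mp (hO o)
  match g with
  | .single q U =>
    simp only [Gate.inv, Gate.op, singleOp_mul]
    rw [← singleOp_one q]
    congr 1
    exact Matrix.UnitaryGroup.star_mul_self U
  | .cnot c t h => simp only [Gate.inv, Gate.op, cnotOp_mul_self h]
  | .query o e i none =>
    cases i <;> simp [Gate.inv, Gate.op, liftOp_mul, hO, hO', liftOp_one]
  | .query o e i (some q) =>
    cases i <;> simp [Gate.inv, Gate.op, liftOp_mul, hO, hO', liftOp_one, controlOp_one,
      controlOp_mul (FixesBit.liftOp e _ q.2)]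

/-- The step `g` does not change the qubit `q`, but it may be controlled by it. -/
def Gate.Spares (q : Q) : Gate σ Q → Prop
  | .single r _ => q ≠ r
  | .cnot _ t _ => q ≠ t
  | .query _ e _ _ => q ∉ Set.range e

theorem Gate.Spares.inv {q : Q} {g : Gate σ Q} (h : g.Spares q) : g.inv.Spares q := by
  match g, h with
  | .single r _, h => exact h
  | .cnot _ t _, h => exact h
  | .query _ e _ _, h => exact h

/-- The syntactic condition suffices for every choice of oracles, about which little is known off
the specified inputs. -/
theorem Gate.Spares.fixesBit {q : Q} {g : Gate σ Q} (h : g.Spares q) (O : Oracles σ) :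
    FixesBit q (g.op O) := by
  match g, h with
  | .single r _, h => exact FixesBit.singleOp _ h
  | .cnot _ t _, h => exact FixesBit.cnotOp _ h
  | .query _ e _ none, h => exact FixesBit.liftOp _ _ h
  | .query _ e _ (some q), h => exact FixesBit.controlOp (FixesBit.liftOp _ _ h)

namespace Circuit

/-- The operator of a circuit. -/
noncomputable def mat (O : Oracles σ) : Circuit σ Q → Matrix (Q → Bool) (Q → Bool) ℂ
  | [] => 1
  | g :: gs => mat O gs * g.op O

theorem run_eq_mulVec (O : Oracles σ) (𝒜 : Circuit σ Q) (ψ : State Q) :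
    run O 𝒜 ψ = mat O 𝒜 *ᵥ ψ := by
  induction 𝒜 generalizing ψ with
  | nil => simp [run, mat]
  | cons g gs ih => rw [run, ih, mat, Matrix.mulVec_mulVec]

theorem mat_append (O : Oracles σ) (𝒜 ℬ : Circuit σ Q) :
    mat O (𝒜 ++ ℬ) = mat O ℬ * mat O 𝒜 := by
  induction 𝒜 with
  | nil => simp [mat]
  | cons g gs ih => rw [List.cons_append, mat, ih, mat, mul_assoc]

theorem run_append (O : Oracles σ) (𝒜 ℬ : Circuit σ Q) (ψ : State Q) :
    run O (𝒜 ++ ℬ) ψ = run O ℬ (run O 𝒜 ψ) := by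
  simp [run_eq_mulVec, mat_append]

/-- The inverse circuit. -/
def inv (𝒜 : Circuit σ Q) : Circuit σ Q := (𝒜.map Gate.inv).reverse

theorem length_inv (𝒜 : Circuit σ Q) : (inv 𝒜).length = 𝒜.length := by
  simp [inv]

theorem mat_inv (O : Oracles σ) (𝒜 : Circuit σ Q) : mat O (inv 𝒜) = (mat O 𝒜)ᴴ := by
  induction 𝒜 with
  | nil => simp [inv, mat]
  | cons g gs ih =>
    have : inv (g :: gs) = inv gs ++ [g.inv] := by simp [inv]
    rw [this, mat_append, ih]
    simp only [mat, Matrix.conjTranspose_mul, one_mul, Gate.inv_op]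

theorem conjTranspose_mat_mul (O : Oracles σ) (𝒜 : Circuit σ Q) :
    (mat O 𝒜)ᴴ * mat O 𝒜 = 1 := by
  induction 𝒜 with
  | nil => simp [mat]
  | cons g gs ih =>
    rw [mat, Matrix.conjTranspose_mul, mul_assoc, ← mul_assoc _ _ (g.op O), ih, one_mul,
      ← Gate.inv_op, Gate.op_mul_inv]

theorem run_inv_run (O : Oracles σ) (𝒜 : Circuit σ Q) (ψ : State Q) :
    run O (inv 𝒜) (run O 𝒜 ψ) = ψ := by
  rw [run_eq_mulVec, run_eq_mulVec, Matrix.mulVec_mulVec, mat_inv, conjTranspose_mat_mul,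
    Matrix.one_mulVec]

theorem run_run_inv (O : Oracles σ) (𝒜 : Circuit σ Q) (ψ : State Q) :
    run O 𝒜 (run O (inv 𝒜) ψ) = ψ := by
  rw [run_eq_mulVec, run_eq_mulVec, Matrix.mulVec_mulVec, mat_inv,
    mul_eq_one_comm.mp (conjTranspose_mat_mul O 𝒜), Matrix.one_mulVec]

theorem run_add (O : Oracles σ) (𝒜 : Circuit σ Q) (ψ φ : State Q) :
    run O 𝒜 (ψ + φ) = run O 𝒜 ψ + run O 𝒜 φ := by
  simp [run_eq_mulVec, Matrix.mulVec_add]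

theorem run_sub (O : Oracles σ) (𝒜 : Circuit σ Q) (ψ φ : State Q) :
    run O 𝒜 (ψ - φ) = run O 𝒜 ψ - run O 𝒜 φ := by
  simp [run_eq_mulVec, Matrix.mulVec_sub]

theorem run_smul (O : Oracles σ) (𝒜 : Circuit σ Q) (c : ℂ) (ψ : State Q) :
    run O 𝒜 (c • ψ) = c • run O 𝒜 ψ := by
  simp [run_eq_mulVec, Matrix.mulVec_smul]

theorem run_sum (O : Oracles σ) (𝒜 : Circuit σ Q) {ι : Type*} (S : Finset ι) (ψ : ι → State Q) :
    run O 𝒜 (∑ i ∈ S, ψ i) = ∑ i ∈ S, run O 𝒜 (ψ i) := by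
  simp [run_eq_mulVec, Matrix.mulVec_sum]

/-- The circuit does not change the qubit `q`. -/
def Spares (q : Q) (𝒜 : Circuit σ Q) : Prop := ∀ g ∈ 𝒜, Gate.Spares q g

theorem Spares.append {q : Q} {𝒜 ℬ : Circuit σ Q} (hA : Spares q 𝒜) (hB : Spares q ℬ) :
    Spares q (𝒜 ++ ℬ) := by
  intro g hg
  rcases List.mem_append.mp hg with h | h
  exacts [hA g h, hB g h]

theorem Spares.inv {q : Q} {𝒜 : Circuit σ Q} (hA : Spares q 𝒜) : Spares q (inv 𝒜) := by
  intro g hg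
  simp only [Circuit.inv, List.mem_reverse, List.mem_map] at hg
  obtain ⟨g', hg', rfl⟩ := hg
  exact (hA g' hg').inv

theorem Spares.fixesBit {q : Q} {𝒜 : Circuit σ Q} (hA : Spares q 𝒜) (O : Oracles σ) :
    FixesBit q (mat O 𝒜) := by
  induction 𝒜 with
  | nil => exact FixesBit.one q
  | cons g gs ih =>
    exact FixesBit.mul (ih fun g' h => hA g' (List.mem_cons_of_mem _ h))
      ((hA g List.mem_cons_self).fixesBit O)

theorem Spares.run {q : Q} {𝒜 : Circuit σ Q} (hA : Spares q 𝒜) (O : Oracles σ)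
    {ψ : State Q} {β : Bool} (hψ : ∀ s, ψ s ≠ 0 → s q = β) :
    ∀ s, run O 𝒜 ψ s ≠ 0 → s q = β := by
  rw [run_eq_mulVec]
  exact (hA.fixesBit O).mulVec hψ

/-- The bound `T + 1` covers gates of time `1` as well as queries, also when `T = 0`; hence only the
number of steps has to be counted. -/
theorem time_le_length_mul (T : ℕ) (𝒜 : Circuit σ Q) : time T 𝒜 ≤ 𝒜.length * (T + 1) := by
  induction 𝒜 with
  | nil => simp [time]
  | cons g gs ih =>
    have hg : Gate.time T g ≤ T + 1 := by
      cases g <;> simp [Gate.time]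
    simp only [time, List.map_cons, List.sum_cons, List.length_cons] at ih ⊢
    linarith

end Circuit

/-- The inner product of two states, conjugate linear in the first argument. -/
noncomputable def braket (φ ψ : State Q) : ℂ := star φ ⬝ᵥ ψ

/-- Moving a circuit to the other side turns an amplitude after an uncomputation into an inner
product of two explicit states. -/
theorem braket_run_left (O : Oracles σ) (𝒜 : Circuit σ Q) (φ ψ : State Q) :
    braket (Circuit.run O 𝒜 φ) ψ = braket φ (Circuit.run O (Circuit.inv 𝒜) ψ) := by
  simp only [braket, Circuit.run_eq_mulVec, Circuit.mat_inv, Matrix.star_mulVec,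
    Matrix.dotProduct_mulVec]

theorem braket_run_run (O : Oracles σ) (𝒜 : Circuit σ Q) (φ ψ : State Q) :
    braket (Circuit.run O 𝒜 φ) (Circuit.run O 𝒜 ψ) = braket φ ψ := by
  rw [braket_run_left, Circuit.run_inv_run]

theorem braket_eq_sum (φ ψ : State Q) : braket φ ψ = ∑ s, star (φ s) * ψ s := rfl

theorem braket_ket_left (s : Q → Bool) (ψ : State Q) : braket (ket s) ψ = ψ s := by
  rw [braket, ket, ← Pi.single_star, star_one, single_one_dotProduct]

theorem braket_add_right (φ ψ χ : State Q) : braket φ (ψ + χ) = braket φ ψ + braket φ χ :=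
  dotProduct_add _ _ _

theorem braket_sub_right (φ ψ χ : State Q) : braket φ (ψ - χ) = braket φ ψ - braket φ χ :=
  dotProduct_sub _ _ _

theorem braket_smul_right (c : ℂ) (φ ψ : State Q) : braket φ (c • ψ) = c * braket φ ψ :=
  dotProduct_smul _ _ _

theorem braket_sum_right {ι : Type*} (S : Finset ι) (φ : State Q) (ψ : ι → State Q) :
    braket φ (∑ i ∈ S, ψ i) = ∑ i ∈ S, braket φ (ψ i) := dotProduct_sum _ _ _

theorem star_braket (φ ψ : State Q) : star (braket φ ψ) = braket ψ φ := by
  rw [braket, braket, Matrix.star_dotProduct, star_star]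

theorem braket_smul_left (c : ℂ) (φ ψ : State Q) : braket (c • φ) ψ = star c * braket φ ψ := by
  rw [← star_braket, braket_smul_right, star_mul', star_braket]

theorem braket_sum_left {ι : Type*} (S : Finset ι) (φ : ι → State Q) (ψ : State Q) :
    braket (∑ i ∈ S, φ i) ψ = ∑ i ∈ S, braket (φ i) ψ := by
  rw [← star_braket, braket_sum_right, star_sum]
  simp only [star_braket]

theorem stateNorm_sq_eq_sum (f : State Q) : stateNorm f ^ 2 = ∑ s, ‖f s‖ ^ 2 := by
  rw [stateNorm, EuclideanSpace.norm_eq, Real.sq_sqrt (by positivity)]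

theorem braket_self (f : State Q) : braket f f = ((stateNorm f ^ 2 : ℝ) : ℂ) := by
  rw [stateNorm_sq_eq_sum, braket_eq_sum]
  push_cast
  refine Finset.sum_congr rfl fun s _ => ?_
  rw [← Complex.conj_mul']; rfl

theorem stateNorm_nonneg (f : State Q) : 0 ≤ stateNorm f := norm_nonneg _

theorem stateNorm_run (O : Oracles σ) (𝒜 : Circuit σ Q) (ψ : State Q) :
    stateNorm (Circuit.run O 𝒜 ψ) = stateNorm ψ := by
  have h := braket_run_run O 𝒜 ψ ψ
  rw [braket_self, braket_self] at h
  have h' := Complex.ofReal_injective h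
  exact (pow_left_inj₀ (stateNorm_nonneg _) (stateNorm_nonneg _) two_ne_zero).mp h'

theorem stateNorm_sub_le (f g : State Q) : stateNorm (f - g) ≤ stateNorm f + stateNorm g := by
  unfold stateNorm
  rw [WithLp.toLp_sub]
  exact norm_sub_le _ _

theorem stateNorm_add_le (f g : State Q) : stateNorm (f + g) ≤ stateNorm f + stateNorm g := by
  unfold stateNorm
  rw [WithLp.toLp_add]
  exact norm_add_le _ _

end GateSemantics

end QAlg


namespace QAlg

/-! ### Fejér–Riesz factorisation and signal processing sequences -/

section PolynomialsOnTheCircle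

open Polynomial ComplexConjugate

theorem infinite_unit_circle : {z : ℂ | ‖z‖ = 1}.Infinite := by
  have h : (Metric.sphere (0 : ℂ) 1).Infinite := by
    apply IsPreconnected.infinite_of_nontrivial
    · exact isPreconnected_sphere (by rw [Complex.rank_real_complex]; norm_num) _ _
    · exact ⟨1, by simp, -1, by simp, by norm_num⟩
  refine h.mono fun z hz => ?_
  simpa using hz

theorem eq_of_eval_eq_on_circle {p q : ℂ[X]} (h : ∀ z : ℂ, ‖z‖ = 1 → p.eval z = q.eval z) :
    p = q :=
  Polynomial.eq_of_infinite_eval_eq p q (infinite_unit_circle.mono fun z hz => h z hz)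

/-- The polynomial `z ^ d * conj (p (1 / conj z))`. -/
noncomputable def conjReflect (d : ℕ) (p : ℂ[X]) : ℂ[X] := reflect d (p.map (starRingEnd ℂ))

theorem natDegree_conjReflect_le {d : ℕ} {p : ℂ[X]} (h : p.natDegree ≤ d) :
    (conjReflect d p).natDegree ≤ d := by
  rw [natDegree_le_iff_coeff_eq_zero]
  intro n hn
  rw [conjReflect, coeff_reflect, revAt_eq_self_of_lt hn, coeff_map,
    coeff_eq_zero_of_natDegree_lt (h.trans_lt hn), map_zero]

theorem coeff_conjReflect {d k : ℕ} (hk : k ≤ d) (p : ℂ[X]) :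
    (conjReflect d p).coeff k = conj (p.coeff (d - k)) := by
  rw [conjReflect, coeff_reflect, revAt_le hk, coeff_map]

/-- Reversing the order of summation matches the coefficients term by term. -/
theorem eval_conjReflect {d : ℕ} {p : ℂ[X]} (h : p.natDegree ≤ d) {z : ℂ} (hz : z ≠ 0) :
    (conjReflect d p).eval z = z ^ d * conj (p.eval (conj z)⁻¹) := by
  rw [eval_eq_sum_range' (Nat.lt_succ_of_le (natDegree_conjReflect_le h)),
    eval_eq_sum_range' (Nat.lt_succ_of_le h), map_sum, Finset.mul_sum,
    ← Finset.sum_range_reflect]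
  refine Finset.sum_congr rfl fun k hk => ?_
  have hk' : k ≤ d := Nat.lt_succ_iff.mp (Finset.mem_range.mp hk)
  rw [Nat.succ_eq_add_one, show d + 1 - 1 - k = d - k by omega, coeff_conjReflect (by omega),
    show d - (d - k) = k by omega, map_mul, map_pow, map_inv₀, Complex.conj_conj]
  rw [show z ^ d = z ^ (d - k) * z ^ k by rw [← pow_add]; congr 1; omega]
  have hzk : z ^ k * z⁻¹ ^ k = 1 := by rw [← mul_pow, mul_inv_cancel₀ hz, one_pow]
  linear_combination (-(conj (p.coeff k) * z ^ (d - k))) * hzk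

theorem conj_inv_of_norm_eq_one {z : ℂ} (hz : ‖z‖ = 1) : (conj z)⁻¹ = z := by
  rw [Complex.inv_def, Complex.normSq_conj, Complex.normSq_eq_norm_sq, hz]
  simp

theorem eval_conjReflect_of_norm_eq_one {d : ℕ} {p : ℂ[X]} (h : p.natDegree ≤ d) {z : ℂ}
    (hz : ‖z‖ = 1) : (conjReflect d p).eval z = z ^ d * conj (p.eval z) := by
  rw [eval_conjReflect h (by rw [← norm_pos_iff, hz]; exact one_pos), conj_inv_of_norm_eq_one hz]

/-- The Fejér–Riesz theorem for trigonometric polynomials that are positive on the circle. -/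
theorem fejer_riesz (N : ℕ) (p : ℂ[X]) (hdeg : p.natDegree ≤ 2 * N)
    (hp : ∀ z : ℂ, ‖z‖ = 1 → ∃ x : ℝ, 0 < x ∧ p.eval z = x * z ^ N) :
    ∃ q : ℂ[X], q.natDegree ≤ N ∧ ∀ z : ℂ, ‖z‖ = 1 → p.eval z = (‖q.eval z‖ ^ 2 : ℝ) * z ^ N := by
  induction N generalizing p with
  | zero =>
    obtain ⟨a, rfl⟩ : ∃ a, p = C a := ⟨_, eq_C_of_natDegree_le_zero hdeg⟩
    obtain ⟨x, hx, hxa⟩ := hp 1 (by simp)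
    refine ⟨C ((Real.sqrt x : ℝ) : ℂ), by simp, fun z hz => ?_⟩
    simp only [eval_C, pow_zero, mul_one] at hxa ⊢
    rw [hxa, Complex.norm_real, Real.norm_eq_abs, sq_abs, Real.sq_sqrt hx.le]
  | succ N ih =>
    -- Since $p(z)z^{-(N+1)}$ is real on the circle, `p` is its own conjugate reflection:
    -- coefficients pair up, and so do roots $\alpha$, $1/\bar\alpha$.
    have hrefl : conjReflect (2 * (N + 1)) p = p := by
      refine eq_of_eval_eq_on_circle fun z hz => ?_
      obtain ⟨x, hx, hxz⟩ := hp z hz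
      have hz0 : z ≠ 0 := by rw [← norm_pos_iff, hz]; exact one_pos
      have hc : conj z * z = 1 := by rw [Complex.conj_mul', hz]; simp
      rw [eval_conjReflect_of_norm_eq_one hdeg hz, hxz, map_mul, map_pow, Complex.conj_ofReal,
        two_mul, pow_add]
      calc z ^ (N + 1) * z ^ (N + 1) * (x * conj z ^ (N + 1))
          = x * z ^ (N + 1) * (conj z * z) ^ (N + 1) := by rw [mul_pow]; ring
        _ = x * z ^ (N + 1) := by rw [hc]; simp
    -- If the lowest coefficient vanishes, so does the highest, and division by $z$ lowers `N`.
    -- Otherwise a root $\alpha\ne0$ is removed together with its mirror image.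
    by_cases h0 : p.coeff 0 = 0
    · have htop : p.coeff (2 * (N + 1)) = 0 := by
        rw [← hrefl, coeff_conjReflect le_rfl, Nat.sub_self, h0, map_zero]
      have hX : p.divX * X = p := by
        have := divX_mul_X_add p
        rwa [h0, map_zero, add_zero] at this
      have hd : p.divX.natDegree ≤ 2 * N := by
        rw [natDegree_le_iff_coeff_eq_zero]
        intro n hn
        rw [coeff_divX]
        rcases Nat.lt_or_ge (2 * (N + 1)) (n + 1) with h | h
        · exact coeff_eq_zero_of_natDegree_lt (hdeg.trans_lt h)
        · rw [show n + 1 = 2 * (N + 1) by omega, htop]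
      have hev : ∀ z : ℂ, p.eval z = p.divX.eval z * z := fun z => by
        conv_lhs => rw [← hX]
        simp
      obtain ⟨q, hq, hqz⟩ := ih p.divX hd fun z hz => by
        obtain ⟨x, hx, hxz⟩ := hp z hz
        have hz0 : z ≠ 0 := by rw [← norm_pos_iff, hz]; exact one_pos
        refine ⟨x, hx, mul_right_cancel₀ hz0 ?_⟩
        rw [← hev, hxz]; ring
      refine ⟨q, by omega, fun z hz => ?_⟩
      rw [hev, hqz z hz]; ring
    · have htop : p.coeff (2 * (N + 1)) ≠ 0 := by
        rw [← hrefl, coeff_conjReflect le_rfl, Nat.sub_self]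
        simpa using h0
      have hdeg' : p.natDegree ≠ 0 := by
        have := le_natDegree_of_ne_zero htop
        omega
      obtain ⟨α, hα⟩ := IsAlgClosed.exists_root p (fun h => hdeg' (natDegree_eq_of_degree_eq_some h))
      have hα0 : α ≠ 0 := by
        rintro rfl
        rw [IsRoot, ← coeff_zero_eq_eval_zero] at hα
        exact h0 hα
      -- Strict positivity excludes roots on the circle, so $\alpha$ and $1/\bar\alpha$ are
      -- distinct.
      have hα1 : ‖α‖ ≠ 1 := by
        intro h
        obtain ⟨x, hx, hxz⟩ := hp α h
        rw [IsRoot] at hα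
        rw [hα] at hxz
        have : (x : ℂ) * α ^ (N + 1) ≠ 0 :=
          mul_ne_zero (by exact_mod_cast hx.ne') (pow_ne_zero _ hα0)
        exact this hxz.symm
      have hcα : conj α ≠ 0 := by simpa using hα0
      have hβ : p.eval (conj α)⁻¹ = 0 := by
        have h := eval_conjReflect hdeg (inv_ne_zero hcα)
        rw [hrefl, map_inv₀, Complex.conj_conj, inv_inv, hα, map_zero, mul_zero] at h
        exact h
      obtain ⟨p₁, hp₁⟩ := dvd_iff_isRoot.mpr hα
      have hβα : (conj α)⁻¹ - α ≠ 0 := by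
        intro h
        rw [sub_eq_zero, inv_eq_iff_eq_inv] at h
        have h2 : conj α * α = 1 := by rw [h, inv_mul_cancel₀ hα0]
        rw [Complex.conj_mul'] at h2
        have h3 : ‖α‖ ^ 2 = 1 := by exact_mod_cast h2
        exact hα1 ((pow_eq_one_iff_of_nonneg (norm_nonneg _) two_ne_zero).mp h3)
      have hβ₁ : p₁.IsRoot (conj α)⁻¹ := by
        rw [hp₁, eval_mul, eval_sub, eval_X, eval_C] at hβ
        exact (mul_eq_zero.mp hβ).resolve_left hβα
      obtain ⟨p₂, hp₂⟩ := dvd_iff_isRoot.mpr hβ₁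
      have hp0 : p ≠ 0 := fun h => hdeg' (by rw [h, natDegree_zero])
      have hp₂0 : p₂ ≠ 0 := by
        rintro rfl
        exact hp0 (by rw [hp₁, hp₂]; simp)
      have hd₂ : p₂.natDegree ≤ 2 * N := by
        have : p.natDegree = 1 + (1 + p₂.natDegree) := by
          rw [hp₁, hp₂, natDegree_mul (X_sub_C_ne_zero _) (mul_ne_zero (X_sub_C_ne_zero _) hp₂0),
            natDegree_mul (X_sub_C_ne_zero _) hp₂0, natDegree_X_sub_C, natDegree_X_sub_C]
        omega
      have hne : ∀ z : ℂ, ‖z‖ = 1 → ‖z - α‖ ≠ 0 := fun z hz h => hα1 (by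
        rw [norm_eq_zero, sub_eq_zero] at h
        rw [← h, hz])
      -- On the circle $(z-\alpha)(z-1/\bar\alpha)=-\bar\alpha^{-1}|z-\alpha|^2z$, so the remaining
      -- quotient, scaled by $-\bar\alpha^{-1}$, is positive again.
      have hev : ∀ z : ℂ, ‖z‖ = 1 →
          p.eval z = (C (-(conj α)⁻¹) * p₂).eval z * (‖z - α‖ ^ 2 : ℝ) * z := fun z hz => by
        have hc : conj z * z = 1 := by rw [Complex.conj_mul', hz]; simp
        rw [hp₁, hp₂]
        simp only [eval_mul, eval_sub, eval_X, eval_C]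
        push_cast
        rw [← Complex.conj_mul', map_sub]
        have h1 : z - (conj α)⁻¹ = -(conj α)⁻¹ * ((conj z - conj α) * z) := by
          rw [sub_mul, hc]; field_simp; ring
        rw [h1]; ring
      obtain ⟨q, hq, hqz⟩ := ih (C (-(conj α)⁻¹) * p₂) ((natDegree_C_mul_le _ _).trans hd₂)
        fun z hz => by
          obtain ⟨x, hx, hxz⟩ := hp z hz
          have hz0 : z ≠ 0 := by rw [← norm_pos_iff, hz]; exact one_pos
          have hpos : 0 < ‖z - α‖ := lt_of_le_of_ne (norm_nonneg _) (hne z hz).symm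
          refine ⟨x / ‖z - α‖ ^ 2, by positivity, ?_⟩
          have h2 : ((‖z - α‖ ^ 2 : ℝ) : ℂ) ≠ 0 := by exact_mod_cast (pow_pos hpos 2).ne'
          refine mul_right_cancel₀ (mul_ne_zero h2 hz0) ?_
          rw [← mul_assoc, ← hev z hz, hxz, Complex.ofReal_div, pow_succ]
          generalize ((‖z - α‖ ^ 2 : ℝ) : ℂ) = D at h2 ⊢
          field_simp
      refine ⟨(X - C α) * q, ?_, fun z hz => ?_⟩
      · refine natDegree_mul_le.trans ?_
        rw [natDegree_X_sub_C]; omega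
      · rw [hev z hz, hqz z hz]
        simp only [eval_mul, eval_sub, eval_X, eval_C, norm_mul]
        push_cast
        ring

/-- On the circle, $z^d$ minus the product of $P$ and its conjugate reflection equals
$(1-|P|^2)z^d$, to which `fejer_riesz` applies. The strict bound on $P$ gives the positivity needed
there. -/
theorem exists_complement {d : ℕ} {P : ℂ[X]} (hd : P.natDegree ≤ d)
    (hP : ∀ z : ℂ, ‖z‖ = 1 → ‖P.eval z‖ < 1) :
    ∃ Q : ℂ[X], Q.natDegree ≤ d ∧ ∀ z : ℂ, ‖z‖ = 1 → ‖P.eval z‖ ^ 2 + ‖Q.eval z‖ ^ 2 = 1 := by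
  have hev : ∀ z : ℂ, ‖z‖ = 1 →
      (X ^ d - P * conjReflect d P).eval z = ((1 - ‖P.eval z‖ ^ 2 : ℝ) : ℂ) * z ^ d := by
    intro z hz
    rw [eval_sub, eval_pow, eval_X, eval_mul, eval_conjReflect_of_norm_eq_one hd hz]
    push_cast
    rw [← Complex.conj_mul']
    ring
  obtain ⟨Q, hQ, hQz⟩ := fejer_riesz d (X ^ d - P * conjReflect d P)
    (by
      refine (natDegree_sub_le _ _).trans (max_le ?_ ?_)
      · rw [natDegree_X_pow]; omega
      · refine natDegree_mul_le.trans ?_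
        have := natDegree_conjReflect_le hd
        omega)
    (fun z hz => ⟨1 - ‖P.eval z‖ ^ 2, by
      have := hP z hz
      nlinarith [norm_nonneg (P.eval z)], hev z hz⟩)
  refine ⟨Q, hQ, fun z hz => ?_⟩
  have hz0 : z ^ d ≠ 0 := pow_ne_zero _ (by rw [← norm_pos_iff, hz]; exact one_pos)
  have h := (hev z hz).symm.trans (hQz z hz)
  have h' := Complex.ofReal_injective (mul_right_cancel₀ hz0 h)
  linarith

/-- The unitary matrix with first column `(α, β)`. -/
noncomputable def columnUnitary (α β : ℂ) (h : conj α * α + conj β * β = 1) :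
    Matrix.unitaryGroup Bool ℂ :=
  ⟨Matrix.of fun r c => match r, c with
    | false, false => α
    | true, false => β
    | false, true => -conj β
    | true, true => conj α, by
    rw [Matrix.mem_unitaryGroup_iff']
    ext r c
    rw [Matrix.mul_apply, Fintype.sum_bool]
    cases r <;> cases c <;> simp [Matrix.star_apply] <;>
      first | linear_combination h | ring⟩

/-- The polynomials `(P, Q)` with `(P(z), Q(z)) = R_d D(z) ⋯ R₁ D(z) R₀ (1, 0)`, where `D(z)` is the
diagonal matrix with entries `z` and `1`; the list is in the order `R_d, …, R₁`. -/
noncomputable def signalPair (R₀ : Matrix.unitaryGroup Bool ℂ) :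
    List (Matrix.unitaryGroup Bool ℂ) → ℂ[X] × ℂ[X]
  | [] => (C (R₀.1 false false), C (R₀.1 true false))
  | R :: Rs =>
    (C (R.1 false false) * (X * (signalPair R₀ Rs).1) + C (R.1 false true) * (signalPair R₀ Rs).2,
      C (R.1 true false) * (X * (signalPair R₀ Rs).1) + C (R.1 true true) * (signalPair R₀ Rs).2)

/-- The hypothesis makes $(a,b)$ and $(c,d)$ orthogonal, so a unit vector parallel to $(c,d)$ works;
if that vector is zero, one orthogonal to $(a,b)$ does. -/
theorem exists_unit_orthogonal {a b c d : ℂ} (h : conj a * c + conj b * d = 0) :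
    ∃ α β : ℂ, conj α * α + conj β * β = 1 ∧ conj α * a + conj β * b = 0 ∧ α * d - β * c = 0 := by
  have normalise : ∀ x y : ℂ, ¬(x = 0 ∧ y = 0) → ∃ r : ℝ, r ≠ 0 ∧
      conj (r * x) * (r * x) + conj (r * y) * (r * y) = 1 := by
    intro x y hxy
    have hpos : 0 < ‖x‖ ^ 2 + ‖y‖ ^ 2 := by
      by_contra hle
      have hx : ‖x‖ ^ 2 = 0 := by nlinarith [sq_nonneg ‖x‖, sq_nonneg ‖y‖]
      have hy : ‖y‖ ^ 2 = 0 := by nlinarith [sq_nonneg ‖x‖, sq_nonneg ‖y‖]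
      exact hxy ⟨by simpa using hx, by simpa using hy⟩
    refine ⟨(Real.sqrt (‖x‖ ^ 2 + ‖y‖ ^ 2))⁻¹, inv_ne_zero (Real.sqrt_pos.mpr hpos).ne', ?_⟩
    rw [Complex.conj_mul', Complex.conj_mul']
    norm_cast
    rw [norm_mul, norm_mul, Complex.norm_real, Real.norm_eq_abs, mul_pow, mul_pow, sq_abs, inv_pow,
      Real.sq_sqrt hpos.le, ← mul_add, inv_mul_cancel₀ hpos.ne']
  by_cases hcd : c = 0 ∧ d = 0
  · obtain ⟨rfl, rfl⟩ := hcd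
    by_cases hab : a = 0 ∧ b = 0
    · obtain ⟨rfl, rfl⟩ := hab
      exact ⟨1, 0, by simp, by simp, by simp⟩
    · obtain ⟨r, hr, hr1⟩ := normalise (-conj b) (conj a) (by
        simpa [and_comm] using hab)
      refine ⟨r * (-conj b), r * conj a, hr1, ?_, by simp⟩
      simp only [map_mul, map_neg, Complex.conj_conj, Complex.conj_ofReal]
      ring
  · obtain ⟨r, hr, hr1⟩ := normalise c d hcd
    refine ⟨r * c, r * d, hr1, ?_, by ring⟩
    have h' := congrArg conj h
    simp only [map_add, map_mul, Complex.conj_conj, map_zero] at h'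
    simp only [map_mul, Complex.conj_ofReal]
    linear_combination (r : ℂ) * h'

/-- Peel off one unitary at a time. The vectors of lowest and of highest coefficients of $(P,Q)$ are
orthogonal, so one rotation makes the first component divisible by $z$ and at the same time lowers
the degree of the second. -/
theorem exists_signalPair (d : ℕ) (P Q : ℂ[X]) (hP : P.natDegree ≤ d) (hQ : Q.natDegree ≤ d)
    (h : ∀ z : ℂ, ‖z‖ = 1 → ‖P.eval z‖ ^ 2 + ‖Q.eval z‖ ^ 2 = 1) :
    ∃ (R₀ : Matrix.unitaryGroup Bool ℂ) (Rs : List (Matrix.unitaryGroup Bool ℂ)),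
      Rs.length = d ∧ signalPair R₀ Rs = (P, Q) := by
  induction d generalizing P Q with
  | zero =>
    obtain ⟨a, rfl⟩ : ∃ a, P = C a := ⟨_, eq_C_of_natDegree_le_zero hP⟩
    obtain ⟨b, rfl⟩ : ∃ b, Q = C b := ⟨_, eq_C_of_natDegree_le_zero hQ⟩
    have h1 := h 1 (by simp)
    rw [eval_C, eval_C] at h1
    refine ⟨columnUnitary a b ?_, [], rfl, rfl⟩
    rw [Complex.conj_mul', Complex.conj_mul']
    exact_mod_cast h1
  | succ d ih =>
    have hpoly : P * conjReflect (d + 1) P + Q * conjReflect (d + 1) Q = X ^ (d + 1) := by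
      refine eq_of_eval_eq_on_circle fun z hz => ?_
      have h1 : conj (P.eval z) * P.eval z + conj (Q.eval z) * Q.eval z = 1 := by
        rw [Complex.conj_mul', Complex.conj_mul']
        exact_mod_cast h z hz
      rw [eval_add, eval_mul, eval_mul, eval_conjReflect_of_norm_eq_one hP hz,
        eval_conjReflect_of_norm_eq_one hQ hz, eval_pow, eval_X]
      linear_combination z ^ (d + 1) * h1
    -- Compare the coefficients of $z^{2(d+1)}$, which is zero on the right since $d+1>0$.
    have hcoeff : P.coeff (d + 1) * conj (P.coeff 0) + Q.coeff (d + 1) * conj (Q.coeff 0) = 0 := by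
      have h2 := congrArg (fun p => p.coeff ((d + 1) + (d + 1))) hpoly
      simp only [coeff_add] at h2
      rw [coeff_mul_add_eq_of_natDegree_le hP (natDegree_conjReflect_le hP),
        coeff_mul_add_eq_of_natDegree_le hQ (natDegree_conjReflect_le hQ),
        coeff_conjReflect le_rfl, coeff_conjReflect le_rfl, Nat.sub_self, coeff_X_pow,
        if_neg (by omega)] at h2
      exact h2
    obtain ⟨α, β, hu, h0, htop⟩ := exists_unit_orthogonal (a := P.coeff 0) (b := Q.coeff 0)
      (c := P.coeff (d + 1)) (d := Q.coeff (d + 1)) (by linear_combination hcoeff)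
    set P₁ := C (conj α) * P + C (conj β) * Q with hP₁
    set Q₁ := C α * Q - C β * P with hQ₁
    have hX : P₁.divX * X = P₁ := by
      have := divX_mul_X_add P₁
      rwa [show P₁.coeff 0 = 0 by simp [hP₁, h0], map_zero, add_zero] at this
    have hPd : P₁.divX.natDegree ≤ d := by
      rw [natDegree_divX_eq_natDegree_tsub_one]
      have : P₁.natDegree ≤ d + 1 := (natDegree_add_le _ _).trans
        (max_le ((natDegree_C_mul_le _ _).trans hP) ((natDegree_C_mul_le _ _).trans hQ))
      omega
    have hQd : Q₁.natDegree ≤ d := by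
      rw [natDegree_le_iff_coeff_eq_zero]
      intro n hn
      rw [hQ₁, coeff_sub, coeff_C_mul, coeff_C_mul]
      rcases Nat.lt_or_ge (d + 1) n with h | h
      · rw [coeff_eq_zero_of_natDegree_lt (hP.trans_lt h),
          coeff_eq_zero_of_natDegree_lt (hQ.trans_lt h)]
        simp
      · rw [show n = d + 1 by omega]; exact htop
    obtain ⟨R₀, Rs, hl, hRs⟩ := ih P₁.divX Q₁ hPd hQd fun z hz => by
      have h1 : P₁.eval z = P₁.divX.eval z * z := by
        conv_lhs => rw [← hX]
        simp
      have h2 : ‖P₁.divX.eval z‖ = ‖P₁.eval z‖ := by rw [h1, norm_mul, hz, mul_one]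
      have h3 : conj (P.eval z) * P.eval z + conj (Q.eval z) * Q.eval z = 1 := by
        rw [Complex.conj_mul', Complex.conj_mul']
        exact_mod_cast h z hz
      rw [h2]
      have h4 : conj (P₁.eval z) * P₁.eval z + conj (Q₁.eval z) * Q₁.eval z = 1 := by
        simp only [hP₁, hQ₁, eval_add, eval_sub, eval_mul, eval_C, map_add, map_sub, map_mul,
          Complex.conj_conj]
        linear_combination h3 + (conj (P.eval z) * P.eval z + conj (Q.eval z) * Q.eval z) * hu
      rw [Complex.conj_mul', Complex.conj_mul'] at h4
      exact_mod_cast h4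
    refine ⟨R₀, columnUnitary α β hu :: Rs, by rw [List.length_cons, hl], ?_⟩
    have hC : C α * C (conj α) + C β * C (conj β) = (1 : ℂ[X]) := by
      rw [← C_mul, ← C_mul, ← C_add, ← C_1]
      congr 1
      linear_combination hu
    rw [signalPair, hRs]
    simp only [columnUnitary, Matrix.of_apply, map_neg]
    rw [mul_comm X, hX, hP₁, hQ₁]
    refine Prod.ext ?_ ?_
    · simp only
      linear_combination P * hC
    · simp only
      linear_combination Q * hC

end PolynomialsOnTheCircle

end QAlg


namespace QAlg

/-! ### The smoothed square wave and the amplifying polynomial -/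

section SquareWave

open Finset Polynomial

/-- The squared modulus of the trigonometric polynomial with coefficients `g`. -/
noncomputable def trigKernel (n : ℕ) (g : ℕ → ℝ) (t : ℝ) : ℝ :=
  ∑ k ∈ range n, ∑ l ∈ range n, g k * g l * Real.cos (((k : ℝ) - l) * t)

theorem trigKernel_eq_norm_sq (n : ℕ) (g : ℕ → ℝ) (t : ℝ) :
    trigKernel n g t = ‖∑ k ∈ range n, (g k : ℂ) * Complex.exp (Complex.I * t) ^ k‖ ^ 2 := by
  have hexp : ∀ k : ℕ, (g k : ℂ) * Complex.exp (Complex.I * t) ^ k =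
      ((g k * Real.cos (k * t) : ℝ) : ℂ) + ((g k * Real.sin (k * t) : ℝ) : ℂ) * Complex.I := by
    intro k
    rw [← Complex.exp_nat_mul, show (k : ℂ) * (Complex.I * t) = ((k * t : ℝ) : ℂ) * Complex.I by
      push_cast; ring, Complex.exp_mul_I]
    push_cast
    ring
  rw [sum_congr rfl fun k _ => hexp k, sum_add_distrib, ← sum_mul, ← Complex.ofReal_sum,
    ← Complex.ofReal_sum, Complex.sq_norm, Complex.normSq_add_mul_I, sq, sq, sum_mul_sum,
    sum_mul_sum, ← sum_add_distrib, trigKernel]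
  refine sum_congr rfl fun k _ => ?_
  rw [← sum_add_distrib]
  refine sum_congr rfl fun l _ => ?_
  rw [sub_mul, Real.cos_sub]
  ring

theorem trigKernel_nonneg (n : ℕ) (g : ℕ → ℝ) (t : ℝ) : 0 ≤ trigKernel n g t := by
  rw [trigKernel_eq_norm_sq]; positivity

/-- The points of a regular grid with `2 n` points that lie in the upper half of the circle. -/
noncomputable def gridAngle (n j : ℕ) : ℝ := Real.pi * (2 * j + 1) / (2 * n)

theorem cos_int_mul_add_pi (m : ℤ) (t : ℝ) :
    Real.cos (m * (t + Real.pi)) = (-1) ^ m * Real.cos (m * t) := by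
  rw [mul_add, Real.cos_add_int_mul_pi]

theorem sin_int_mul_add_pi (m : ℤ) (t : ℝ) :
    Real.sin (m * (t + Real.pi)) = (-1) ^ m * Real.sin (m * t) := by
  rw [mul_add, Real.sin_add_int_mul_pi]

/-- Up to a phase this is the full geometric sum of an `n`-th root of unity different from `1`. -/
theorem sum_exp_even_gridAngle {n : ℕ} (hn : 0 < n) {m : ℤ} (hm : ¬((n : ℤ) ∣ m)) :
    ∑ j ∈ range n, Complex.exp (Complex.I * ((2 * m : ℤ) * gridAngle n j : ℝ)) = 0 := by
  have hn0 : (n : ℂ) ≠ 0 := by exact_mod_cast hn.ne'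
  have hζ := Complex.isPrimitiveRoot_exp n hn.ne'
  set ζ := Complex.exp (2 * Real.pi * Complex.I / n) with hζ'
  have h1 : ζ ^ m ≠ 1 := fun h => hm ((hζ.zpow_eq_one_iff_dvd m).mp h)
  have hterm : ∀ j : ℕ, Complex.exp (Complex.I * ((2 * m : ℤ) * gridAngle n j : ℝ)) =
      Complex.exp (Complex.I * (m * Real.pi / n)) * (ζ ^ m) ^ j := by
    intro j
    rw [hζ', ← Complex.exp_int_mul, ← Complex.exp_nat_mul, ← Complex.exp_add, gridAngle]
    congr 1
    push_cast
    field_simp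
    ring
  rw [sum_congr rfl fun j _ => hterm j, ← mul_sum]
  have h2 : (∑ j ∈ range n, (ζ ^ m) ^ j) * (ζ ^ m - 1) = 0 := by
    rw [geom_sum_mul, ← zpow_natCast, ← zpow_mul, mul_comm, zpow_mul, zpow_natCast, hζ.pow_eq_one,
      one_zpow, sub_self]
  rw [(mul_eq_zero.mp h2).resolve_right (sub_ne_zero.mpr h1), mul_zero]

/-- Odd frequencies cancel between antipodal points; an even frequency below $2n$ is a nontrivial
character on the `n` upper points. -/
theorem sum_cos_gridAngle {n : ℕ} (hn : 0 < n) {m : ℤ} (hm0 : m ≠ 0) (hm : |m| < 2 * n) (θ : ℝ) :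
    ∑ j ∈ range n, (Real.cos (m * (θ - gridAngle n j)) +
      Real.cos (m * (θ - gridAngle n j + Real.pi))) = 0 := by
  rcases Int.even_or_odd m with he | ho
  · obtain ⟨m', rfl⟩ := he
    have hd : ¬((n : ℤ) ∣ -m') := by
      rintro ⟨c, hc⟩
      have hc0 : c ≠ 0 := by rintro rfl; omega
      have h1 : 1 ≤ |c| := Int.one_le_abs hc0
      have h2 : |m'| = n * |c| := by rw [← abs_neg, hc, abs_mul, Nat.abs_cast]
      have h3 : |m' + m'| = 2 * |m'| := by rw [← two_mul, abs_mul]; rfl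
      nlinarith
    have hsum := congrArg (fun z : ℂ => (Complex.exp (Complex.I * ((m' + m' : ℤ) * θ : ℝ)) * z).re)
      (sum_exp_even_gridAngle hn hd)
    simp only [mul_zero, Complex.zero_re, mul_sum, Complex.re_sum, ← Complex.exp_add] at hsum
    have hterm : ∀ j ∈ range n, (Complex.exp (Complex.I * ((m' + m' : ℤ) * θ : ℝ) +
        Complex.I * ((2 * -m' : ℤ) * gridAngle n j : ℝ))).re =
        Real.cos ((m' + m' : ℤ) * (θ - gridAngle n j)) := by
      intro j _
      rw [← mul_add, ← Complex.ofReal_add, mul_comm Complex.I, Complex.exp_ofReal_mul_I_re]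
      congr 1
      push_cast
      ring
    rw [sum_congr rfl hterm] at hsum
    simp only [cos_int_mul_add_pi, Even.neg_one_zpow (Even.add_self m'), one_mul]
    rw [sum_add_distrib, hsum, add_zero]
  · refine sum_eq_zero fun j _ => ?_
    rw [cos_int_mul_add_pi, Odd.neg_one_zpow ho]
    ring

/-- Parseval on the grid of $2n$ points: all off-diagonal frequencies are below $2n$ in modulus and
average to zero. -/
theorem sum_trigKernel_gridAngle {n N : ℕ} (hN : N ≤ n) (hn : 0 < n) (g : ℕ → ℝ) (θ : ℝ) :
    ∑ j ∈ range n, (trigKernel N g (θ - gridAngle n j) +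
      trigKernel N g (θ - gridAngle n j + Real.pi)) = 2 * n * ∑ k ∈ range N, g k ^ 2 := by
  simp only [trigKernel, ← sum_add_distrib, ← mul_add]
  rw [sum_comm, mul_sum]
  refine sum_congr rfl fun k hk => ?_
  rw [sum_comm, sum_eq_single k]
  · simp only [sub_self, zero_mul, Real.cos_zero, sum_const, card_range, nsmul_eq_mul]
    ring
  · intro l hl hlk
    have h := sum_cos_gridAngle hn (m := (k : ℤ) - l) (by omega)
      (by rw [mem_range] at hk hl; rw [abs_lt]; omega) θ
    push_cast at h
    rw [← mul_sum, h, mul_zero]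
  · intro h; exact absurd hk h

/-- The odd moments of the square wave on the grid. -/
noncomputable def squareMoment (n : ℕ) (m : ℤ) : ℝ :=
  ∑ j ∈ range n, (Real.sin (m * gridAngle n j) - Real.sin (m * (gridAngle n j + Real.pi)))

theorem squareMoment_of_even (n : ℕ) {m : ℤ} (hm : Even m) : squareMoment n m = 0 := by
  refine sum_eq_zero fun j _ => ?_
  rw [sin_int_mul_add_pi, Even.neg_one_zpow hm]
  ring

theorem squareMoment_neg (n : ℕ) (m : ℤ) : squareMoment n (-m) = -squareMoment n m := by
  rw [squareMoment, squareMoment, ← sum_neg_distrib]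
  refine sum_congr rfl fun j _ => ?_
  push_cast
  rw [neg_mul, neg_mul, Real.sin_neg, Real.sin_neg]
  ring

/-- The square wave is odd. Even frequencies cancel antipodally, odd ones under $j\mapsto n-1-j$,
which sends an angle $t$ to $\pi-t$. -/
theorem sum_cos_square_gridAngle {n : ℕ} (hn : 0 < n) (m : ℤ) :
    ∑ j ∈ range n, (Real.cos (m * gridAngle n j) - Real.cos (m * (gridAngle n j + Real.pi))) =
      0 := by
  rcases Int.even_or_odd m with he | ho
  · refine sum_eq_zero fun j _ => ?_
    rw [cos_int_mul_add_pi, Even.neg_one_zpow he]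
    ring
  · simp only [cos_int_mul_add_pi, Odd.neg_one_zpow ho]
    set f : ℕ → ℝ := fun j => Real.cos (m * gridAngle n j) - -1 * Real.cos (m * gridAngle n j)
    have hn0 : (n : ℝ) ≠ 0 := by exact_mod_cast hn.ne'
    have h : ∀ j ∈ range n, f (n - 1 - j) = -f j := by
      intro j hj
      rw [mem_range] at hj
      have h1 : gridAngle n (n - 1 - j) = -gridAngle n j + Real.pi := by
        have : ((n - 1 - j : ℕ) : ℝ) = n - 1 - j := by
          rw [Nat.cast_sub (by omega), Nat.cast_sub (by omega), Nat.cast_one]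
        rw [gridAngle, gridAngle, this]
        field_simp
        ring
      simp only [f]
      rw [h1, cos_int_mul_add_pi, Odd.neg_one_zpow ho, mul_neg, Real.cos_neg]
      ring
    have h2 := sum_range_reflect f n
    rw [sum_congr rfl h, sum_neg_distrib] at h2
    linarith

/-- The convolution of the kernel with the square wave. -/
noncomputable def squareWave (n : ℕ) (g : ℕ → ℝ) (θ : ℝ) : ℝ :=
  (2 * n * ∑ k ∈ range n, g k ^ 2)⁻¹ * ∑ j ∈ range n, (trigKernel n g (θ - gridAngle n j) -
    trigKernel n g (θ - gridAngle n j + Real.pi))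

/-- The coefficients of the convolution. -/
noncomputable def squareWaveCoeff (n : ℕ) (g : ℕ → ℝ) (k l : ℕ) : ℝ :=
  (2 * n * ∑ k ∈ range n, g k ^ 2)⁻¹ * (g k * g l * squareMoment n ((k : ℤ) - l))

/-- Expand the cosine of the difference of angles; the cosine moments of the square wave vanish, so
only sines remain. -/
theorem squareWave_eq_sum {n : ℕ} (hn : 0 < n) (g : ℕ → ℝ) (θ : ℝ) :
    squareWave n g θ =
      ∑ k ∈ range n, ∑ l ∈ range n, squareWaveCoeff n g k l * Real.sin (((k : ℝ) - l) * θ) := by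
  simp only [squareWave, squareWaveCoeff, trigKernel, ← sum_sub_distrib, ← mul_sub, mul_assoc,
    ← mul_sum]
  congr 1
  rw [sum_comm]
  refine sum_congr rfl fun k _ => ?_
  rw [← mul_sum]
  congr 1
  rw [sum_comm]
  refine sum_congr rfl fun l _ => ?_
  rw [← mul_sum]
  congr 1
  have hc := sum_cos_square_gridAngle hn ((k : ℤ) - l)
  have hterm : ∀ j ∈ range n, Real.cos (((k : ℝ) - l) * (θ - gridAngle n j)) -
      Real.cos (((k : ℝ) - l) * (θ - gridAngle n j + Real.pi)) =
      Real.cos (((k : ℝ) - l) * θ) * (Real.cos (((k : ℤ) - l : ℤ) * gridAngle n j) -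
        Real.cos (((k : ℤ) - l : ℤ) * (gridAngle n j + Real.pi))) +
      Real.sin (((k : ℝ) - l) * θ) * (Real.sin (((k : ℤ) - l : ℤ) * gridAngle n j) -
        Real.sin (((k : ℤ) - l : ℤ) * (gridAngle n j + Real.pi))) := by
    intro j _
    have h1 := cos_int_mul_add_pi ((k : ℤ) - l) (θ - gridAngle n j)
    have h2 := cos_int_mul_add_pi ((k : ℤ) - l) (gridAngle n j)
    have h3 := sin_int_mul_add_pi ((k : ℤ) - l) (gridAngle n j)
    push_cast at h1 h2 h3 ⊢
    rw [h1, h2, h3, mul_sub, Real.cos_sub]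
    ring
  rw [sum_congr rfl hterm, sum_add_distrib, ← mul_sum, ← mul_sum, hc, mul_zero, zero_add,
    squareMoment, mul_comm]

/-- The coefficients are antisymmetric in `k` and `l`, the cosine is symmetric. This exact vanishing
later removes the component orthogonal to the target. -/
theorem sum_squareWaveCoeff_mul_cos (n : ℕ) (g : ℕ → ℝ) (θ : ℝ) :
    ∑ k ∈ range n, ∑ l ∈ range n, squareWaveCoeff n g k l * Real.cos (((k : ℝ) - l) * θ) = 0 := by
  have h : ∑ k ∈ range n, ∑ l ∈ range n, squareWaveCoeff n g k l * Real.cos (((k : ℝ) - l) * θ) =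
      -∑ k ∈ range n, ∑ l ∈ range n, squareWaveCoeff n g k l * Real.cos (((k : ℝ) - l) * θ) := by
    conv_lhs => rw [sum_comm]
    simp only [← sum_neg_distrib]
    refine sum_congr rfl fun k _ => sum_congr rfl fun l _ => ?_
    rw [squareWaveCoeff, squareWaveCoeff, show (l : ℤ) - k = -((k : ℤ) - l) by ring,
      squareMoment_neg, show ((l : ℝ) - k) * θ = -(((k : ℝ) - l) * θ) by ring, Real.cos_neg]
    ring
  linarith

/-- The wave is a signed average with nonnegative weights of total mass one. -/
theorem abs_squareWave_le_one {n : ℕ} (hn : 0 < n) {g : ℕ → ℝ}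
    (hg : 0 < ∑ k ∈ range n, g k ^ 2) (θ : ℝ) : |squareWave n g θ| ≤ 1 := by
  have hn0 : (0 : ℝ) < n := by exact_mod_cast hn
  have h := sum_trigKernel_gridAngle le_rfl hn g θ
  rw [squareWave, abs_mul, abs_of_pos (by positivity), inv_mul_le_iff₀ (by positivity), mul_one, ← h]
  refine (abs_sum_le_sum_abs _ _).trans (sum_le_sum fun j _ => ?_)
  have h1 := trigKernel_nonneg n g (θ - gridAngle n j)
  have h2 := trigKernel_nonneg n g (θ - gridAngle n j + Real.pi)
  rw [abs_le]
  constructor <;> linarith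

/-- By the same normalisation, only the mass on the half where the square wave is $-1$ is missing,
counted twice. -/
theorem one_sub_squareWave {n : ℕ} (hn : 0 < n) {g : ℕ → ℝ}
    (hg : 0 < ∑ k ∈ range n, g k ^ 2) (θ : ℝ) :
    1 - squareWave n g θ = (n * ∑ k ∈ range n, g k ^ 2)⁻¹ *
      ∑ j ∈ range n, trigKernel n g (θ - gridAngle n j + Real.pi) := by
  have hn0 : (0 : ℝ) < n := by exact_mod_cast hn
  have h := sum_trigKernel_gridAngle le_rfl hn g θ
  rw [squareWave]
  rw [sum_sub_distrib]
  rw [sum_add_distrib] at h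
  field_simp
  linarith

/-- Sum the geometric series and use $|e^{it}-1|=2|\sin(t/2)|$. -/
theorem norm_geom_sum_mul_sin_le (M : ℕ) (t : ℝ) :
    ‖∑ k ∈ range M, Complex.exp (Complex.I * t) ^ k‖ * |Real.sin (t / 2)| ≤ 1 := by
  have h1 : (∑ k ∈ range M, Complex.exp (Complex.I * t) ^ k) * (Complex.exp (Complex.I * t) - 1) =
      Complex.exp (Complex.I * t) ^ M - 1 := geom_sum_mul _ _
  have h2 := congrArg norm h1
  rw [norm_mul, Complex.norm_exp_I_mul_ofReal_sub_one, norm_mul, Real.norm_eq_abs,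
    Real.norm_eq_abs, abs_two] at h2
  have h3 : ‖Complex.exp (Complex.I * t) ^ M - 1‖ ≤ 2 := by
    refine (norm_sub_le _ _).trans ?_
    rw [norm_pow, mul_comm, Complex.norm_exp_ofReal_mul_I, one_pow, norm_one]
    norm_num
  linarith

/-- Jordan's inequality $\sin x\ge 2x/\pi$, used at $x$ or at $\pi-x$. -/
theorem div_pi_le_abs_sin {θ₀ x : ℝ} (h0 : 0 < θ₀) (hl : θ₀ / 2 ≤ x)
    (hu : x ≤ Real.pi - θ₀ / 2) : θ₀ / Real.pi ≤ |Real.sin x| := by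
  have hpi := Real.pi_pos
  refine le_trans ?_ (le_abs_self _)
  rcases le_total x (Real.pi / 2) with h | h
  · refine le_trans ?_ (Real.mul_le_sin (by linarith) h)
    rw [div_mul_eq_mul_div]
    gcongr
    linarith
  · rw [← Real.sin_pi_sub]
    refine le_trans ?_ (Real.mul_le_sin (by linarith) (by linarith))
    rw [div_mul_eq_mul_div]
    gcongr
    linarith

/-- The coefficients of the `r`-th power of the geometric sum with `M` terms. -/
noncomputable def geomPowCoeff (M r : ℕ) (k : ℕ) : ℝ :=
  ((∑ i ∈ range M, (X : ℝ[X]) ^ i) ^ r).coeff k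

theorem natDegree_geom_pow_le (M r : ℕ) :
    ((∑ i ∈ range M, (X : ℝ[X]) ^ i) ^ r).natDegree ≤ r * (M - 1) := by
  refine natDegree_pow_le.trans (Nat.mul_le_mul le_rfl ?_)
  refine natDegree_sum_le_of_forall_le _ _ fun i hi => ?_
  rw [mem_range] at hi
  rw [natDegree_X_pow]
  omega

theorem sum_geomPowCoeff_mul_pow {M r n : ℕ} (hn : r * (M - 1) < n) (z : ℂ) :
    ∑ k ∈ range n, (geomPowCoeff M r k : ℂ) * z ^ k = (∑ i ∈ range M, z ^ i) ^ r := by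
  have h := eval₂_eq_sum_range' Complex.ofRealHom
    ((natDegree_geom_pow_le M r).trans_lt hn) z
  rw [eval₂_pow, eval₂_finsetSum] at h
  simp only [eval₂_X_pow] at h
  rw [h]
  rfl

/-- Cauchy–Schwarz for the coefficients, whose sum is the value $M^r$ at $z=1$. -/
theorem pow_le_mul_sum_sq_geomPowCoeff {M r n : ℕ} (hn : r * (M - 1) < n) :
    (M : ℝ) ^ (2 * r) ≤ n * ∑ k ∈ range n, geomPowCoeff M r k ^ 2 := by
  have h := sum_geomPowCoeff_mul_pow hn 1
  simp only [one_pow, mul_one, sum_const, card_range, nsmul_eq_mul] at h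
  have h' : ∑ k ∈ range n, geomPowCoeff M r k = (M : ℝ) ^ r := by exact_mod_cast h
  have hcs := sq_sum_le_card_mul_sum_sq (s := range n) (f := geomPowCoeff M r)
  rw [h', card_range] at hcs
  rw [mul_comm 2 r, pow_mul]
  exact hcs

/-- With $D$ the geometric sum, the kernel is $|D|^{2r+2}$. On the half of the grid with the wrong
sign, $|D|\le x=\pi/\theta_0$; this bounds $2r$ of the factors, and the remaining $|D|^2$ is summed
exactly. Against the normalisation, $M\ge 2x$ gains $4^{-r}$, of which $2^r$ pays for $n\le(r+1)M\le
2^rM$. -/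
theorem one_sub_squareWave_geomPow_le {M r n : ℕ} {θ₀ θ : ℝ} (hM0 : 0 < M)
    (hn : n = (r + 1) * (M - 1) + 1) (hθ₀ : 0 < θ₀) (hM : 2 * (Real.pi / θ₀) ≤ M)
    (hl : θ₀ ≤ θ) (hu : θ ≤ Real.pi / 2) :
    1 - squareWave n (geomPowCoeff M (r + 1)) θ ≤ 2 / 2 ^ r := by
  have hpi := Real.pi_pos
  have hn0 : 0 < n := by omega
  have hnr : (0 : ℝ) < n := by exact_mod_cast hn0
  have hMr : (0 : ℝ) < M := by exact_mod_cast hM0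
  have hlt : (r + 1) * (M - 1) < n := by omega
  have hK := pow_le_mul_sum_sq_geomPowCoeff hlt
  set K₀ := ∑ k ∈ range n, geomPowCoeff M (r + 1) k ^ 2 with hK₀
  have hKpos : 0 < K₀ := by
    have : 0 < (n : ℝ) * K₀ := lt_of_lt_of_le (by positivity) hK
    exact pos_of_mul_pos_right this hnr.le
  have hMn : M ≤ n := by
    rw [hn]
    nlinarith [Nat.sub_add_cancel hM0]
  have hnM : (n : ℝ) ≤ (r + 1) * M := by
    have : n ≤ (r + 1) * M := by
      rw [hn]
      nlinarith [Nat.sub_add_cancel hM0]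
    exact_mod_cast this
  rw [one_sub_squareWave hn0 hKpos]
  set x := Real.pi / θ₀ with hx
  have hx0 : 0 < x := by positivity
  have hterm : ∀ j ∈ range n, trigKernel n (geomPowCoeff M (r + 1)) (θ - gridAngle n j + Real.pi) ≤
      x ^ (2 * r) * trigKernel M (fun _ => 1) (θ - gridAngle n j + Real.pi) := by
    intro j hj
    rw [mem_range] at hj
    have hj' : (j : ℝ) + 1 ≤ n := by exact_mod_cast hj
    have hg0 : 0 < gridAngle n j := by unfold gridAngle; positivity
    have hg1 : gridAngle n j ≤ Real.pi := by
      unfold gridAngle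
      rw [div_le_iff₀ (by positivity)]
      nlinarith
    set t := θ - gridAngle n j + Real.pi with ht
    -- Here $\theta_0\le t\le 3\pi/2$, since the grid angle lies in $(0,\pi]$ and
    -- $\theta_0\le\theta\le\pi/2$; thus $t/2$ keeps the distance $\theta_0/2$ from $0$ and $\pi$.
    have hsin : θ₀ / Real.pi ≤ |Real.sin (t / 2)| :=
      div_pi_le_abs_sin hθ₀ (by rw [ht]; linarith) (by rw [ht]; linarith)
    have hD := norm_geom_sum_mul_sin_le M t
    have hDx : ‖∑ k ∈ range M, Complex.exp (Complex.I * t) ^ k‖ ≤ x := by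
      have h1 : ‖∑ k ∈ range M, Complex.exp (Complex.I * t) ^ k‖ * (θ₀ / Real.pi) ≤ 1 :=
        (mul_le_mul_of_nonneg_left hsin (norm_nonneg _)).trans hD
      rw [hx]
      rw [← mul_div_assoc, div_le_one hpi] at h1
      rwa [le_div_iff₀ hθ₀]
    rw [trigKernel_eq_norm_sq, trigKernel_eq_norm_sq, sum_geomPowCoeff_mul_pow hlt]
    simp only [Complex.ofReal_one, one_mul]
    rw [norm_pow, ← pow_mul, show (r + 1) * 2 = 2 * r + 2 by ring, pow_add]
    gcongr
  -- The plain kernel has mass $2nM$ on the whole grid, and dropping the other half only decreases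
  -- it.
  have hsum : ∑ j ∈ range n, trigKernel M (fun _ => 1) (θ - gridAngle n j + Real.pi) ≤
      2 * n * M := by
    have h := sum_trigKernel_gridAngle hMn hn0 (fun _ => 1) θ
    simp only [one_pow, sum_const, card_range, nsmul_eq_mul, mul_one, sum_add_distrib] at h
    have : 0 ≤ ∑ j ∈ range n, trigKernel M (fun _ => 1) (θ - gridAngle n j) :=
      sum_nonneg fun j _ => trigKernel_nonneg _ _ _
    linarith
  have htot : ∑ j ∈ range n, trigKernel n (geomPowCoeff M (r + 1)) (θ - gridAngle n j + Real.pi) ≤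
      x ^ (2 * r) * (2 * n * M) := by
    refine (sum_le_sum hterm).trans ?_
    rw [← mul_sum]
    gcongr
  have hxM : (2 : ℝ) ^ r * 2 ^ r * x ^ (2 * r) ≤ (M : ℝ) ^ (2 * r) := by
    calc (2 : ℝ) ^ r * 2 ^ r * x ^ (2 * r) = (2 * x) ^ (2 * r) := by
          rw [mul_pow, two_mul r, pow_add, pow_add]
      _ ≤ (M : ℝ) ^ (2 * r) := by gcongr
  have hr2 : ((r : ℝ) + 1) ≤ 2 ^ r := by
    have : r + 1 ≤ 2 ^ r := Nat.lt_two_pow_self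
    exact_mod_cast this
  have hKM : (M : ℝ) * (2 ^ r * x ^ (2 * r)) ≤ K₀ := by
    have h1 : (M : ℝ) ^ (2 * r) * M ^ 2 ≤ (2 ^ r * M) * K₀ := by
      rw [← pow_add]
      refine hK.trans (mul_le_mul_of_nonneg_right (hnM.trans ?_) hKpos.le)
      gcongr
    have h2 : (2 ^ r * M) * ((M : ℝ) * (2 ^ r * x ^ (2 * r))) ≤ (2 ^ r * M) * K₀ := by
      refine le_trans ?_ h1
      calc (2 ^ r * M) * ((M : ℝ) * (2 ^ r * x ^ (2 * r)))
          = ((2 : ℝ) ^ r * 2 ^ r * x ^ (2 * r)) * (M : ℝ) ^ 2 := by ring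
        _ ≤ _ := by gcongr
    exact le_of_mul_le_mul_left h2 (by positivity)
  rw [inv_mul_le_iff₀ (by positivity)]
  refine htot.trans ?_
  have h2r : (0 : ℝ) < 2 ^ r := by positivity
  calc x ^ (2 * r) * (2 * n * M) = n * (M * (2 ^ r * x ^ (2 * r))) * (2 / 2 ^ r) := by
        field_simp
    _ ≤ n * K₀ * (2 / 2 ^ r) := by gcongr

/-- The polynomial whose coefficients are those of the convolution, up to a shift. -/
noncomputable def squareWavePoly (n : ℕ) (g : ℕ → ℝ) : ℂ[X] :=
  ∑ k ∈ range n, ∑ l ∈ range n,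
    C (squareWaveCoeff n g k l : ℂ) * X ^ ((k + (2 * n - 1 - l)) / 2)

theorem natDegree_squareWavePoly_le (n : ℕ) (g : ℕ → ℝ) :
    (squareWavePoly n g).natDegree ≤ 2 * n := by
  refine natDegree_sum_le_of_forall_le _ _ fun k hk =>
    natDegree_sum_le_of_forall_le _ _ fun l hl => ?_
  rw [mem_range] at hk hl
  refine (natDegree_C_mul_X_pow_le _ _).trans ?_
  omega

theorem sum_coeff_squareWavePoly (n : ℕ) (g : ℕ → ℝ) (f : ℕ → ℂ) :
    ∑ m ∈ range (2 * n + 1), (squareWavePoly n g).coeff m * f m =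
      ∑ k ∈ range n, ∑ l ∈ range n,
        (squareWaveCoeff n g k l : ℂ) * f ((k + (2 * n - 1 - l)) / 2) := by
  simp only [squareWavePoly, finsetSum_coeff, coeff_C_mul_X_pow, sum_mul]
  rw [sum_comm]
  refine sum_congr rfl fun k hk => ?_
  rw [sum_comm]
  refine sum_congr rfl fun l hl => ?_
  rw [mem_range] at hk hl
  simp only [ite_mul, zero_mul]
  rw [sum_ite_eq' , if_pos (by rw [mem_range]; omega)]

/-- Only odd `k - l` have nonzero coefficients, and for these the division by two in the exponent of
`squareWavePoly` is exact. -/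
theorem squareWaveCoeff_eq_zero_or {n k l : ℕ} (g : ℕ → ℝ) (hl : l < n) :
    squareWaveCoeff n g k l = 0 ∨
      2 * (((k + (2 * n - 1 - l)) / 2 : ℕ) : ℝ) + 1 - 2 * n = (k : ℝ) - l := by
  rcases Nat.even_or_odd (k + l) with h | h
  · left
    have he : Even ((k : ℤ) - l) := by
      rw [Int.even_sub]
      have : Even ((k : ℤ) + l) := by exact_mod_cast h
      rwa [Int.even_add] at this
    rw [squareWaveCoeff, squareMoment_of_even n he, mul_zero, mul_zero]
  · right
    obtain ⟨c, hc⟩ := h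
    have h2 : 2 * ((k + (2 * n - 1 - l)) / 2) + 1 + l = k + 2 * n := by omega
    have h3 : 2 * (((k + (2 * n - 1 - l)) / 2 : ℕ) : ℝ) + 1 + l = k + 2 * n := by exact_mod_cast h2
    linarith

theorem sum_coeff_squareWavePoly_mul_sin {n : ℕ} (hn : 0 < n) (g : ℕ → ℝ) (θ : ℝ) :
    ∑ m ∈ range (2 * n + 1), (squareWavePoly n g).coeff m *
      (Real.sin ((2 * m + 1 - 2 * n) * θ) : ℂ) = squareWave n g θ := by
  rw [sum_coeff_squareWavePoly, squareWave_eq_sum hn]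
  push_cast
  refine sum_congr rfl fun k _ => sum_congr rfl fun l hl => ?_
  rcases squareWaveCoeff_eq_zero_or (k := k) g (mem_range.mp hl) with h | h
  · rw [h]; simp
  · congr 2
    exact_mod_cast congrArg (fun y : ℝ => (y * θ : ℝ)) h

theorem sum_coeff_squareWavePoly_mul_cos {n : ℕ} (g : ℕ → ℝ) (θ : ℝ) :
    ∑ m ∈ range (2 * n + 1), (squareWavePoly n g).coeff m *
      (Real.cos ((2 * m + 1 - 2 * n) * θ) : ℂ) = 0 := by
  rw [sum_coeff_squareWavePoly, ← Complex.ofReal_zero, ← sum_squareWaveCoeff_mul_cos n g θ]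
  push_cast
  refine sum_congr rfl fun k _ => sum_congr rfl fun l hl => ?_
  rcases squareWaveCoeff_eq_zero_or (k := k) g (mem_range.mp hl) with h | h
  · rw [h]; simp
  · congr 2
    exact_mod_cast congrArg (fun y : ℝ => (y * θ : ℝ)) h

/-- With $z=e^{2i\theta}$ the phase $e^{i(2n-1)\theta}$ factors out and centres the frequencies at
$2m+1-2n$; the cosines cancel and the sines give the wave times $i$. -/
theorem norm_eval_squareWavePoly {n : ℕ} (hn : 0 < n) (g : ℕ → ℝ) {z : ℂ} (hz : ‖z‖ = 1) :
    ∃ θ : ℝ, ‖(squareWavePoly n g).eval z‖ = |squareWave n g θ| := by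
  refine ⟨z.arg / 2, ?_⟩
  set θ := z.arg / 2 with hθ
  have hzθ : z = Complex.exp ((2 * θ : ℝ) * Complex.I) := by
    rw [show 2 * θ = z.arg by rw [hθ]; ring, ← one_mul (Complex.exp _), ← Complex.ofReal_one, ← hz,
      Complex.norm_mul_exp_arg_mul_I]
  have hterm : ∀ m : ℕ, z ^ m = Complex.exp (((2 * n - 1) * θ : ℝ) * Complex.I) *
      ((Real.cos ((2 * m + 1 - 2 * n) * θ) : ℂ) +
        (Real.sin ((2 * m + 1 - 2 * n) * θ) : ℂ) * Complex.I) := by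
    intro m
    rw [Complex.ofReal_cos, Complex.ofReal_sin, ← Complex.exp_mul_I, ← Complex.exp_add, hzθ,
      ← Complex.exp_nat_mul]
    congr 1
    push_cast
    ring
  rw [eval_eq_sum_range' (Nat.lt_succ_of_le (natDegree_squareWavePoly_le n g)),
    sum_congr rfl fun m _ => by rw [hterm m]]
  have hsplit : ∀ m ∈ range (2 * n).succ, (squareWavePoly n g).coeff m *
      (Complex.exp (((2 * n - 1) * θ : ℝ) * Complex.I) *
      ((Real.cos ((2 * m + 1 - 2 * n) * θ) : ℂ) +
        (Real.sin ((2 * m + 1 - 2 * n) * θ) : ℂ) * Complex.I)) =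
      Complex.exp (((2 * n - 1) * θ : ℝ) * Complex.I) *
        ((squareWavePoly n g).coeff m * (Real.cos ((2 * m + 1 - 2 * n) * θ) : ℂ)) +
      Complex.exp (((2 * n - 1) * θ : ℝ) * Complex.I) * Complex.I *
        ((squareWavePoly n g).coeff m * (Real.sin ((2 * m + 1 - 2 * n) * θ) : ℂ)) :=
    fun m _ => by ring
  rw [sum_congr rfl hsplit, sum_add_distrib, ← mul_sum, ← mul_sum,
    sum_coeff_squareWavePoly_mul_cos, sum_coeff_squareWavePoly_mul_sin hn, mul_zero, zero_add,
    norm_mul, norm_mul, Complex.norm_exp_ofReal_mul_I, Complex.norm_I, Complex.norm_real,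
    Real.norm_eq_abs, one_mul, one_mul]

/-- Polynomials that send every rotation angle in `[θ₀, π / 2]` close to `π / 2`. -/
theorem exists_amplifying_polynomial {θ₀ δ : ℝ} (hθ₀ : 0 < θ₀) (hθ₁ : θ₀ ≤ 1) (hδ : 0 < δ)
    (hδ₁ : δ < 1) :
    ∃ (n : ℕ) (P : ℂ[X]), (n : ℝ) ≤ 64 / θ₀ * (1 + Real.log (1 / δ)) ∧ P.natDegree ≤ 2 * n ∧
      (∀ z : ℂ, ‖z‖ = 1 → ‖P.eval z‖ < 1) ∧
      ∀ θ : ℝ, θ₀ ≤ θ → θ ≤ Real.pi / 2 → ∃ s : ℝ, 1 - δ ≤ s ∧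
        ∑ m ∈ range (2 * n + 1), P.coeff m * (Real.sin ((2 * m + 1 - 2 * n) * θ) : ℂ) = s ∧
        ∑ m ∈ range (2 * n + 1), P.coeff m * (Real.cos ((2 * m + 1 - 2 * n) * θ) : ℂ) = 0 := by
  have hpi := Real.pi_pos
  have hpi4 := Real.pi_le_four
  have hlog : 0 ≤ Real.log (1 / δ) := Real.log_nonneg (by rw [le_div_iff₀ hδ]; linarith)
  -- The least `M` admitted by `one_sub_squareWave_geomPow_le`; it is at most $9/\theta_0$ because
  -- $\pi\le4$ and $\theta_0\le1$.
  set M := ⌈2 * (Real.pi / θ₀)⌉₊ with hMdef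
  have hM : 2 * (Real.pi / θ₀) ≤ M := Nat.le_ceil _
  have hMr : (0 : ℝ) < M := lt_of_lt_of_le (by positivity) hM
  have hM0 : 0 < M := by exact_mod_cast hMr
  have hMu : (M : ℝ) ≤ 9 / θ₀ := by
    have h1 : (M : ℝ) < 2 * (Real.pi / θ₀) + 1 := Nat.ceil_lt_add_one (by positivity)
    have h2 : (1 : ℝ) ≤ 1 / θ₀ := by rw [le_div_iff₀ hθ₀]; linarith
    have h3 : 2 * (Real.pi / θ₀) ≤ 8 / θ₀ := by
      rw [← mul_div_assoc]; gcongr; linarith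
    have h4 : (9 : ℝ) / θ₀ = 8 / θ₀ + 1 / θ₀ := by ring
    linarith
  -- Chosen so that $2/2^r\le\delta/2$; the other half of `δ` is spent on the scaling below.
  set r := ⌈Real.log (4 / δ) / Real.log 2⌉₊ with hrdef
  have hl2 : (0.69 : ℝ) < Real.log 2 := by linarith [Real.log_two_gt_d9]
  have hr : 2 / 2 ^ r ≤ δ / 2 := by
    have h1 : Real.log (4 / δ) ≤ r * Real.log 2 := by
      rw [← div_le_iff₀ (by linarith)]; exact Nat.le_ceil _
    rw [← Real.log_pow, Real.log_le_log_iff (by positivity) (by positivity)] at h1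
    rw [div_le_iff₀ hδ] at h1
    rw [div_le_iff₀ (by positivity)]
    linarith
  have hlog4 : Real.log (4 / δ) = 2 * Real.log 2 + Real.log (1 / δ) := by
    rw [show 4 / δ = 2 ^ 2 * (1 / δ) by ring, Real.log_mul (by norm_num) (by positivity),
      Real.log_pow]
    norm_num
  have hru : (r : ℝ) + 1 ≤ 7 * (1 + Real.log (1 / δ)) - 3 := by
    have h1 : (r : ℝ) < Real.log (4 / δ) / Real.log 2 + 1 := by
      refine Nat.ceil_lt_add_one (div_nonneg ?_ (by linarith))
      rw [hlog4]; linarith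
    have h2 : Real.log (4 / δ) / Real.log 2 ≤ 2 + 2 * Real.log (1 / δ) := by
      rw [div_le_iff₀ (by linarith), hlog4]
      nlinarith
    linarith
  set n := (r + 1) * (M - 1) + 1 with hn
  have hn0 : 0 < n := by omega
  set g := geomPowCoeff M (r + 1)
  have hK : 0 < ∑ k ∈ range n, g k ^ 2 := by
    have h1 := pow_le_mul_sum_sq_geomPowCoeff (M := M) (r := r + 1) (n := n) (by omega)
    have h2 : 0 < (n : ℝ) * ∑ k ∈ range n, g k ^ 2 := lt_of_lt_of_le (by positivity) h1
    exact pos_of_mul_pos_right h2 (Nat.cast_nonneg _)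
  -- The factor $1-\delta/2$ makes the bound on the circle strict, and $(1-\delta/2)^2\ge1-\delta$.
  refine ⟨n, C ((1 - δ / 2 : ℝ) : ℂ) * squareWavePoly n g, ?_,
    (natDegree_C_mul_le _ _).trans (natDegree_squareWavePoly_le n g), ?_, ?_⟩
  · have h1 : n ≤ (r + 1) * M := by
      rw [hn]
      nlinarith [Nat.sub_add_cancel hM0]
    have h2 : (n : ℝ) ≤ (r + 1) * M := by exact_mod_cast h1
    calc (n : ℝ) ≤ (r + 1) * M := h2
      _ ≤ (7 * (1 + Real.log (1 / δ))) * (9 / θ₀) := by gcongr; linarith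
      _ ≤ 64 / θ₀ * (1 + Real.log (1 / δ)) := by
        have : 0 ≤ (1 + Real.log (1 / δ)) / θ₀ := by positivity
        calc _ = 63 * ((1 + Real.log (1 / δ)) / θ₀) := by ring
          _ ≤ 64 * ((1 + Real.log (1 / δ)) / θ₀) := by linarith
          _ = _ := by ring
  · intro z hz
    obtain ⟨θ, hθ⟩ := norm_eval_squareWavePoly hn0 g hz
    rw [eval_mul, eval_C, norm_mul, hθ, Complex.norm_real, Real.norm_eq_abs,
      abs_of_pos (by linarith)]
    have h1 := abs_squareWave_le_one hn0 hK θ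
    nlinarith [abs_nonneg (squareWave n g θ)]
  · intro θ hl hu
    have h1 := one_sub_squareWave_geomPow_le hM0 hn hθ₀ hM hl hu
    refine ⟨(1 - δ / 2) * squareWave n g θ, ?_, ?_, ?_⟩
    · have h2 : 1 - δ / 2 ≤ squareWave n g θ := by linarith
      nlinarith
    · simp only [coeff_C_mul, mul_assoc]
      rw [← mul_sum, sum_coeff_squareWavePoly_mul_sin hn0, Complex.ofReal_mul]
    · simp only [coeff_C_mul, mul_assoc]
      rw [← mul_sum, sum_coeff_squareWavePoly_mul_cos, mul_zero]

end SquareWave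

end QAlg


namespace QAlg

/-! ### The relative-phase Toffoli gate -/

section OneQubitGates

/-- The Pauli matrix `X`. -/
def pauliX : Matrix.unitaryGroup Bool ℂ :=
  ⟨Matrix.of fun r c => if r = c then 0 else 1, by
    rw [Matrix.mem_unitaryGroup_iff']
    ext r c
    rw [Matrix.mul_apply, Fintype.sum_bool]
    cases r <;> cases c <;> simp [Matrix.star_apply]⟩

/-- The diagonal matrix with entries `x`, `y` equal to `1` or `-1`. -/
def signGate (x y : ℤˣ) : Matrix.unitaryGroup Bool ℂ :=
  ⟨Matrix.diagonal fun r => bif r then ((y : ℤ) : ℂ) else ((x : ℤ) : ℂ), by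
    rw [Matrix.mem_unitaryGroup_iff', Matrix.star_eq_conjTranspose, Matrix.diagonal_conjTranspose,
      Matrix.diagonal_mul_diagonal, ← Matrix.diagonal_one]
    congr 1
    funext r
    rcases Int.units_eq_one_or x with rfl | rfl <;> rcases Int.units_eq_one_or y with rfl | rfl <;>
      cases r <;> simp⟩

/-- The Hadamard matrix. -/
noncomputable def hadamard : Matrix.unitaryGroup Bool ℂ :=
  ⟨Matrix.of fun r c => if r && c then -((Real.sqrt 2)⁻¹ : ℂ) else ((Real.sqrt 2)⁻¹ : ℂ), by
    have h : ((Real.sqrt 2)⁻¹ : ℂ) * ((Real.sqrt 2)⁻¹ : ℂ) = 1 / 2 := by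
      rw [← mul_inv, ← Complex.ofReal_mul, Real.mul_self_sqrt (by norm_num)]
      norm_num
    rw [Matrix.mem_unitaryGroup_iff']
    ext r c
    rw [Matrix.mul_apply, Fintype.sum_bool]
    cases r <;> cases c <;>
      simp only [Matrix.star_apply, Matrix.of_apply, Matrix.one_apply, Bool.and_true,
        Bool.and_false, Bool.false_eq_true, if_true, if_false, star_neg, star_inv₀,
        Complex.star_def, Complex.conj_ofReal, reduceCtorEq, neg_mul, mul_neg, neg_neg, h] <;>
      norm_num⟩

/-- The rotation by `π / 8`. -/
noncomputable def rotation : Matrix.unitaryGroup Bool ℂ :=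
  columnUnitary (Real.cos (Real.pi / 8)) (Real.sin (Real.pi / 8)) (by
    rw [Complex.conj_ofReal, Complex.conj_ofReal, ← Complex.ofReal_mul, ← Complex.ofReal_mul,
      ← Complex.ofReal_add, ← sq, ← sq, Real.cos_sq_add_sin_sq, Complex.ofReal_one])

theorem pauliX_mul_pauliX : pauliX * pauliX = 1 := by
  ext r c
  rw [Matrix.UnitaryGroup.mul_val, Matrix.mul_apply, Fintype.sum_bool]
  cases r <;> cases c <;> simp [pauliX]

theorem pauliX_mul_rotation : pauliX * rotation = rotation⁻¹ * pauliX := by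
  ext r c
  rw [Matrix.UnitaryGroup.mul_val, Matrix.UnitaryGroup.mul_val, Matrix.mul_apply,
    Fintype.sum_bool, Matrix.mul_apply, Fintype.sum_bool]
  cases r <;> cases c <;> simp [pauliX, rotation, columnUnitary, Matrix.UnitaryGroup.inv_val,
    Matrix.star_apply, -Complex.ofReal_cos, -Complex.ofReal_sin, -Real.cos_pi_div_eight,
    -Real.sin_pi_div_eight]

/-- The product of the matrices of the relative-phase Toffoli gate, for given control bits. -/
noncomputable def toffoliMatrix (a b : Bool) : Matrix.unitaryGroup Bool ℂ :=
  rotation⁻¹ * ((bif b then pauliX else 1) * (rotation⁻¹ * ((bif a then pauliX else 1) *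
    (rotation * ((bif b then pauliX else 1) * rotation)))))

/-- Without the middle $X$, the rotations and the outer $X$ gates cancel in nested pairs. -/
theorem toffoliMatrix_of_false_left (b : Bool) : toffoliMatrix false b = 1 := by
  cases b
  · simp [toffoliMatrix]
  · simp only [toffoliMatrix, cond_true, cond_false, one_mul, inv_mul_cancel_left]
    rw [← mul_assoc pauliX, pauliX_mul_pauliX, one_mul, inv_mul_cancel]

/-- Conjugation by $X$ inverts the rotation, so $XRXR=1$ and the remaining word collapses to $X$. -/
theorem toffoliMatrix_true_true : toffoliMatrix true true = pauliX := by
  have h1 : pauliX * (rotation * (pauliX * rotation)) = 1 := by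
    rw [pauliX_mul_rotation, mul_inv_cancel_left, pauliX_mul_pauliX]
  have h2 : pauliX * rotation⁻¹ = rotation * pauliX := by
    rw [mul_inv_eq_iff_eq_mul, mul_assoc, pauliX_mul_rotation, mul_inv_cancel_left]
  simp only [toffoliMatrix, cond_true]
  rw [h1, mul_one, h2, inv_mul_cancel_left]

/-- The matrix is $G^{-1}XG$, where $G=R^2$ rotates $|0\rangle$ by $\pi/4$ onto the diagonal vector,
which $X$ fixes. Nothing is claimed about $|1\rangle$. -/
theorem toffoliMatrix_true_false (r : Bool) :
    (toffoliMatrix true false).1 r false = if r = false then 1 else 0 := by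
  set G := rotation * rotation with hG
  have hcol : G.1 true false = G.1 false false := by
    have h1 : Real.cos (Real.pi / 8) * Real.cos (Real.pi / 8) -
        Real.sin (Real.pi / 8) * Real.sin (Real.pi / 8) =
        2 * Real.sin (Real.pi / 8) * Real.cos (Real.pi / 8) := by
      rw [← Real.sin_two_mul, ← sq, ← sq, ← Real.cos_two_mul',
        show 2 * (Real.pi / 8) = Real.pi / 4 by ring, Real.cos_pi_div_four, Real.sin_pi_div_four]
    have h2 := congrArg (fun x : ℝ => (x : ℂ)) h1
    push_cast at h2
    rw [hG, Matrix.UnitaryGroup.mul_val, Matrix.mul_apply, Fintype.sum_bool, Matrix.mul_apply,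
      Fintype.sum_bool]
    simp only [rotation, columnUnitary, Matrix.of_apply, Complex.conj_ofReal]
    push_cast
    linear_combination -h2
  have hX : ∀ k, (pauliX * G).1 k false = G.1 k false := by
    intro k
    rw [Matrix.UnitaryGroup.mul_val, Matrix.mul_apply, Fintype.sum_bool]
    cases k <;> simp [pauliX, hcol]
  have hT : toffoliMatrix true false = G⁻¹ * (pauliX * G) := by
    simp only [toffoliMatrix, cond_true, cond_false, one_mul, hG, mul_inv_rev, mul_assoc]
  have h1 : (toffoliMatrix true false).1 r false = (G⁻¹ * G).1 r false := by
    rw [hT, Matrix.UnitaryGroup.mul_val, Matrix.UnitaryGroup.mul_val, Matrix.mul_apply]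
    refine (Finset.sum_congr rfl fun k _ => ?_).trans (Matrix.mul_apply).symm
    exact congrArg _ (hX k)
  rw [h1, inv_mul_cancel]
  cases r <;> simp

end OneQubitGates

/-! ### Reversible subcircuits on basis states -/

section Gadgets

variable {σ : Sizes} {Q : Type} [Fintype Q] [DecidableEq Q]

theorem ket_apply (s u : Q → Bool) : ket s u = if u = s then 1 else 0 := by
  rw [ket, Pi.single_apply]

theorem state_eq_sum (ψ : State Q) : ψ = ∑ s, ψ s • ket s := by
  funext u
  simp [Finset.sum_apply, ket_apply]

theorem eq_update_iff {s u : Q → Bool} {q : Q} {β : Bool} :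
    u = Function.update s q β ↔ u q = β ∧ ∀ r, r ≠ q → u r = s r := by
  constructor
  · rintro rfl
    exact ⟨Function.update_self _ _ _, fun r hr => Function.update_of_ne hr _ _⟩
  · rintro ⟨h1, h2⟩
    funext r
    by_cases hr : r = q
    · subst hr; rw [h1, Function.update_self]
    · rw [h2 r hr, Function.update_of_ne hr]

theorem run_single_ket (O : Oracles σ) (q : Q) (U : Matrix.unitaryGroup Bool ℂ) (s : Q → Bool) :
    Circuit.run O [Gate.single q U] (ket s) =
      ∑ β, U.1 β (s q) • ket (Function.update s q β) := by
  funext u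
  simp only [Circuit.run, Gate.op, Finset.sum_apply, Pi.smul_apply, smul_eq_mul, ket_apply]
  rw [ket, Matrix.mulVec_single_one]
  simp only [singleOp, Matrix.col_apply, Matrix.of_apply, eq_update_iff]
  by_cases h : ∀ r, r ≠ q → u r = s r
  · simp only [if_pos h, and_iff_left h, Fintype.sum_bool]
    cases u q <;> simp
  · simp [h]

theorem run_cnot_ket (O : Oracles σ) {c t : Q} (h : c ≠ t) (s : Q → Bool) :
    Circuit.run O [Gate.cnot c t h] (ket s) = ket (Function.update s t (xor (s t) (s c))) := by
  funext u
  simp only [Circuit.run, Gate.op, ket_apply]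
  rw [ket, Matrix.mulVec_single_one]
  simp [cnotOp, Matrix.col_apply]

/-- On the qubit `t`, with the other qubits in the basis state `s`, the circuit acts as `M`. -/
def ActsOn (O : Oracles σ) (𝒜 : Circuit σ Q) (t : Q) (s : Q → Bool)
    (M : Matrix.unitaryGroup Bool ℂ) : Prop :=
  ∀ β, Circuit.run O 𝒜 (ket (Function.update s t β)) =
    ∑ γ, M.1 γ β • ket (Function.update s t γ)

theorem ActsOn.append {O : Oracles σ} {𝒜 ℬ : Circuit σ Q} {t : Q} {s : Q → Bool}
    {M N : Matrix.unitaryGroup Bool ℂ} (hA : ActsOn O 𝒜 t s M) (hB : ActsOn O ℬ t s N) :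
    ActsOn O (𝒜 ++ ℬ) t s (N * M) := by
  intro β
  rw [Circuit.run_append, hA β, Circuit.run_sum]
  simp only [Circuit.run_smul, hB _, Finset.smul_sum, smul_smul]
  rw [Finset.sum_comm]
  refine Finset.sum_congr rfl fun γ _ => ?_
  rw [← Finset.sum_smul, Matrix.UnitaryGroup.mul_val, Matrix.mul_apply]
  congr 1
  exact Finset.sum_congr rfl fun _ _ => mul_comm _ _

theorem actsOn_single (O : Oracles σ) (t : Q) (s : Q → Bool) (U : Matrix.unitaryGroup Bool ℂ) :
    ActsOn O [Gate.single t U] t s U := by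
  intro β
  rw [run_single_ket]
  simp

/-- A CNOT gate; no gate at all if the two qubits agree. -/
def cx (c t : Q) : Circuit σ Q := if h : c ≠ t then [Gate.cnot c t h] else []

theorem run_cx (O : Oracles σ) {c t : Q} (h : c ≠ t) (s : Q → Bool) :
    Circuit.run O (cx c t) (ket s) = ket (Function.update s t (xor (s t) (s c))) := by
  rw [cx, dif_pos h, run_cnot_ket]

theorem length_cx_le (c t : Q) : (cx c t : Circuit σ Q).length ≤ 1 := by
  unfold cx; split_ifs <;> simp

theorem spares_cx {q c t : Q} (h : q ≠ t) : Circuit.Spares q (cx c t : Circuit σ Q) := by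
  unfold cx
  split_ifs
  · intro g hg
    rw [List.mem_singleton] at hg
    subst hg
    exact h
  · intro g hg; simp at hg

theorem spares_single {q r : Q} (U : Matrix.unitaryGroup Bool ℂ) (h : q ≠ r) :
    Circuit.Spares q ([Gate.single r U] : Circuit σ Q) := by
  intro g hg
  rw [List.mem_singleton] at hg
  subst hg
  exact h

theorem actsOn_cx (O : Oracles σ) {c t : Q} (h : c ≠ t) (s : Q → Bool) :
    ActsOn O (cx c t) t s (bif s c then pauliX else 1) := by
  intro β
  rw [run_cx O h, Function.update_of_ne h, Function.update_self, Function.update_idem]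
  cases s c <;> cases β <;> simp [pauliX]

/-- The relative-phase Toffoli gate. -/
noncomputable def andGate (a b t : Q) : Circuit σ Q :=
  [Gate.single t rotation] ++ cx b t ++ [Gate.single t rotation] ++ cx a t ++
    [Gate.single t rotation⁻¹] ++ cx b t ++ [Gate.single t rotation⁻¹]

theorem length_andGate_le (a b t : Q) : (andGate a b t : Circuit σ Q).length ≤ 7 := by
  have h1 := length_cx_le (σ := σ) a t
  have h2 := length_cx_le (σ := σ) b t
  simp only [andGate, List.length_append, List.length_singleton]
  omega

theorem spares_andGate {q a b t : Q} (h : q ≠ t) :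
    Circuit.Spares q (andGate a b t : Circuit σ Q) :=
  ((((((spares_single _ h).append (spares_cx h)).append (spares_single _ h)).append
    (spares_cx h)).append (spares_single _ h)).append (spares_cx h)).append (spares_single _ h)

/-- An unwanted phase can arise only when the target and the first control are both `1`, which `hs`
excludes. -/
theorem run_andGate (O : Oracles σ) {a b t : Q} (ha : a ≠ t) (hb : b ≠ t) {s : Q → Bool}
    (hs : s t = true → s a = false) :
    Circuit.run O (andGate a b t) (ket s) = ket (Function.update s t (xor (s t) (s a && s b))) := by
  have h : ActsOn O (andGate a b t) t s (toffoliMatrix (s a) (s b)) :=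
    ((((((actsOn_single O t s _).append (actsOn_cx O hb s)).append (actsOn_single O t s _)).append
      (actsOn_cx O ha s)).append (actsOn_single O t s _)).append (actsOn_cx O hb s)).append
      (actsOn_single O t s _)
  have h' := h (s t)
  rw [Function.update_eq_self] at h'
  rw [h', Fintype.sum_bool]
  cases hsa : s a
  · rw [toffoliMatrix_of_false_left]
    cases s t <;> simp
  · have hst : s t = false := by
      cases hst : s t
      · rfl
      · rw [hs hst] at hsa; cases hsa
    rw [hst]
    cases s b
    · rw [toffoliMatrix_true_false, toffoliMatrix_true_false]
      simp
    · rw [toffoliMatrix_true_true]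
      simp [pauliX]

theorem run_pauliX (O : Oracles σ) (q : Q) (s : Q → Bool) :
    Circuit.run O [Gate.single q pauliX] (ket s) = ket (Function.update s q (!s q)) := by
  rw [run_single_ket, Fintype.sum_bool]
  cases s q <;> simp [pauliX]

theorem run_signGate (O : Oracles σ) (q : Q) (x y : ℤˣ) (s : Q → Bool) :
    Circuit.run O [Gate.single q (signGate x y)] (ket s) =
      (bif s q then ((y : ℤ) : ℂ) else ((x : ℤ) : ℂ)) • ket s := by
  rw [run_single_ket, Fintype.sum_bool]
  cases h : s q <;> simp [signGate, ← h]

/-- Computes into `y n` whether all of `x 0, …, x (n - 1)` are `0`. -/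
noncomputable def ladder (x y : ℕ → Q) : ℕ → Circuit σ Q
  | 0 => [Gate.single (y 0) pauliX]
  | n + 1 => ladder x y n ++ ([Gate.single (x n) pauliX] ++ andGate (y n) (x n) (y (n + 1)) ++
      [Gate.single (x n) pauliX])

theorem length_ladder_le (x y : ℕ → Q) (n : ℕ) :
    (ladder x y n : Circuit σ Q).length ≤ 9 * n + 1 := by
  induction n with
  | zero => simp [ladder]
  | succ n ih =>
    have h := length_andGate_le (σ := σ) (y n) (x n) (y (n + 1))
    simp only [ladder, List.length_append, List.length_singleton]
    omega

/-- Each rung takes the conjunction of the previous rung with a negated input. The input is flipped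
back, so only the `y` qubits change. -/
theorem run_ladder (O : Oracles σ) {x y : ℕ → Q} {n : ℕ}
    (hy : ∀ k ≤ n, ∀ l ≤ n, y k = y l → k = l) (hxy : ∀ k < n, ∀ l ≤ n, x k ≠ y l) {s : Q → Bool}
    (hs : ∀ k ≤ n, s (y k) = false) :
    ∃ s' : Q → Bool, Circuit.run O (ladder x y n) (ket s) = ket s' ∧
      (∀ q, (∀ k ≤ n, q ≠ y k) → s' q = s q) ∧
      (s' (y n) = true ↔ ∀ k < n, s (x k) = false) := by
  induction n with
  | zero =>
    refine ⟨_, run_pauliX O (y 0) s, fun q hq => Function.update_of_ne (hq 0 le_rfl) _ _, ?_⟩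
    simp [hs 0 le_rfl]
  | succ n ih =>
    obtain ⟨s₁, hrun, hoff, hval⟩ := ih (fun k hk l hl => hy k (by omega) l (by omega))
      (fun k hk l hl => hxy k (by omega) l (by omega)) (fun k hk => hs k (by omega))
    have hnn : y n ≠ y (n + 1) := fun h => by
      have := hy n (by omega) (n + 1) le_rfl h
      omega
    have hx1 : x n ≠ y (n + 1) := hxy n (by omega) _ le_rfl
    have hx0 : x n ≠ y n := hxy n (by omega) _ (by omega)
    have h1 : s₁ (y (n + 1)) = false := by
      rw [hoff _ fun k hk h => by have := hy (n + 1) le_rfl k (by omega) h; omega]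
      exact hs _ le_rfl
    have h2 : s₁ (x n) = s (x n) := hoff _ fun k hk => hxy n (by omega) k (by omega)
    rw [ladder, Circuit.run_append, hrun, Circuit.run_append, Circuit.run_append, run_pauliX,
      run_andGate O hnn hx1 (by rw [Function.update_of_ne hx1.symm, h1]; simp), run_pauliX]
    refine ⟨_, rfl, fun q hq => ?_, ?_⟩
    · by_cases hqx : q = x n
      · subst hqx
        simp [Function.update_of_ne hx1, h2]
      · rw [Function.update_of_ne hqx, Function.update_of_ne (hq _ le_rfl),
          Function.update_of_ne hqx]
        exact hoff q fun k hk => hq k (by omega)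
    · rw [Function.update_of_ne hx1.symm, Function.update_self, Function.update_of_ne hx1.symm, h1,
        Function.update_of_ne hx0.symm, Function.update_self, h2, Bool.false_xor,
        Bool.and_eq_true, hval, Bool.not_eq_true', Nat.forall_lt_succ_right]

/-- The reflection that multiplies the states with `x 0 = ⋯ = x (n - 1) = 0` by `-1`. -/
noncomputable def reflection (x y : ℕ → Q) (n : ℕ) : Circuit σ Q :=
  ladder x y n ++ [Gate.single (y n) (signGate 1 (-1))] ++ Circuit.inv (ladder x y n)

theorem length_reflection_le (x y : ℕ → Q) (n : ℕ) :
    (reflection x y n : Circuit σ Q).length ≤ 18 * n + 3 := by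
  have h := length_ladder_le (σ := σ) x y n
  simp only [reflection, List.length_append, List.length_singleton, Circuit.length_inv]
  omega

/-- The sign gate multiplies the computed basis state by a scalar, so the inverse ladder restores
the original one. -/
theorem run_reflection_ket (O : Oracles σ) {x y : ℕ → Q} {n : ℕ}
    (hy : ∀ k ≤ n, ∀ l ≤ n, y k = y l → k = l) (hxy : ∀ k < n, ∀ l ≤ n, x k ≠ y l) {s : Q → Bool}
    (hs : ∀ k ≤ n, s (y k) = false) [Decidable (∀ k < n, s (x k) = false)] :
    Circuit.run O (reflection x y n) (ket s) =
      (if ∀ k < n, s (x k) = false then (-1 : ℂ) else 1) • ket s := by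
  obtain ⟨s', hrun, -, hval⟩ := run_ladder O hy hxy hs
  rw [reflection, Circuit.run_append, Circuit.run_append, hrun, run_signGate, Circuit.run_smul,
    ← hrun, Circuit.run_inv_run]
  congr 1
  by_cases h : ∀ k < n, s (x k) = false
  · rw [if_pos h, hval.mpr h]; simp
  · rw [if_neg h, Bool.eq_false_iff.mpr fun h' => h (hval.mp h')]; simp

theorem run_reflection (O : Oracles σ) {x y : ℕ → Q} {n : ℕ}
    (hy : ∀ k ≤ n, ∀ l ≤ n, y k = y l → k = l) (hxy : ∀ k < n, ∀ l ≤ n, x k ≠ y l) {ψ : State Q}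
    (hψ : ∀ s, ψ s ≠ 0 → ∀ k ≤ n, s (y k) = false) (s : Q → Bool)
    [Decidable (∀ k < n, s (x k) = false)] :
    Circuit.run O (reflection x y n) ψ s =
      (if ∀ k < n, s (x k) = false then (-1 : ℂ) else 1) * ψ s := by
  classical
  have h : Circuit.run O (reflection x y n) ψ =
      ∑ u, ((if ∀ k < n, u (x k) = false then (-1 : ℂ) else 1) * ψ u) • ket u := by
    conv_lhs => rw [state_eq_sum ψ]
    rw [Circuit.run_sum]
    refine Finset.sum_congr rfl fun u _ => ?_
    rw [Circuit.run_smul]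
    by_cases hu : ψ u = 0
    · rw [hu, mul_zero, zero_smul, zero_smul]
    · rw [run_reflection_ket O hy hxy (hψ u hu), smul_smul, mul_comm]
  rw [h, Finset.sum_apply]
  simp only [Pi.smul_apply, ket_apply, smul_eq_mul, mul_ite, mul_one, mul_zero]
  rw [Finset.sum_ite_eq, if_pos (Finset.mem_univ _)]
  congr

/-- The bit of `ρ` at the position of the leading one among the first bits of `κ`. -/
def muxVal (κ ρ : ℕ → Bool) : ℕ → Bool
  | 0 => false
  | n + 1 => bif κ n then ρ n else muxVal κ ρ n

/-- Computes `muxVal` of the qubits `k` and `r` into `u n`. -/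
noncomputable def muxCircuit (k r u : ℕ → Q) : ℕ → Circuit σ Q
  | 0 => []
  | n + 1 => muxCircuit k r u n ++ (andGate (k n) (r n) (u (n + 1)) ++
      [Gate.single (k n) pauliX] ++ andGate (k n) (u n) (u (n + 1)) ++ [Gate.single (k n) pauliX])

theorem length_muxCircuit_le (k r u : ℕ → Q) (n : ℕ) :
    (muxCircuit k r u n : Circuit σ Q).length ≤ 16 * n := by
  induction n with
  | zero => simp [muxCircuit]
  | succ n ih =>
    have h := length_andGate_le (σ := σ) (k n) (r n) (u (n + 1))
    have h' := length_andGate_le (σ := σ) (k n) (u n) (u (n + 1))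
    simp only [muxCircuit, List.length_append, List.length_singleton]
    omega

theorem spares_muxCircuit {q : Q} {k r u : ℕ → Q} {n : ℕ} (hk : ∀ l < n, q ≠ k l)
    (hu : ∀ l ≤ n, q ≠ u l) : Circuit.Spares q (muxCircuit k r u n : Circuit σ Q) := by
  induction n with
  | zero => intro g hg; simp [muxCircuit] at hg
  | succ n ih =>
    have h := hk n (Nat.lt_succ_self n)
    exact (ih (fun l hl => hk l (by omega)) fun l hl => hu l (by omega)).append
      ((((spares_andGate (hu _ le_rfl)).append (spares_single _ h)).append
        (spares_andGate (hu _ le_rfl))).append (spares_single _ h))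

theorem run_muxCircuit (O : Oracles σ) {k r u : ℕ → Q} {n : ℕ}
    (hu : ∀ a ≤ n, ∀ b ≤ n, u a = u b → a = b) (hku : ∀ a < n, ∀ b ≤ n, k a ≠ u b)
    (hru : ∀ a < n, ∀ b ≤ n, r a ≠ u b) (hkr : ∀ a < n, ∀ b < n, k a ≠ r b) {s : Q → Bool}
    (hs : ∀ a ≤ n, s (u a) = false) :
    ∃ s' : Q → Bool, Circuit.run O (muxCircuit k r u n) (ket s) = ket s' ∧
      (∀ q, (∀ a ≤ n, q ≠ u a) → s' q = s q) ∧
      ∀ l ≤ n, s' (u l) = muxVal (fun a => s (k a)) (fun a => s (r a)) l := by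
  induction n with
  | zero =>
    refine ⟨s, rfl, fun _ _ => rfl, fun l hl => ?_⟩
    rw [Nat.le_zero.mp hl]
    exact hs 0 le_rfl
  | succ n ih =>
    obtain ⟨s₁, hrun, hoff, hval⟩ := ih (fun a ha b hb => hu a (by omega) b (by omega))
      (fun a ha b hb => hku a (by omega) b (by omega))
      (fun a ha b hb => hru a (by omega) b (by omega))
      (fun a ha b hb => hkr a (by omega) b (by omega)) (fun a ha => hs a (by omega))
    have hnn : u n ≠ u (n + 1) := fun h => by
      have := hu n (by omega) (n + 1) le_rfl h
      omega
    have hk1 : k n ≠ u (n + 1) := hku n (by omega) _ le_rfl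
    have hk0 : k n ≠ u n := hku n (by omega) _ (by omega)
    have hr1 : r n ≠ u (n + 1) := hru n (by omega) _ le_rfl
    have h1 : s₁ (u (n + 1)) = false := by
      rw [hoff _ fun a ha h => by have := hu (n + 1) le_rfl a (by omega) h; omega]
      exact hs _ le_rfl
    have h2 : s₁ (k n) = s (k n) := hoff _ fun a ha => hku n (by omega) a (by omega)
    have h3 : s₁ (r n) = s (r n) := hoff _ fun a ha => hru n (by omega) a (by omega)
    -- The target of the second `andGate` may already be `1`, but only if `k n` was `1`. By then `k
    -- n` has been flipped to `0`, so the relative phase does not occur.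
    rw [muxCircuit, Circuit.run_append, hrun, Circuit.run_append, Circuit.run_append,
      Circuit.run_append, run_andGate O hk1 hr1 (by rw [h1]; simp), run_pauliX,
      run_andGate O hk1 hnn (by
        simp only [Function.update_of_ne hk1.symm, Function.update_self, h1,
          Function.update_of_ne hk1]
        cases s₁ (k n) <;> simp), run_pauliX]
    refine ⟨_, rfl, fun q hq => ?_, fun l hl => ?_⟩
    · by_cases hqx : q = k n
      · subst hqx
        simp [Function.update_of_ne hk1, h2]
      · rw [Function.update_of_ne hqx, Function.update_of_ne (hq _ le_rfl),
          Function.update_of_ne hqx, Function.update_of_ne (hq _ le_rfl)]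
        exact hoff q fun a ha => hq a (by omega)
    · rcases Nat.lt_or_ge l (n + 1) with hln | hln
      · have hl1 : u l ≠ u (n + 1) := fun h => by
          have := hu l (by omega) (n + 1) le_rfl h
          omega
        have hlk : u l ≠ k n := (hku n (by omega) l (by omega)).symm
        rw [Function.update_of_ne hlk, Function.update_of_ne hl1, Function.update_of_ne hlk,
          Function.update_of_ne hl1]
        exact hval l (by omega)
      · obtain rfl : l = n + 1 := by omega
        simp only [Function.update_of_ne hk1.symm, Function.update_self, Function.update_of_ne hk1,
          Function.update_of_ne hk0.symm, Function.update_of_ne hnn, h1, h2, h3, hval n le_rfl,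
          muxVal]
        cases s (k n) <;> cases s (r n) <;> simp

/-- The extension of a bit string by zeros. -/
def padBits {n : ℕ} (κ : Fin n → Bool) (t : ℕ) : Bool := if h : t < n then κ ⟨t, h⟩ else false

theorem muxVal_congr {κ κ' ρ ρ' : ℕ → Bool} {n : ℕ} (h : ∀ t < n, κ t = κ' t)
    (h' : ∀ t < n, ρ t = ρ' t) : muxVal κ ρ n = muxVal κ' ρ' n := by
  induction n with
  | zero => rfl
  | succ n ih =>
    rw [muxVal, muxVal, h n (by omega), h' n (by omega),
      ih (fun t ht => h t (by omega)) fun t ht => h' t (by omega)]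

/-- Split on the top bit of `κ`: if it is set, all $2^n$ completions return bit `n` of `r`,
otherwise recurse. This is the binary expansion of `r`. Only this count of accepted keys is used
later, so no ordering of the keys enters. -/
theorem sum_muxVal (r n : ℕ) :
    ∑ κ : Fin n → Bool, (muxVal (padBits κ) r.testBit n).toNat = r % 2 ^ n := by
  induction n with
  | zero => simp [muxVal, Nat.mod_one]
  | succ n ih =>
    rw [← (Fin.snocEquiv fun _ => Bool).sum_comp, Fintype.sum_prod_type, Fintype.sum_bool,
      Nat.mod_pow_succ, ← Nat.toNat_testBit, ← ih]
    have hlast : ∀ (β : Bool) (κ : Fin n → Bool),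
        padBits ((Fin.snocEquiv fun _ => Bool) (β, κ)) n = β := by
      intro β κ
      rw [padBits, dif_pos (Nat.lt_succ_self n)]
      exact Fin.snoc_last (α := fun _ => Bool) β κ
    have hinit : ∀ (β : Bool) (κ : Fin n → Bool), ∀ t < n,
        padBits ((Fin.snocEquiv fun _ => Bool) (β, κ)) t = padBits κ t := by
      intro β κ t ht
      rw [padBits, dif_pos (Nat.lt_succ_of_lt ht), padBits, dif_pos ht]
      exact Fin.snoc_castSucc (α := fun _ => Bool) β κ ⟨t, ht⟩
    simp only [muxVal, hlast, cond_true, cond_false]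
    simp only [muxVal_congr (hinit false _) fun t _ => rfl]
    simp [add_comm]

/-- Hadamard gates on a list of qubits. -/
noncomputable def hadamards (L : List Q) : Circuit σ Q := L.map fun q => Gate.single q hadamard

/-- All listed qubits start at `0`, so no signs appear. The induction removes the last gate, whose
qubit is not touched earlier. -/
theorem run_hadamards_ket (O : Oracles σ) {L : List Q} (hL : L.Nodup) {s : Q → Bool}
    (hs : ∀ q ∈ L, s q = false) (u : Q → Bool) [Decidable (∀ q, q ∉ L → u q = s q)] :
    Circuit.run O (hadamards L) (ket s) u =
      if ∀ q, q ∉ L → u q = s q then ((Real.sqrt 2)⁻¹ : ℂ) ^ L.length else 0 := by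
  classical
  induction L using List.reverseRecOn generalizing u with
  | nil =>
    simp [hadamards, Circuit.run, ket_apply, funext_iff]
  | append_singleton L q ih =>
    have hnd := List.nodup_append.mp hL
    have hqL : q ∉ L := fun h => hnd.2.2 q h q (by simp) rfl
    have ih' := fun u => ih hnd.1 (fun r hr => hs r (by simp [hr])) u
    rw [hadamards, List.map_append, Circuit.run_append]
    simp only [List.map_cons, List.map_nil, Circuit.run, Gate.op]
    rw [singleOp_mulVec, Fintype.sum_bool]
    change hadamard.1 (u q) true * Circuit.run O (hadamards L) (ket s) _ +
      hadamard.1 (u q) false * Circuit.run O (hadamards L) (ket s) _ = _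
    have hiff : (∀ r, r ∉ L → Function.update u q false r = s r) ↔
        ∀ r, r ∉ L ++ [q] → u r = s r := by
      constructor
      · intro h r hr
        rw [List.mem_append, List.mem_singleton, not_or] at hr
        have := h r hr.1
        rwa [Function.update_of_ne hr.2] at this
      · intro h r hr
        by_cases hrq : r = q
        · subst hrq
          rw [Function.update_self, hs r (by simp)]
        · rw [Function.update_of_ne hrq]
          exact h r (by simp [hr, hrq])
    rw [ih', ih', if_neg, if_congr hiff rfl rfl]
    · split_ifs
      · simp [hadamard, pow_succ, mul_comm]
      · simp
    · intro h
      have := h q hqL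
      rw [Function.update_self, hs q (by simp)] at this
      cases this

theorem spares_hadamards {q : Q} {L : List Q} (h : q ∉ L) :
    Circuit.Spares q (hadamards L : Circuit σ Q) := by
  intro g hg
  simp only [hadamards, List.mem_map] at hg
  obtain ⟨r, hr, rfl⟩ := hg
  exact fun e => h (e ▸ hr)

/-- Adds the qubits `src` to the qubits `tgt`. -/
def copies {ι : Type} (src tgt : ι → Q) (L : List ι) : Circuit σ Q :=
  (L.map fun i => cx (src i) (tgt i)).flatten

theorem length_copies_le {ι : Type} (src tgt : ι → Q) (L : List ι) :
    (copies src tgt L : Circuit σ Q).length ≤ L.length := by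
  induction L with
  | nil => simp [copies]
  | cons i L ih =>
    have := length_cx_le (σ := σ) (src i) (tgt i)
    simp only [copies, List.map_cons, List.flatten_cons, List.length_append,
      List.length_cons] at ih ⊢
    omega

theorem spares_copies {ι : Type} {q : Q} {src tgt : ι → Q} {L : List ι} (h : ∀ i ∈ L, q ≠ tgt i) :
    Circuit.Spares q (copies src tgt L : Circuit σ Q) := by
  intro g hg
  simp only [copies, List.mem_flatten, List.mem_map] at hg
  obtain ⟨_, ⟨i, hi, rfl⟩, hg⟩ := hg
  exact spares_cx (h i hi) g hg

theorem run_copies (O : Oracles σ) {ι : Type} {src tgt : ι → Q} {L : List ι} (hL : L.Nodup)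
    (ht : Function.Injective tgt) (hst : ∀ i j, src i ≠ tgt j) (s : Q → Bool) :
    ∃ s' : Q → Bool, Circuit.run O (copies src tgt L) (ket s) = ket s' ∧
      (∀ q, (∀ i ∈ L, q ≠ tgt i) → s' q = s q) ∧
      ∀ i ∈ L, s' (tgt i) = xor (s (tgt i)) (s (src i)) := by
  induction L generalizing s with
  | nil => exact ⟨s, rfl, fun _ _ => rfl, by simp⟩
  | cons i L ih =>
    rw [List.nodup_cons] at hL
    obtain ⟨s', hrun, hoff, hval⟩ := ih hL.2 (Function.update s (tgt i) (xor (s (tgt i)) (s (src i))))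
    refine ⟨s', ?_, fun q hq => ?_, fun j hj => ?_⟩
    · rw [copies, List.map_cons, List.flatten_cons, Circuit.run_append, run_cx O (hst i i)]
      exact hrun
    · rw [hoff q fun j hj => hq j (by simp [hj]), Function.update_of_ne (hq i (by simp))]
    · have hne : ∀ k, Function.update s (tgt i) (xor (s (tgt i)) (s (src i))) (src k) = s (src k) :=
        fun k => Function.update_of_ne (hst k i) _ _
      rcases List.mem_cons.mp hj with rfl | hj
      · rw [hoff _ fun k hk h => hL.1 (by rwa [ht h]), Function.update_self]
      · rw [hval j hj, hne, Function.update_of_ne fun h => hL.1 (by rwa [← ht h])]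

end Gadgets

end QAlg


namespace QAlg

/-! ### Controlled queries on basis states -/

section Queries

variable {σ : Sizes} {Q : Type} [Fintype Q] [DecidableEq Q]

theorem extend_eq_of {ι : Type} {e : ι ↪ Q} {u : ι → Bool} {s s' : Q → Bool}
    (h1 : ∀ i, s' (e i) = u i) (h2 : ∀ q, (∀ i, e i ≠ q) → s' q = s q) :
    Function.extend e u s = s' := by
  funext q
  by_cases hq : ∃ i, e i = q
  · obtain ⟨i, rfl⟩ := hq
    rw [e.injective.extend_apply, h1]
  · rw [Function.extend_apply' _ _ _ hq, h2 q fun i hi => hq ⟨i, hi⟩]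

theorem liftOp_mulVec_ket {ι : Type} [Fintype ι] [DecidableEq ι] (e : ι ↪ Q)
    (U : Matrix (ι → Bool) (ι → Bool) ℂ) (s : Q → Bool) :
    liftOp e U *ᵥ ket s = ∑ u, (U *ᵥ ket (s ∘ e)) u • ket (Function.extend e u s) := by
  classical
  funext t
  rw [ket, ket, Matrix.mulVec_single_one, Matrix.mulVec_single_one]
  simp only [Finset.sum_apply, Pi.smul_apply, smul_eq_mul, ket_apply, Matrix.col_apply, liftOp,
    Matrix.of_apply]
  by_cases h : ∀ q, q ∉ Set.range e → t q = s q
  · rw [if_pos h, Finset.sum_eq_single (t ∘ e)]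
    · rw [if_pos, mul_one]
      exact (extend_eq_of (fun _ => rfl) fun q hq => h q (by simpa using hq)).symm
    · intro u _ hu
      rw [if_neg, mul_zero]
      rintro rfl
      exact hu (extend_comp_emb e u s).symm
    · simp
  · rw [if_neg h]
    symm
    refine Finset.sum_eq_zero fun u _ => ?_
    rw [if_neg, mul_zero]
    rintro rfl
    exact h fun q hq => Function.extend_apply' _ _ _ (by simpa using hq)

/-- The form in which oracle specifications are used: any expansion of the local output carries
over, with no injectivity of `p` required. -/
theorem liftOp_mulVec_ket_of_eq {ι : Type} [Fintype ι] [DecidableEq ι] {e : ι ↪ Q}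
    {U : Matrix (ι → Bool) (ι → Bool) ℂ} {s : Q → Bool} {K : Type*} [Fintype K] {c : K → ℂ}
    {p : K → ι → Bool} (h : U *ᵥ ket (s ∘ e) = ∑ k, c k • ket (p k)) :
    liftOp e U *ᵥ ket s = ∑ k, c k • ket (Function.extend e (p k) s) := by
  rw [liftOp_mulVec_ket, h]
  simp only [Finset.sum_apply, Pi.smul_apply, smul_eq_mul, ket_apply, Finset.sum_smul]
  rw [Finset.sum_comm]
  refine Finset.sum_congr rfl fun k _ => ?_
  rw [Finset.sum_eq_single (p k)]
  · simp
  · intro u _ hu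
    rw [if_neg hu, mul_zero, zero_smul]
  · simp

theorem run_controlled_query_of_false (O : Oracles σ) {o : OracleName} {e : σ.Wires o ↪ Q}
    {c : {q : Q // q ∉ Set.range e}} {s : Q → Bool} (hc : s c = false) :
    Circuit.run O [Gate.query o e false (some c)] (ket s) = ket s := by
  simp [Circuit.run, Gate.op, controlOp_mulVec, hc]

theorem run_controlled_query_of_true (O : Oracles σ) {o : OracleName} {e : σ.Wires o ↪ Q}
    {c : {q : Q // q ∉ Set.range e}} {s : Q → Bool} (hc : s c = true) {K : Type*} [Fintype K]
    {f : K → ℂ} {p : K → σ.Wires o → Bool}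
    (h : (O o).1 *ᵥ ket (s ∘ e) = ∑ k, f k • ket (p k)) :
    Circuit.run O [Gate.query o e false (some c)] (ket s) =
      ∑ k, f k • ket (Function.extend e (p k) s) := by
  simp only [Circuit.run, Gate.op, controlOp_mulVec, hc, if_true, Bool.false_eq_true, if_false]
  exact liftOp_mulVec_ket_of_eq h

theorem spares_query {q : Q} {o : OracleName} {e : σ.Wires o ↪ Q} {i : Bool}
    {c : Option {q : Q // q ∉ Set.range e}} (h : ∀ x, q ≠ e x) :
    Circuit.Spares q [Gate.query o e i c] := by
  intro g hg
  rw [List.mem_singleton] at hg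
  subst hg
  rintro ⟨x, hx⟩
  exact h x hx.symm

end Queries

/-! ### Tensor products of basis states -/

section Tensor

variable {Q R : Type} [Fintype Q] [DecidableEq Q] [Fintype R] [DecidableEq R]

theorem tensor_ket_ket (s : Q → Bool) (t : R → Bool) :
    tensor (ket s) (ket t) = ket (Sum.elim s t) := by
  funext u
  have : u = Sum.elim s t ↔ u ∘ Sum.inl = s ∧ u ∘ Sum.inr = t := by
    constructor
    · rintro rfl
      exact ⟨rfl, rfl⟩
    · rintro ⟨h1, h2⟩
      rw [← Sum.elim_comp_inl_inr u, h1, h2]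
  simp only [tensor, ket_apply, this]
  split_ifs <;> simp_all

theorem tensor_sum_right {K : Type*} (S : Finset K) (f : State Q) (g : K → State R) :
    tensor f (∑ k ∈ S, g k) = ∑ k ∈ S, tensor f (g k) := by
  funext u
  simp [tensor, Finset.mul_sum]

theorem tensor_smul_right (f : State Q) (c : ℂ) (g : State R) :
    tensor f (c • g) = c • tensor f g := by
  funext u
  simp [tensor, mul_left_comm]

end Tensor

/-! ### Registers, preparation and selected queries -/

section Layout

/-- The work qubits: copies of the two indices, a norm register, the register that is compared with the
norm, its carries, the bit that selects `x` or `y`, the failure flag, the signal processing qubit, and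
scratch space for the reflections. -/
inductive Work (a b B S : ℕ) : Type
  | ci (r : Fin a) | cj (r : Fin a) | num (r : Fin b) | key (r : Fin B) | car (r : Fin (B + 1))
  | sel | flag | anc | scr (r : Fin S)
  deriving DecidableEq, Fintype

/-- All qubits of the algorithm. -/
abbrev Wire (a d b B S : ℕ) : Type := Fin a ⊕ (Fin a ⊕ (Fin d ⊕ Work a b B S))

namespace Wire

variable {a d b B S : ℕ}

/-- A work qubit. -/
abbrev work (x : Work a b B S) : Wire a d b B S := Sum.inr (Sum.inr (Sum.inr x))

/-- A qubit of the first index register. -/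
abbrev fst (r : Fin a) : Wire a d b B S := Sum.inl r

/-- A qubit of the second index register. -/
abbrev snd (r : Fin a) : Wire a d b B S := Sum.inr (Sum.inl r)

/-- A qubit of the vector register. -/
abbrev vec (r : Fin d) : Wire a d b B S := Sum.inr (Sum.inr (Sum.inl r))

/-- The qubits that the oracles are applied to. -/
def oracle : ∀ o : OracleName, (Sizes.mk a d b).Wires o ↪ Wire a d b B S
  | .vecX => ⟨Sum.elim (fun r : Fin a => work (.ci r)) (fun r : Fin d => vec r),
      Function.Injective.sumElim (fun x y h => by cases h; rfl) (fun x y h => by cases h; rfl)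
        (by simp)⟩
  | .vecY => ⟨Sum.elim (fun r : Fin a => work (.cj r)) (fun r : Fin d => vec r),
      Function.Injective.sumElim (fun x y h => by cases h; rfl) (fun x y h => by cases h; rfl)
        (by simp)⟩
  | .normX => ⟨Sum.elim (fun r : Fin a => work (.ci r)) (fun r : Fin b => work (.num r)),
      Function.Injective.sumElim (fun x y h => by cases h; rfl) (fun x y h => by cases h; rfl)
        (by simp)⟩
  | .normY => ⟨Sum.elim (fun r : Fin a => work (.cj r)) (fun r : Fin b => work (.num r)),
      Function.Injective.sumElim (fun x y h => by cases h; rfl) (fun x y h => by cases h; rfl)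
        (by simp)⟩

theorem oracle_ne {o : OracleName} {x : Work a b B S} (h1 : ∀ r, x ≠ .ci r) (h2 : ∀ r, x ≠ .cj r)
    (h3 : ∀ r, x ≠ .num r) (y : (Sizes.mk a d b).Wires o) : work x ≠ oracle o y := by
  intro h
  match o, y, h with
  | .vecX, .inl r, h => exact h1 r (Sum.inr.inj (Sum.inr.inj (Sum.inr.inj h)))
  | .vecX, .inr r, h => cases Sum.inr.inj (Sum.inr.inj h)
  | .vecY, .inl r, h => exact h2 r (Sum.inr.inj (Sum.inr.inj (Sum.inr.inj h)))
  | .vecY, .inr r, h => cases Sum.inr.inj (Sum.inr.inj h)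
  | .normX, .inl r, h => exact h1 r (Sum.inr.inj (Sum.inr.inj (Sum.inr.inj h)))
  | .normX, .inr r, h => exact h3 r (Sum.inr.inj (Sum.inr.inj (Sum.inr.inj h)))
  | .normY, .inl r, h => exact h2 r (Sum.inr.inj (Sum.inr.inj (Sum.inr.inj h)))
  | .normY, .inr r, h => exact h3 r (Sum.inr.inj (Sum.inr.inj (Sum.inr.inj h)))

theorem sel_notMem_range (o : OracleName) :
    work .sel ∉ Set.range (oracle (a := a) (d := d) (b := b) (B := B) (S := S) o) := by
  rintro ⟨y, hy⟩
  exact oracle_ne (by simp) (by simp) (by simp) y hy.symm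

/-- The basis state with the given register contents; all other work qubits are `0`. -/
def state (i j : Fin a → Bool) (v : Fin d → Bool) (ci cj : Fin a → Bool) (num : Fin b → Bool)
    (key : Fin B → Bool) (sel flag : Bool) : Wire a d b B S → Bool :=
  Sum.elim i (Sum.elim j (Sum.elim v fun
    | .ci r => ci r
    | .cj r => cj r
    | .num r => num r
    | .key r => key r
    | .car _ => false
    | .sel => sel
    | .flag => flag
    | .anc => false
    | .scr _ => false))

theorem state_inj {i j i' j' : Fin a → Bool} {v v' : Fin d → Bool} {ci cj ci' cj' : Fin a → Bool}
    {num num' : Fin b → Bool} {key key' : Fin B → Bool} {sel flag sel' flag' : Bool} :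
    (state i j v ci cj num key sel flag : Wire a d b B S → Bool) =
      state i' j' v' ci' cj' num' key' sel' flag' ↔
    i = i' ∧ j = j' ∧ v = v' ∧ ci = ci' ∧ cj = cj' ∧ num = num' ∧ key = key' ∧ sel = sel' ∧
      flag = flag' := by
  constructor
  · intro h
    exact ⟨funext fun r => congrFun h (fst r), funext fun r => congrFun h (snd r),
      funext fun r => congrFun h (vec r), funext fun r => congrFun h (work (.ci r)),
      funext fun r => congrFun h (work (.cj r)), funext fun r => congrFun h (work (.num r)),
      funext fun r => congrFun h (work (.key r)), congrFun h (work .sel),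
      congrFun h (work .flag)⟩
  · rintro ⟨rfl, rfl, rfl, rfl, rfl, rfl, rfl, rfl, rfl⟩
    rfl

/-- The bit string of zeros. -/
abbrev zero {n : ℕ} : Fin n → Bool := fun _ => false

theorem bits_zero (n : ℕ) : bits n 0 = zero := by
  funext r; simp [bits]

/-- Copies both indices. -/
def copyIndices : Circuit (Sizes.mk a d b) (Wire a d b B S) :=
  copies fst (fun r => work (.ci r)) (List.finRange a) ++
    copies snd (fun r => work (.cj r)) (List.finRange a)

/-- The oracles are applied to copies of the indices. Their action off the specified inputs is
arbitrary, so this is what guarantees that the original index registers are never changed. -/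
theorem run_copyIndices (O : Oracles (Sizes.mk a d b)) (i j : Fin a → Bool) (v : Fin d → Bool)
    (num : Fin b → Bool) (key : Fin B → Bool) (sel flag : Bool) :
    Circuit.run O copyIndices
      (ket (state i j v zero zero num key sel flag : Wire a d b B S → Bool)) =
      ket (state i j v i j num key sel flag) := by
  obtain ⟨s₁, h1, h1', h1''⟩ := run_copies O (List.nodup_finRange a)
    (src := (fst : _ → Wire a d b B S)) (tgt := fun r => work (.ci r))
    (fun x y h => by simpa using h) (by simp) (state i j v zero zero num key sel flag)
  obtain ⟨s₂, h2, h2', h2''⟩ := run_copies O (List.nodup_finRange a)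
    (src := (snd : _ → Wire a d b B S)) (tgt := fun r => work (.cj r))
    (fun x y h => by simpa using h) (by simp) s₁
  rw [copyIndices, Circuit.run_append, h1, h2]
  congr 1
  have off : ∀ q : Wire a d b B S, (∀ r, q ≠ work (.ci r)) → (∀ r, q ≠ work (.cj r)) →
      s₂ q = state i j v zero zero num key sel flag q := fun q hi hj => by
    rw [h2' q fun r _ => hj r, h1' q fun r _ => hi r]
  funext q
  rcases q with q | q | q | q
  · exact off _ (by simp) (by simp)
  · exact off _ (by simp) (by simp)
  · exact off _ (by simp) (by simp)
  · cases q with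
    | ci r =>
      rw [h2' _ (by simp), h1'' r (List.mem_finRange r)]
      simp [state]
    | cj r =>
      rw [h2'' r (List.mem_finRange r), h1' _ (by simp), h1' _ (by simp)]
      simp [state]
    | _ => exact off _ (by simp) (by simp)

/-- The qubits that select one of the vectors and are compared with its norm. -/
def randomQubits : List (Wire a d b B S) :=
  work .sel :: (List.finRange B).map fun r => work (.key r)

theorem nodup_randomQubits : (randomQubits : List (Wire a d b B S)).Nodup := by
  rw [randomQubits, List.nodup_cons]
  exact ⟨by simp, (List.nodup_finRange B).map fun x y h => by simpa using h⟩

/-- Copies the indices and creates a uniform superposition. -/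
noncomputable def prepare : Circuit (Sizes.mk a d b) (Wire a d b B S) :=
  copyIndices ++ hadamards randomQubits

theorem run_prepare (O : Oracles (Sizes.mk a d b)) (i j : Fin a → Bool) (v : Fin d → Bool)
    (flag : Bool) :
    Circuit.run O prepare (ket (state i j v zero zero zero zero false flag : Wire a d b B S → Bool)) =
      ((Real.sqrt 2)⁻¹ : ℂ) ^ (B + 1) • ∑ x : Bool × (Fin B → Bool),
        ket (state i j v i j zero x.2 x.1 flag) := by
  classical
  rw [prepare, Circuit.run_append, run_copyIndices]
  funext u
  rw [run_hadamards_ket O nodup_randomQubits (by simp [randomQubits, state])]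
  simp only [Pi.smul_apply, Finset.sum_apply, ket_apply, smul_eq_mul]
  by_cases h : ∀ q, q ∉ (randomQubits : List (Wire a d b B S)) →
      u q = state i j v i j zero zero false flag q
  · rw [if_pos h, Finset.sum_eq_single (u (work .sel), fun r => u (work (.key r))), if_pos]
    · simp [randomQubits]
    · funext q
      by_cases hq : q ∈ (randomQubits : List (Wire a d b B S))
      · simp only [randomQubits, List.mem_cons, List.mem_map, List.mem_finRange, true_and] at hq
        rcases hq with rfl | ⟨r, rfl⟩ <;> rfl
      · rw [h q hq]
        rcases q with q | q | q | q
        · rfl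
        · rfl
        · rfl
        · cases q <;> first | rfl | simp [randomQubits] at hq
    · intro x _ hx
      rw [if_neg]
      rintro rfl
      exact hx rfl
    · simp
  · rw [if_neg h, Finset.sum_eq_zero, mul_zero]
    intro x _
    rw [if_neg]
    rintro rfl
    refine h fun q hq => ?_
    rcases q with q | q | q | q
    · rfl
    · rfl
    · rfl
    · cases q <;> first | rfl | simp [randomQubits] at hq

/-- Queries one of two oracles, depending on the selection qubit. -/
def selectQuery (o o' : OracleName) : Circuit (Sizes.mk a d b) (Wire a d b B S) :=
  [Gate.single (work .sel) pauliX] ++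
    [Gate.query o (oracle o) false (some ⟨work .sel, sel_notMem_range o⟩)] ++
    [Gate.single (work .sel) pauliX] ++
    [Gate.query o' (oracle o') false (some ⟨work .sel, sel_notMem_range o'⟩)]

theorem update_sel_state (i j : Fin a → Bool) (v : Fin d → Bool) (ci cj : Fin a → Bool)
    (num : Fin b → Bool) (key : Fin B → Bool) (sel sel' flag : Bool) :
    Function.update (state i j v ci cj num key sel flag : Wire a d b B S → Bool) (work .sel) sel' =
      state i j v ci cj num key sel' flag := by
  symm
  rw [eq_update_iff]
  refine ⟨rfl, fun q hq => ?_⟩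
  rcases q with q | q | q | q
  · rfl
  · rfl
  · rfl
  · cases q <;> first | rfl | exact absurd rfl hq

theorem run_pauliX_sel (O : Oracles (Sizes.mk a d b)) (i j : Fin a → Bool) (v : Fin d → Bool)
    (ci cj : Fin a → Bool) (num : Fin b → Bool) (key : Fin B → Bool) (sel flag : Bool) :
    Circuit.run O [Gate.single (work .sel) pauliX]
      (ket (state i j v ci cj num key sel flag : Wire a d b B S → Bool)) =
      ket (state i j v ci cj num key (!sel) flag) := by
  rw [run_pauliX, update_sel_state]
  rfl

variable {i j : Fin a → Bool} {O : Oracles (Sizes.mk a d b)}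

/-- The two flips make exactly one of the queries active. The sum over `Unit` in the hypotheses
gives basis outputs the same shape as superpositions. -/
theorem run_selectQuery_norm {rx ry : ℕ}
    (hx : ((O .normX).1 : Matrix (Fin a ⊕ Fin b → Bool) (Fin a ⊕ Fin b → Bool) ℂ) *ᵥ
      ket (Sum.elim i zero) = ∑ _k : Unit, (1 : ℂ) • ket (Sum.elim i (bits b rx)))
    (hy : ((O .normY).1 : Matrix (Fin a ⊕ Fin b → Bool) (Fin a ⊕ Fin b → Bool) ℂ) *ᵥ
      ket (Sum.elim j zero) = ∑ _k : Unit, (1 : ℂ) • ket (Sum.elim j (bits b ry)))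
    (i' j' : Fin a → Bool) (v : Fin d → Bool) (key : Fin B → Bool) (sel flag : Bool) :
    Circuit.run O (selectQuery .normX .normY)
      (ket (state i' j' v i j zero key sel flag : Wire a d b B S → Bool)) =
      ket (state i' j' v i j (bits b (bif sel then ry else rx)) key sel flag) := by
  rw [selectQuery, Circuit.run_append, Circuit.run_append, Circuit.run_append, run_pauliX_sel]
  cases sel
  · rw [run_controlled_query_of_true O (o := .normX) (K := Unit) (f := fun _ => 1)
      (p := fun _ => Sum.elim i (bits b rx)) rfl]
    · simp only [Finset.univ_unique, one_smul, Finset.sum_const, Finset.card_singleton]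
      have : Function.extend (oracle .normX) (Sum.elim i (bits b rx))
          (state i' j' v i j zero key (!false) flag : Wire a d b B S → Bool) =
          state i' j' v i j (bits b rx) key true flag := by
        refine extend_eq_of (by rintro (x | x) <;> rfl) ?_
        rintro (q | q | q | q) hq
        · rfl
        · rfl
        · rfl
        · cases q <;> first | rfl | exact absurd rfl (hq (Sum.inr _))
      rw [this, run_pauliX_sel, run_controlled_query_of_false O rfl]
      rfl
    · refine Eq.trans (congrArg (fun z => (O .normX).1 *ᵥ ket z) ?_) hx
      funext x
      rcases x with x | x <;> rfl
  · rw [run_controlled_query_of_false O rfl, run_pauliX_sel,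
      run_controlled_query_of_true O (o := .normY) (K := Unit) (f := fun _ => 1)
      (p := fun _ => Sum.elim j (bits b ry)) rfl]
    · simp only [Finset.univ_unique, one_smul, Finset.sum_const, Finset.card_singleton]
      congr 1
      refine extend_eq_of (by rintro (x | x) <;> rfl) ?_
      rintro (q | q | q | q) hq
      · rfl
      · rfl
      · rfl
      · cases q <;> first | rfl | exact absurd rfl (hq (Sum.inr _))
    · refine Eq.trans (congrArg (fun z => (O .normY).1 *ᵥ ket z) ?_) hy
      funext x
      rcases x with x | x <;> rfl

theorem run_selectQuery_vec {n : ℕ} {ux uy : EuclideanSpace ℂ (Fin n)}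
    (hx : ((O .vecX).1 : Matrix (Fin a ⊕ Fin d → Bool) (Fin a ⊕ Fin d → Bool) ℂ) *ᵥ
      ket (Sum.elim i zero) = ∑ k, ux k • ket (Sum.elim i (bits d k)))
    (hy : ((O .vecY).1 : Matrix (Fin a ⊕ Fin d → Bool) (Fin a ⊕ Fin d → Bool) ℂ) *ᵥ
      ket (Sum.elim j zero) = ∑ k, uy k • ket (Sum.elim j (bits d k)))
    (i' j' : Fin a → Bool) (num : Fin b → Bool) (key : Fin B → Bool) (sel flag : Bool) :
    Circuit.run O (selectQuery .vecX .vecY)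
      (ket (state i' j' zero i j num key sel flag : Wire a d b B S → Bool)) =
      ∑ k : Fin n, (bif sel then uy k else ux k) •
        ket (state i' j' (bits d k) i j num key sel flag) := by
  rw [selectQuery, Circuit.run_append, Circuit.run_append, Circuit.run_append, run_pauliX_sel]
  cases sel
  · rw [run_controlled_query_of_true O (o := .vecX) (f := fun k => ux k)
      (p := fun k : Fin n => Sum.elim i (bits d k)) rfl]
    · rw [Circuit.run_sum, Circuit.run_sum]
      refine Finset.sum_congr rfl fun k _ => ?_
      have : Function.extend (oracle .vecX) (Sum.elim i (bits d k))
          (state i' j' zero i j num key (!false) flag : Wire a d b B S → Bool) =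
          state i' j' (bits d k) i j num key true flag := by
        refine extend_eq_of (by rintro (x | x) <;> rfl) ?_
        rintro (q | q | q | q) hq
        · rfl
        · rfl
        · exact absurd rfl (hq (Sum.inr _))
        · cases q <;> rfl
      rw [Circuit.run_smul, Circuit.run_smul, this, run_pauliX_sel,
        run_controlled_query_of_false O rfl]
      rfl
    · refine Eq.trans (congrArg (fun z => (O .vecX).1 *ᵥ ket z) ?_) hx
      funext x
      rcases x with x | x <;> rfl
  · rw [run_controlled_query_of_false O rfl, run_pauliX_sel,
      run_controlled_query_of_true O (o := .vecY) (f := fun k => uy k)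
      (p := fun k : Fin n => Sum.elim j (bits d k)) rfl]
    · refine Finset.sum_congr rfl fun k _ => ?_
      have : Function.extend (oracle .vecY) (Sum.elim j (bits d k))
          (state i' j' zero i j num key (!!true) flag : Wire a d b B S → Bool) =
          state i' j' (bits d k) i j num key true flag := by
        refine extend_eq_of (by rintro (x | x) <;> rfl) ?_
        rintro (q | q | q | q) hq
        · rfl
        · rfl
        · exact absurd rfl (hq (Sum.inr _))
        · cases q <;> rfl
      rw [this]
      rfl
    · refine Eq.trans (congrArg (fun z => (O .vecY).1 *ᵥ ket z) ?_) hy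
      funext x
      rcases x with x | x <;> rfl

end Wire

end Layout

end QAlg


namespace QAlg

/-! ### The circuit whose amplitudes are those of the difference -/

namespace Wire

variable {a d b B S : ℕ}

/-- The register that is compared with the norm, as a sequence. -/
def keyWire (t : ℕ) : Wire a d b B S := if h : t < B then work (.key ⟨t, h⟩) else work .sel

/-- The norm register as a sequence. -/
def numWire (t : ℕ) : Wire a d b B S := if h : t < b then work (.num ⟨t, h⟩) else work .sel

/-- The carries as a sequence. -/
def carWire (t : ℕ) : Wire a d b B S := if h : t < B + 1 then work (.car ⟨t, h⟩) else work .sel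

theorem keyWire_of_lt {t : ℕ} (h : t < B) :
    (keyWire t : Wire a d b B S) = work (.key ⟨t, h⟩) := dif_pos h

theorem numWire_of_lt {t : ℕ} (h : t < b) :
    (numWire t : Wire a d b B S) = work (.num ⟨t, h⟩) := dif_pos h

theorem carWire_of_le {t : ℕ} (h : t ≤ B) :
    (carWire t : Wire a d b B S) = work (.car ⟨t, Nat.lt_succ_of_le h⟩) :=
  dif_pos (Nat.lt_succ_of_le h)

/-- The computation of the carries. -/
noncomputable def carries : Circuit (Sizes.mk a d b) (Wire a d b B S) :=
  muxCircuit keyWire numWire carWire B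

/-- Sets the failure flag if the key is not below the norm. -/
noncomputable def compare : Circuit (Sizes.mk a d b) (Wire a d b B S) :=
  carries ++ ([Gate.single (work .flag) pauliX] ++ cx (carWire B) (work .flag)) ++
    Circuit.inv carries

theorem update_flag_state (i j : Fin a → Bool) (v : Fin d → Bool) (ci cj : Fin a → Bool)
    (num : Fin b → Bool) (key : Fin B → Bool) (sel flag flag' : Bool) :
    Function.update (state i j v ci cj num key sel flag : Wire a d b B S → Bool) (work .flag) flag' =
      state i j v ci cj num key sel flag' := by
  symm
  rw [eq_update_iff]
  refine ⟨rfl, fun q hq => ?_⟩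
  rcases q with q | q | q | q
  · rfl
  · rfl
  · rfl
  · cases q <;> first | rfl | exact absurd rfl hq

theorem run_carries (hB : B ≤ b) (O : Oracles (Sizes.mk a d b)) (i j : Fin a → Bool)
    (v : Fin d → Bool) (ci cj : Fin a → Bool) (num : Fin b → Bool) (key : Fin B → Bool)
    (sel flag : Bool) :
    ∃ s' : Wire a d b B S → Bool,
      Circuit.run O carries (ket (state i j v ci cj num key sel flag)) = ket s' ∧
      (∀ q, (∀ r, q ≠ work (.car r)) → s' q = state i j v ci cj num key sel flag q) ∧
      ∀ r, s' (work (.car r)) = muxVal (padBits key) (padBits num) r := by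
  obtain ⟨s', h1, h2, h3⟩ := run_muxCircuit O (k := (keyWire : ℕ → Wire a d b B S))
    (r := numWire) (u := carWire) (n := B)
    (fun l hl l' hl' h => by
      rw [carWire_of_le hl, carWire_of_le hl'] at h
      simpa using h)
    (fun l hl l' hl' h => by
      rw [keyWire_of_lt hl, carWire_of_le hl'] at h
      simp at h)
    (fun l hl l' hl' h => by
      rw [numWire_of_lt (hl.trans_le hB), carWire_of_le hl'] at h
      simp at h)
    (fun l hl l' hl' h => by
      rw [keyWire_of_lt hl, numWire_of_lt (hl'.trans_le hB)] at h
      simp at h)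
    (s := state i j v ci cj num key sel flag)
    (fun l hl => by rw [carWire_of_le hl]; rfl)
  refine ⟨s', h1, fun q hq => h2 q fun l hl => ?_, fun r => ?_⟩
  · rw [carWire_of_le hl]
    exact hq _
  · have h := h3 r (Nat.lt_succ_iff.mp r.2)
    rw [carWire_of_le (Nat.lt_succ_iff.mp r.2)] at h
    rw [h]
    refine muxVal_congr (fun t ht => ?_) fun t ht => ?_
    · have htB : t < B := ht.trans_le (Nat.lt_succ_iff.mp r.2)
      rw [keyWire_of_lt htB, padBits, dif_pos htB]
      rfl
    · have htb : t < b := (ht.trans_le (Nat.lt_succ_iff.mp r.2)).trans_le hB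
      rw [numWire_of_lt htb, padBits, dif_pos htb]
      rfl

/-- The carries do not depend on the flag. Hence the state after setting the flag is also what
`carries` makes of the final state, and its inverse clears the scratch bits. -/
theorem run_compare (hB : B ≤ b) (O : Oracles (Sizes.mk a d b)) (i j : Fin a → Bool)
    (v : Fin d → Bool) (ci cj : Fin a → Bool) (num : Fin b → Bool) (key : Fin B → Bool)
    (sel : Bool) :
    Circuit.run O compare (ket (state i j v ci cj num key sel false : Wire a d b B S → Bool)) =
      ket (state i j v ci cj num key sel (!muxVal (padBits key) (padBits num) B)) := by
  obtain ⟨s₁, h1, h1', h1''⟩ := run_carries (S := S) hB O i j v ci cj num key sel false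
  obtain ⟨s₂, h2, h2', h2''⟩ := run_carries (S := S) hB O i j v ci cj num key sel
    (!muxVal (padBits key) (padBits num) B)
  have hcar : (carWire B : Wire a d b B S) = work (.car ⟨B, Nat.lt_succ_self B⟩) :=
    carWire_of_le le_rfl
  have hne : (carWire B : Wire a d b B S) ≠ work .flag := by rw [hcar]; simp
  have hs : Function.update (Function.update s₁ (work .flag) !s₁ (work .flag)) (work .flag)
      (xor (Function.update s₁ (work .flag) (!s₁ (work .flag)) (work .flag))
        (Function.update s₁ (work .flag) (!s₁ (work .flag)) (carWire B))) = s₂ := by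
    symm
    rw [Function.update_idem, eq_update_iff]
    refine ⟨?_, fun q hq => ?_⟩
    · rw [h2' _ (by simp), Function.update_self, Function.update_of_ne hne, hcar, h1'',
        h1' _ (by simp)]
      simp [state]
    · by_cases hc : ∃ r, q = work (.car r)
      · obtain ⟨r, rfl⟩ := hc
        rw [h1'', h2'']
      · rw [h1' q fun r hr => hc ⟨r, hr⟩, h2' q fun r hr => hc ⟨r, hr⟩,
          ← update_flag_state i j v ci cj num key sel false, Function.update_of_ne hq]
  rw [compare, Circuit.run_append, Circuit.run_append, h1, Circuit.run_append, run_pauliX,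
    run_cx O hne, hs, ← h2, Circuit.run_inv_run]

/-- Computes the failure flag and the selected vector. -/
noncomputable def select : Circuit (Sizes.mk a d b) (Wire a d b B S) :=
  selectQuery .normX .normY ++ compare ++ Circuit.inv (selectQuery .normX .normY) ++
    selectQuery .vecX .vecY

/-- The oracles, given as matrices, act on the indices `i` and `j` in the expected way. -/
structure ActsAt {n : ℕ} (O : Oracles (Sizes.mk a d b)) (i j : Fin a → Bool)
    (ux uy : EuclideanSpace ℂ (Fin n)) (rx ry : ℕ) : Prop where
  vecX : ((O .vecX).1 : Matrix (Fin a ⊕ Fin d → Bool) (Fin a ⊕ Fin d → Bool) ℂ) *ᵥ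
    ket (Sum.elim i zero) = ∑ k, ux k • ket (Sum.elim i (bits d k))
  vecY : ((O .vecY).1 : Matrix (Fin a ⊕ Fin d → Bool) (Fin a ⊕ Fin d → Bool) ℂ) *ᵥ
    ket (Sum.elim j zero) = ∑ k, uy k • ket (Sum.elim j (bits d k))
  normX : ((O .normX).1 : Matrix (Fin a ⊕ Fin b → Bool) (Fin a ⊕ Fin b → Bool) ℂ) *ᵥ
    ket (Sum.elim i zero) = ∑ _k : Unit, (1 : ℂ) • ket (Sum.elim i (bits b rx))
  normY : ((O .normY).1 : Matrix (Fin a ⊕ Fin b → Bool) (Fin a ⊕ Fin b → Bool) ℂ) *ᵥ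
    ket (Sum.elim j zero) = ∑ _k : Unit, (1 : ℂ) • ket (Sum.elim j (bits b ry))

variable {i j : Fin a → Bool} {O : Oracles (Sizes.mk a d b)} {n : ℕ}
  {ux uy : EuclideanSpace ℂ (Fin n)} {rx ry : ℕ}

/-- The norm query acts identically for both values of the flag, so its inverse erases the norm
while the flag stays. -/
theorem run_select (hB : B ≤ b) (hO : ActsAt O i j ux uy rx ry) (i' j' : Fin a → Bool)
    (key : Fin B → Bool) (sel : Bool) :
    Circuit.run O select
      (ket (state i' j' zero i j zero key sel false : Wire a d b B S → Bool)) =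
      ∑ k : Fin n, (bif sel then uy k else ux k) • ket (state i' j' (bits d k) i j zero key sel
        (!muxVal (padBits key) (Nat.testBit (bif sel then ry else rx)) B)) := by
  have hmux : muxVal (padBits key) (padBits (bits b (bif sel then ry else rx))) B =
      muxVal (padBits key) (Nat.testBit (bif sel then ry else rx)) B :=
    muxVal_congr (fun t _ => rfl) fun t ht => by
      rw [padBits, dif_pos (ht.trans_le hB)]
      rfl
  rw [select, Circuit.run_append, Circuit.run_append, Circuit.run_append,
    run_selectQuery_norm hO.normX hO.normY, run_compare hB, hmux,
    ← run_selectQuery_norm hO.normX hO.normY, Circuit.run_inv_run,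
    run_selectQuery_vec hO.vecX hO.vecY]

/-- The circuit whose amplitudes at zero work qubits are those of the difference. -/
noncomputable def combine : Circuit (Sizes.mk a d b) (Wire a d b B S) :=
  prepare ++ [Gate.single (work .sel) (signGate 1 (-1))] ++ select ++ Circuit.inv prepare

/-- With the final unpreparation moved to the other side, the amplitude is an inner product with a
uniform superposition. Each branch contributes its number of accepted keys times its unit vector,
and the sign gate makes this a difference. -/
theorem run_combine_apply (hB : B ≤ b) (hO : ActsAt O i j ux uy rx ry) (hx : rx < 2 ^ B)
    (hy : ry < 2 ^ B) (w : Fin d → Bool) :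
    Circuit.run O combine
      (ket (state i j zero zero zero zero zero false false : Wire a d b B S → Bool))
      (state i j w zero zero zero zero false false) =
      ((1 / 2 : ℂ) ^ (B + 1)) * ∑ k : Fin n,
        (rx * ux k - ry * uy k) * (if w = bits d k then 1 else 0) := by
  have hcount : ∀ r : ℕ, r < 2 ^ B → ∑ κ : Fin B → Bool,
      (if muxVal (padBits κ) r.testBit B = true then (1 : ℂ) else 0) = r := by
    intro r hr
    have h := sum_muxVal r B
    rw [Nat.mod_eq_of_lt hr] at h
    refine Eq.trans ?_ (congrArg (Nat.cast : ℕ → ℂ) h)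
    push_cast
    refine Finset.sum_congr rfl fun κ _ => ?_
    cases muxVal (padBits κ) r.testBit B <;> simp
  have hmid : ∀ x : Bool × (Fin B → Bool), Circuit.run O select
      (Circuit.run O [Gate.single (work .sel) (signGate 1 (-1))]
        (ket (state i j zero i j zero x.2 x.1 false : Wire a d b B S → Bool))) =
      (bif x.1 then (-1 : ℂ) else 1) • ∑ k : Fin n, (bif x.1 then uy k else ux k) •
        ket (state i j (bits d k) i j zero x.2 x.1
        (!muxVal (padBits x.2) (Nat.testBit (bif x.1 then ry else rx)) B)) := by
    intro x
    rw [run_signGate, Circuit.run_smul, run_select hB hO]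
    congr 1
    cases x.1 <;> simp [state]
  refine (braket_ket_left _ _).symm.trans ?_
  rw [combine, Circuit.run_append, Circuit.run_append, Circuit.run_append,
    ← braket_run_left, run_prepare, run_prepare]
  simp only [Circuit.run_smul, Circuit.run_sum, hmid, braket_smul_left, braket_smul_right,
    braket_sum_left, braket_sum_right, braket_ket_left, ket_apply, state_inj]
  have hsq : star (((Real.sqrt 2)⁻¹ : ℂ) ^ (B + 1)) * ((Real.sqrt 2)⁻¹ : ℂ) ^ (B + 1) =
      (1 / 2) ^ (B + 1) := by
    rw [star_pow, ← mul_pow, star_inv₀, Complex.star_def, Complex.conj_ofReal, ← mul_inv,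
      ← Complex.ofReal_mul, Real.mul_self_sqrt (by norm_num)]
    norm_num
  -- Key and selection bit agree on both sides, so only `y = x` survives; the flag `0` on the left
  -- discards rejected keys.
  have hinner : ∀ (x : Bool × (Fin B → Bool)) (k : Fin n), (∑ y : Bool × (Fin B → Bool),
      if True ∧ True ∧ w = bits d k ∧ True ∧ True ∧ True ∧ y.2 = x.2 ∧ y.1 = x.1 ∧
        false = !muxVal (padBits x.2) (Nat.testBit (bif x.1 then ry else rx)) B then (1 : ℂ)
      else 0) = (if w = bits d k then 1 else 0) *
        (if muxVal (padBits x.2) (Nat.testBit (bif x.1 then ry else rx)) B = true then 1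
          else 0) := by
    intro x k
    rw [Finset.sum_eq_single x]
    · cases muxVal (padBits x.2) (Nat.testBit (bif x.1 then ry else rx)) B <;> simp
    · intro y _ hy
      rw [if_neg]
      rintro ⟨-, -, -, -, -, -, h1, h2, -⟩
      exact hy (Prod.ext h2 h1)
    · simp
  simp only [hinner]
  rw [← hsq, mul_comm (star _), mul_assoc]
  congr 1
  rw [Fintype.sum_prod_type, Fintype.sum_bool]
  simp only [cond_true, cond_false, Finset.mul_sum]
  rw [Finset.sum_comm, Finset.sum_comm (f := fun (κ : Fin B → Bool) (k : Fin n) => _ * (ux k * _)),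
    ← Finset.sum_add_distrib]
  refine Finset.sum_congr rfl fun k _ => ?_
  rw [← hcount rx hx, ← hcount ry hy]
  simp only [Finset.sum_mul, Finset.mul_sum, ← Finset.sum_sub_distrib, ← Finset.sum_add_distrib]
  refine Finset.sum_congr rfl fun κ _ => ?_
  ring

/-- A qubit that the state preparation does not change. -/
def Inert (q : Wire a d b B S) : Prop :=
  (∃ r, q = fst r) ∨ (∃ r, q = snd r) ∨ q = work .anc ∨ ∃ r, q = work (.scr r)

theorem spares_selectQuery {q : Wire a d b B S} (hq : Inert q) (o o' : OracleName) :
    Circuit.Spares q (selectQuery o o' : Circuit (Sizes.mk a d b) (Wire a d b B S)) := by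
  have hsel : q ≠ work .sel := by
    rcases hq with ⟨r, rfl⟩ | ⟨r, rfl⟩ | rfl | ⟨r, rfl⟩ <;> simp
  have ho : ∀ (o : OracleName) (x : (Sizes.mk a d b).Wires o), q ≠ oracle o x := by
    intro o x
    rcases hq with ⟨r, rfl⟩ | ⟨r, rfl⟩ | rfl | ⟨r, rfl⟩
    · cases o <;> rcases x with x | x <;> intro h <;> cases h
    · cases o <;> rcases x with x | x <;> intro h <;> cases Sum.inr.inj h
    · exact oracle_ne (by simp) (by simp) (by simp) x
    · exact oracle_ne (by simp) (by simp) (by simp) x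
  exact (((spares_single _ hsel).append (spares_query (ho o))).append
    (spares_single _ hsel)).append (spares_query (ho o'))

/-- Together with the index registers, the signal qubit and the scratch space stay intact, so every
pair of indices spans an invariant block. -/
theorem spares_combine {q : Wire a d b B S} (hq : Inert q) :
    Circuit.Spares q (combine : Circuit (Sizes.mk a d b) (Wire a d b B S)) := by
  have hsel : q ≠ work .sel := by
    rcases hq with ⟨r, rfl⟩ | ⟨r, rfl⟩ | rfl | ⟨r, rfl⟩ <;> simp
  have hflag : q ≠ work .flag := by
    rcases hq with ⟨r, rfl⟩ | ⟨r, rfl⟩ | rfl | ⟨r, rfl⟩ <;> simp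
  have hprep : Circuit.Spares q (prepare : Circuit (Sizes.mk a d b) (Wire a d b B S)) := by
    refine ((spares_copies fun r _ => ?_).append (spares_copies fun r _ => ?_)).append
      (spares_hadamards ?_)
    · rcases hq with ⟨r, rfl⟩ | ⟨r, rfl⟩ | rfl | ⟨r, rfl⟩ <;> simp
    · rcases hq with ⟨r, rfl⟩ | ⟨r, rfl⟩ | rfl | ⟨r, rfl⟩ <;> simp
    · rcases hq with ⟨r, rfl⟩ | ⟨r, rfl⟩ | rfl | ⟨r, rfl⟩ <;> simp [randomQubits]
  have hcar : Circuit.Spares q (carries : Circuit (Sizes.mk a d b) (Wire a d b B S)) := by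
    refine spares_muxCircuit (fun l hl => ?_) fun l hl => ?_
    · rw [keyWire_of_lt hl]
      rcases hq with ⟨r, rfl⟩ | ⟨r, rfl⟩ | rfl | ⟨r, rfl⟩ <;> simp
    · rw [carWire_of_le hl]
      rcases hq with ⟨r, rfl⟩ | ⟨r, rfl⟩ | rfl | ⟨r, rfl⟩ <;> simp
  exact ((hprep.append (spares_single _ hsel)).append
    ((((spares_selectQuery hq _ _).append
      ((hcar.append ((spares_single _ hflag).append (spares_cx hflag))).append hcar.inv)).append
      (spares_selectQuery hq _ _).inv).append (spares_selectQuery hq _ _))).append hprep.inv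

theorem length_combine_le (hB : B ≤ b) :
    (combine : Circuit (Sizes.mk a d b) (Wire a d b B S)).length ≤ 34 * (a + b + 1) := by
  have h1 : (prepare : Circuit (Sizes.mk a d b) (Wire a d b B S)).length ≤ 2 * a + (B + 1) := by
    have h2 := length_copies_le (σ := Sizes.mk a d b) (fst : _ → Wire a d b B S)
      (fun r => work (.ci r)) (List.finRange a)
    have h3 := length_copies_le (σ := Sizes.mk a d b) (snd : _ → Wire a d b B S)
      (fun r => work (.cj r)) (List.finRange a)
    simp only [prepare, copyIndices, hadamards, randomQubits, List.length_append, List.length_map,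
      List.length_cons, List.length_finRange] at h2 h3 ⊢
    omega
  have h4 : (carries : Circuit (Sizes.mk a d b) (Wire a d b B S)).length ≤ 16 * B :=
    length_muxCircuit_le _ _ _ _
  have h5 := length_cx_le (σ := Sizes.mk a d b) (carWire B : Wire a d b B S) (work .flag)
  simp only [combine, select, compare, selectQuery, List.length_append, List.length_singleton,
    Circuit.length_inv]
  omega

end Wire

end QAlg


namespace QAlg

/-! ### States supported on given basis vectors -/

section Support

variable {σ : Sizes} {Q : Type} [Fintype Q] [DecidableEq Q]

/-- The states that are combinations of the basis states with property `p`. -/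
def supported (p : (Q → Bool) → Prop) : Submodule ℂ (State Q) where
  carrier := {ψ | ∀ s, ψ s ≠ 0 → p s}
  zero_mem' := fun s h => absurd rfl h
  add_mem' := by
    intro ψ φ hψ hφ s h
    by_contra hp
    have h1 : ψ s = 0 := by_contra fun h' => hp (hψ s h')
    have h2 : φ s = 0 := by_contra fun h' => hp (hφ s h')
    exact h (by rw [Pi.add_apply, h1, h2, add_zero])
  smul_mem' := by
    intro c ψ hψ s h
    exact hψ s (right_ne_zero_of_mul h)

theorem apply_eq_zero_of_mem_supported {p : (Q → Bool) → Prop} {ψ : State Q}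
    (hψ : ψ ∈ supported p) {s : Q → Bool} (hs : ¬p s) : ψ s = 0 :=
  by_contra fun h => hs (hψ s h)

theorem supported_mono {p q : (Q → Bool) → Prop} (h : ∀ s, p s → q s) :
    supported p ≤ supported q := fun _ hψ s hs => h s (hψ s hs)

theorem ket_mem_supported {p : (Q → Bool) → Prop} {s : Q → Bool} (hs : p s) :
    ket s ∈ supported p := by
  intro u hu
  rw [ket_apply, ne_eq, ite_eq_right_iff, not_forall] at hu
  rw [hu.1]
  exact hs

theorem braket_eq_zero_of_disjoint {p q : (Q → Bool) → Prop} (hpq : ∀ s, p s → ¬q s)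
    {φ ψ : State Q} (hφ : φ ∈ supported p) (hψ : ψ ∈ supported q) : braket φ ψ = 0 := by
  rw [braket_eq_sum]
  refine Finset.sum_eq_zero fun s _ => ?_
  by_cases h : p s
  · rw [apply_eq_zero_of_mem_supported hψ (hpq s h), mul_zero]
  · rw [apply_eq_zero_of_mem_supported hφ h, star_zero, zero_mul]

theorem run_mem_supported_of_spares {𝒜 : Circuit σ Q} {q : Q} (h : Circuit.Spares q 𝒜)
    (O : Oracles σ) {β : Bool} {ψ : State Q} (hψ : ψ ∈ supported fun s => s q = β) :
    Circuit.run O 𝒜 ψ ∈ supported fun s => s q = β := h.run O hψ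

theorem run_signGate_apply (O : Oracles σ) (q : Q) (x y : ℤˣ) (ψ : State Q) (u : Q → Bool) :
    Circuit.run O [Gate.single q (signGate x y)] ψ u =
      (bif u q then ((y : ℤ) : ℂ) else ((x : ℤ) : ℂ)) * ψ u := by
  simp only [Circuit.run, Gate.op, singleOp_mulVec, Fintype.sum_bool]
  have h : Function.update u q (u q) = u := Function.update_eq_self q u
  cases hu : u q <;> rw [hu] at h <;> simp [signGate, h]

theorem run_pauliX_apply (O : Oracles σ) (q : Q) (ψ : State Q) (u : Q → Bool) :
    Circuit.run O [Gate.single q pauliX] ψ u = ψ (Function.update u q (!u q)) := by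
  simp only [Circuit.run, Gate.op, singleOp_mulVec, Fintype.sum_bool]
  cases hu : u q <;> simp [pauliX]

/-- Flipping `q` plays the role of the second basis vector, so the gate acts by its first column;
the companion for the flipped state uses the second column. -/
theorem run_single_of_mem_supported (O : Oracles σ) (q : Q) (R : Matrix.unitaryGroup Bool ℂ)
    {φ : State Q} (hφ : φ ∈ supported fun s => s q = false) :
    Circuit.run O [Gate.single q R] φ = R.1 false false • φ +
      R.1 true false • Circuit.run O [Gate.single q pauliX] φ := by
  funext u
  rw [Pi.add_apply, Pi.smul_apply, Pi.smul_apply, run_pauliX_apply]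
  simp only [Circuit.run, Gate.op, singleOp_mulVec, Fintype.sum_bool, smul_eq_mul]
  have h0 : φ (Function.update u q true) = 0 :=
    apply_eq_zero_of_mem_supported hφ (by simp)
  have h : Function.update u q (u q) = u := Function.update_eq_self q u
  cases hu : u q <;> rw [hu] at h
  · rw [h, h0, Bool.not_false, h0]; ring
  · rw [h0]
    rw [h] at h0
    rw [h0, Bool.not_true]; ring

theorem run_single_pauliX_of_mem_supported (O : Oracles σ) (q : Q)
    (R : Matrix.unitaryGroup Bool ℂ) {φ : State Q} (hφ : φ ∈ supported fun s => s q = false) :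
    Circuit.run O [Gate.single q R] (Circuit.run O [Gate.single q pauliX] φ) =
      R.1 false true • φ + R.1 true true • Circuit.run O [Gate.single q pauliX] φ := by
  funext u
  rw [Pi.add_apply, Pi.smul_apply, Pi.smul_apply, run_pauliX_apply]
  have hs : Circuit.run O [Gate.single q R] (Circuit.run O [Gate.single q pauliX] φ) u =
      ∑ β, R.1 (u q) β *
        Circuit.run O [Gate.single q pauliX] φ (Function.update u q β) := by
    simp only [Circuit.run, Gate.op, singleOp_mulVec]
  rw [hs, Fintype.sum_bool, run_pauliX_apply, run_pauliX_apply]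
  simp only [Function.update_self, Function.update_idem, Bool.not_true, Bool.not_false, smul_eq_mul]
  have h0 : φ (Function.update u q true) = 0 :=
    apply_eq_zero_of_mem_supported hφ (by simp)
  have h : Function.update u q (u q) = u := Function.update_eq_self q u
  cases hu : u q <;> rw [hu] at h
  · rw [h, h0, Bool.not_false, h0]; ring
  · rw [h0]
    rw [h] at h0
    rw [h0, Bool.not_true]; ring

theorem run_pauliX_mem_supported (O : Oracles σ) {p p' : (Q → Bool) → Prop} {q : Q}
    (h : ∀ s, p (Function.update s q (!s q)) → p' s) {φ : State Q} (hφ : φ ∈ supported p) :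
    Circuit.run O [Gate.single q pauliX] φ ∈ supported p' := by
  intro s hs
  rw [run_pauliX_apply] at hs
  exact h s (hφ _ hs)

theorem stateNorm_sq_of_braket {f : State Q} {r : ℝ}
    (h : braket f f = r) : stateNorm f ^ 2 = r := by
  rw [braket_self] at h
  exact Complex.ofReal_injective h

theorem braket_sub_left (f f' g : State Q) :
    braket (f - f') g = braket f g - braket f' g := by
  rw [← star_braket, braket_sub_right, star_sub, star_braket, star_braket]

theorem eq_zero_of_braket_self {f : State Q}
    (h : braket f f = 0) : f = 0 := by
  have h1 : stateNorm f ^ 2 = 0 := stateNorm_sq_of_braket (by rw [h]; simp)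
  rw [stateNorm_sq_eq_sum, Finset.sum_eq_zero_iff_of_nonneg fun _ _ => by positivity] at h1
  funext s
  simpa using h1 s (Finset.mem_univ s)

end Support

/-! ### The amplification walk and quantum signal processing -/

namespace Wire

variable {a d b B S : ℕ}

/-- The scratch space as a sequence. -/
def scrWire (t : ℕ) : Wire a d b B S := if h : t < S then work (.scr ⟨t, h⟩) else work .anc

theorem scrWire_of_lt {t : ℕ} (h : t < S) :
    (scrWire t : Wire a d b B S) = work (.scr ⟨t, h⟩) := dif_pos h

/-- All work qubits but the scratch space. -/
def checked : List (Wire a d b B S) :=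
  ((List.finRange a).map fun r => work (.ci r)) ++ ((List.finRange a).map fun r => work (.cj r)) ++
    ((List.finRange b).map fun r => work (.num r)) ++
    ((List.finRange B).map fun r => work (.key r)) ++
    ((List.finRange (B + 1)).map fun r => work (.car r)) ++ [work .sel, work .flag, work .anc]

/-- The qubits of the vector register. -/
def vecs : List (Wire a d b B S) := (List.finRange d).map vec

theorem length_checked :
    (checked : List (Wire a d b B S)).length = 2 * a + b + 2 * B + 4 := by
  simp only [checked, List.length_append, List.length_map, List.length_finRange, List.length_cons,
    List.length_nil]
  omega

theorem scr_notMem_checked (r : Fin S) : (work (.scr r) : Wire a d b B S) ∉ checked := by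
  simp [checked]

theorem work_mem_checked {x : Work a b B S} (hx : ∀ r, x ≠ .scr r) :
    (work x : Wire a d b B S) ∈ checked := by
  cases x with
  | scr r => exact absurd rfl (hx r)
  | _ => simp [checked]

/-- A reflection about the states in which the listed qubits are `0`. -/
noncomputable def reflect (L : List (Wire a d b B S)) : Circuit (Sizes.mk a d b) (Wire a d b B S) :=
  reflection (fun k => L.getD k (work .anc)) scrWire L.length

/-- The scratch space is `0`, and the signal processing qubit is `β`. -/
def Clean (β : Bool) (s : Wire a d b B S → Bool) : Prop :=
  s (work .anc) = β ∧ ∀ r, s (work (.scr r)) = false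

/-- A clean state with indices `i` and `j`. -/
def InBlock (i j : Fin a → Bool) (β : Bool) (s : Wire a d b B S → Bool) : Prop :=
  Clean β s ∧ (∀ r, s (fst r) = i r) ∧ ∀ r, s (snd r) = j r

variable (O : Oracles (Sizes.mk a d b))

/-- The ladder needs one more scratch qubit than inputs, hence the strict bound. The default of
`getD` is never read. -/
theorem run_reflect {L : List (Wire a d b B S)} (hL : L.length < S)
    (hscr : ∀ r, work (.scr r) ∉ L) {β : Bool} {ψ : State (Wire a d b B S)}
    (hψ : ψ ∈ supported (Clean β)) (s : Wire a d b B S → Bool)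
    [Decidable (∀ q ∈ L, s q = false)] :
    Circuit.run O (reflect L) ψ s = (if ∀ q ∈ L, s q = false then (-1 : ℂ) else 1) * ψ s := by
  classical
  have hget : ∀ k (hk : k < L.length), L.getD k (work .anc) = L[k] := fun k hk => by
    rw [List.getD_eq_getElem]
  have hiff : (∀ k < L.length, s (L.getD k (work .anc)) = false) ↔ ∀ q ∈ L, s q = false := by
    constructor
    · intro h q hq
      obtain ⟨k, hk, rfl⟩ := List.mem_iff_getElem.mp hq
      rw [← hget k hk]
      exact h k hk
    · intro h k hk
      rw [hget k hk]
      exact h _ (List.getElem_mem hk)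
  rw [reflect, run_reflection O, if_congr hiff rfl rfl]
  · intro k hk l hl h
    rw [scrWire_of_lt (by omega), scrWire_of_lt (by omega)] at h
    simpa using h
  · intro k hk l hl h
    rw [scrWire_of_lt (by omega)] at h
    have hmem : L.getD k (work .anc) ∈ L := by
      rw [hget k hk]; exact List.getElem_mem hk
    rw [h] at hmem
    exact hscr _ hmem
  · intro s hs k hk
    rw [scrWire_of_lt (by omega)]
    exact (hψ s hs).2 _

theorem run_reflect_mem {L : List (Wire a d b B S)} (hL : L.length < S)
    (hscr : ∀ r, work (.scr r) ∉ L) {β : Bool} {p : (Wire a d b B S → Bool) → Prop}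
    (hp : ∀ s, p s → Clean β s) {ψ : State (Wire a d b B S)} (hψ : ψ ∈ supported p) :
    Circuit.run O (reflect L) ψ ∈ supported p := by
  classical
  intro s hs
  rw [run_reflect O hL hscr (supported_mono hp hψ)] at hs
  exact hψ s (right_ne_zero_of_mul hs)

/-- The signal qubit is itself among the qubits tested for `0`, so its value `1` switches the
reflection off. No controlled version of `combine` is needed. -/
theorem run_reflect_of_clean_true {L : List (Wire a d b B S)} (hL : L.length < S)
    (hscr : ∀ r, work (.scr r) ∉ L) (hanc : work .anc ∈ L) {ψ : State (Wire a d b B S)}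
    (hψ : ψ ∈ supported (Clean true)) : Circuit.run O (reflect L) ψ = ψ := by
  classical
  funext s
  rw [run_reflect O hL hscr hψ]
  by_cases h : Clean true s
  · rw [if_neg fun h' => by
      have h1 := h.1
      rw [h' _ hanc] at h1
      exact absurd h1 (by simp), one_mul]
  · rw [apply_eq_zero_of_mem_supported hψ h, mul_zero]

theorem mem_supported_clean {β : Bool} {ψ : State (Wire a d b B S)} :
    ψ ∈ supported (Clean β) ↔ (ψ ∈ supported fun s => s (work .anc) = β) ∧
      ∀ r, ψ ∈ supported fun s => s (work (.scr r)) = false :=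
  ⟨fun h => ⟨fun s hs => (h s hs).1, fun r s hs => (h s hs).2 r⟩,
    fun h s hs => ⟨h.1 s hs, fun r => h.2 r s hs⟩⟩

theorem mem_supported_inBlock {i j : Fin a → Bool} {β : Bool} {ψ : State (Wire a d b B S)} :
    ψ ∈ supported (InBlock i j β) ↔ ψ ∈ supported (Clean β) ∧
      (∀ r, ψ ∈ supported fun s => s (fst r) = i r) ∧ ∀ r, ψ ∈ supported fun s => s (snd r) = j r :=
  ⟨fun h => ⟨fun s hs => (h s hs).1, fun r s hs => (h s hs).2.1 r, fun r s hs => (h s hs).2.2 r⟩,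
    fun h s hs => ⟨h.1 s hs, fun r => h.2.1 r s hs, fun r => h.2.2 r s hs⟩⟩

theorem run_mem_clean {𝒜 : Circuit (Sizes.mk a d b) (Wire a d b B S)}
    (h𝒜 : ∀ q, Inert q → Circuit.Spares q 𝒜) {β : Bool} {ψ : State (Wire a d b B S)}
    (hψ : ψ ∈ supported (Clean β)) : Circuit.run O 𝒜 ψ ∈ supported (Clean β) := by
  rw [mem_supported_clean] at hψ ⊢
  exact ⟨run_mem_supported_of_spares (h𝒜 _ (.inr (.inr (.inl rfl)))) O hψ.1,
    fun r => run_mem_supported_of_spares (h𝒜 _ (.inr (.inr (.inr ⟨r, rfl⟩)))) O (hψ.2 r)⟩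

theorem run_mem_inBlock {𝒜 : Circuit (Sizes.mk a d b) (Wire a d b B S)}
    (h𝒜 : ∀ q, Inert q → Circuit.Spares q 𝒜) {i j : Fin a → Bool} {β : Bool}
    {ψ : State (Wire a d b B S)} (hψ : ψ ∈ supported (InBlock i j β)) :
    Circuit.run O 𝒜 ψ ∈ supported (InBlock i j β) := by
  rw [mem_supported_inBlock] at hψ ⊢
  exact ⟨run_mem_clean O h𝒜 hψ.1,
    fun r => run_mem_supported_of_spares (h𝒜 _ (.inl ⟨r, rfl⟩)) O (hψ.2.1 r),
    fun r => run_mem_supported_of_spares (h𝒜 _ (.inr (.inl ⟨r, rfl⟩))) O (hψ.2.2 r)⟩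

/-- One step of amplitude amplification, controlled by the signal processing qubit. -/
noncomputable def walk : Circuit (Sizes.mk a d b) (Wire a d b B S) :=
  reflect checked ++ (Circuit.inv combine ++ (reflect (checked ++ vecs) ++ (combine ++
    [Gate.single (work .anc) (signGate (-1) 1)])))

theorem run_walk (ψ : State (Wire a d b B S)) :
    Circuit.run O walk ψ = Circuit.run O [Gate.single (work .anc) (signGate (-1) 1)]
      (Circuit.run O combine (Circuit.run O (reflect (checked ++ vecs))
        (Circuit.run O (Circuit.inv combine) (Circuit.run O (reflect checked) ψ)))) := by
  simp only [walk, Circuit.run_append]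

theorem length_checked_vecs :
    (checked ++ vecs : List (Wire a d b B S)).length = 2 * a + b + 2 * B + 4 + d := by
  rw [List.length_append, length_checked, vecs, List.length_map, List.length_finRange]

theorem scr_notMem_checked_vecs (r : Fin S) :
    (work (.scr r) : Wire a d b B S) ∉ checked ++ vecs := by
  simp [checked, vecs]

/-- Both reflections are trivial, `combine` cancels its inverse, and the last sign is `1`. -/
theorem run_walk_of_clean_true (hS : 2 * a + b + 2 * B + 4 + d < S) {ψ : State (Wire a d b B S)}
    (hψ : ψ ∈ supported (Clean true)) : Circuit.run O walk ψ = ψ := by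
  rw [run_walk, run_reflect_of_clean_true O (by rw [length_checked]; omega) scr_notMem_checked
    (work_mem_checked (by simp)) hψ, run_reflect_of_clean_true O (by rw [length_checked_vecs]; omega)
    scr_notMem_checked_vecs (List.mem_append_left _ (work_mem_checked (by simp)))
    (run_mem_clean O (fun q hq => (spares_combine hq).inv) hψ), Circuit.run_run_inv]
  funext s
  rw [run_signGate_apply]
  by_cases h : Clean true s
  · rw [h.1]; simp
  · rw [apply_eq_zero_of_mem_supported hψ h, mul_zero]

theorem run_walk_mem (hS : 2 * a + b + 2 * B + 4 + d < S) {i j : Fin a → Bool} {β : Bool}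
    {ψ : State (Wire a d b B S)} (hψ : ψ ∈ supported (InBlock i j β)) :
    Circuit.run O walk ψ ∈ supported (InBlock i j β) := by
  rw [run_walk]
  have h1 := run_reflect_mem O (L := checked) (by rw [length_checked]; omega) scr_notMem_checked
    (fun s (hs : InBlock i j β s) => hs.1) hψ
  have h2 := run_mem_inBlock O (fun q hq => (spares_combine hq).inv) h1
  have h3 := run_reflect_mem O (by rw [length_checked_vecs]; omega) scr_notMem_checked_vecs
    (fun s (hs : InBlock i j β s) => hs.1) h2
  have h4 := run_mem_inBlock O (fun q hq => spares_combine hq) h3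
  intro s hs
  rw [run_signGate_apply] at hs
  exact h4 s (right_ne_zero_of_mul hs)

/-- The initial basis state. -/
def start (i j : Fin a → Bool) : Wire a d b B S → Bool :=
  state i j zero zero zero zero zero false false

theorem inBlock_start (i j : Fin a → Bool) : InBlock i j false (start i j : Wire a d b B S → Bool) :=
  ⟨⟨rfl, fun _ => rfl⟩, fun _ => rfl, fun _ => rfl⟩

theorem eq_start {i j : Fin a → Bool} {s : Wire a d b B S → Bool} (h : InBlock i j false s)
    (h' : ∀ q ∈ (checked ++ vecs : List (Wire a d b B S)), s q = false) : s = start i j := by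
  funext q
  rcases q with q | q | q | q
  · exact h.2.1 q
  · exact h.2.2 q
  · rw [h' _ (List.mem_append_right _ (by simp [vecs]))]; rfl
  · by_cases hq : ∃ r, q = .scr r
    · obtain ⟨r, rfl⟩ := hq
      exact h.1.2 r
    · rw [h' _ (List.mem_append_left _ (work_mem_checked fun r hr => hq ⟨r, hr⟩))]
      cases q <;> rfl

theorem start_eq_false (i j : Fin a → Bool) :
    ∀ q ∈ (checked ++ vecs : List (Wire a d b B S)), start i j q = false := by
  intro q hq
  rcases q with q | q | q | q
  · simp [checked, vecs] at hq
  · simp [checked, vecs] at hq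
  · rfl
  · cases q <;> rfl

/-- The state prepared from the indices `i` and `j`. -/
noncomputable def prepared (i j : Fin a → Bool) : State (Wire a d b B S) :=
  Circuit.run O combine (ket (start i j))

theorem prepared_mem (i j : Fin a → Bool) :
    (prepared O i j : State (Wire a d b B S)) ∈ supported (InBlock i j false) :=
  run_mem_inBlock O (fun _ hq => spares_combine hq) (ket_mem_supported (inBlock_start i j))

/-- In the block, `start i j` is the only basis state that the second reflection negates. Conjugated
by `combine` and negated by the sign gate, the reflection becomes $2|p\rangle\langle p|-1$ with $p$
the prepared state. -/
theorem run_walk_of_reflect (hS : 2 * a + b + 2 * B + 4 + d < S) {i j : Fin a → Bool}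
    {ψ φ : State (Wire a d b B S)} (hφ : φ ∈ supported (InBlock i j false))
    (h : Circuit.run O (reflect checked) ψ = φ) :
    Circuit.run O walk ψ = (2 * braket (prepared O i j) φ) • prepared O i j - φ := by
  classical
  have h1 : Circuit.run O (Circuit.inv combine) φ ∈ supported (InBlock i j false) :=
    run_mem_inBlock O (fun q hq => (spares_combine hq).inv) hφ
  have h2 : Circuit.run O (reflect (checked ++ vecs)) (Circuit.run O (Circuit.inv combine) φ) =
      Circuit.run O (Circuit.inv combine) φ - (2 * braket (prepared O i j) φ) • ket (start i j) := by
    funext s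
    rw [run_reflect O (by rw [length_checked_vecs]; omega) scr_notMem_checked_vecs
      (supported_mono (fun s hs => hs.1) h1), Pi.sub_apply, Pi.smul_apply, ket_apply, smul_eq_mul,
      prepared, braket_run_left, braket_ket_left]
    by_cases hs : s = start i j
    · subst hs
      rw [if_pos (start_eq_false i j), if_pos rfl]
      ring
    · rw [if_neg hs, mul_zero, sub_zero]
      by_cases hb : InBlock i j false s
      · rw [if_neg fun h' => hs (eq_start hb h'), one_mul]
      · rw [apply_eq_zero_of_mem_supported h1 hb, mul_zero]
  have h3 : (2 * braket (prepared O i j) φ) • prepared O i j - φ ∈ supported (InBlock i j false) :=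
    Submodule.sub_mem _ (Submodule.smul_mem _ _ (prepared_mem O i j)) hφ
  rw [run_walk, h, h2, Circuit.run_sub, Circuit.run_smul, Circuit.run_run_inv]
  change Circuit.run O _ (φ - (2 * braket (prepared O i j) φ) • prepared O i j) = _
  funext s
  rw [run_signGate_apply]
  by_cases hs : InBlock i j false s
  · rw [hs.1.1, ← neg_sub ((2 * braket (prepared O i j) φ) • prepared O i j) φ, Pi.neg_apply]
    simp
  · rw [apply_eq_zero_of_mem_supported h3 hs, ← neg_sub, Pi.neg_apply,
      apply_eq_zero_of_mem_supported h3 hs]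
    simp

/-- The work qubits that matter are `0`. -/
def Good (i j : Fin a → Bool) (s : Wire a d b B S → Bool) : Prop :=
  InBlock i j false s ∧ ∀ q ∈ (checked : List (Wire a d b B S)), s q = false

/-- A normalised state `g` such that the part of the prepared state with zero work qubits is
`sin θ • g`. -/
structure IsTarget (i j : Fin a → Bool) (g : State (Wire a d b B S)) (θ : ℝ) : Prop where
  mem : g ∈ supported (Good i j)
  braket_self : braket g g = 1
  apply : ∀ s, Good i j s → prepared O i j s = Real.sin θ * g s

variable {O} {i j : Fin a → Bool} {g : State (Wire a d b B S)} {θ : ℝ}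

theorem IsTarget.mem_block (h : IsTarget O i j g θ) : g ∈ supported (InBlock i j false) :=
  supported_mono (fun _ hs => hs.1) h.mem

theorem IsTarget.braket_prepared (h : IsTarget O i j g θ) :
    braket g (prepared O i j) = Real.sin θ := by
  have h1 : braket g (prepared O i j) = Real.sin θ * braket g g := by
    rw [braket_eq_sum, braket_eq_sum, Finset.mul_sum]
    refine Finset.sum_congr rfl fun s _ => ?_
    by_cases hs : Good i j s
    · rw [h.apply s hs]; ring
    · rw [apply_eq_zero_of_mem_supported h.mem hs]; simp
  rw [h1, h.braket_self, mul_one]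

theorem IsTarget.prepared_braket (h : IsTarget O i j g θ) :
    braket (prepared O i j) g = Real.sin θ := by
  rw [← star_braket, h.braket_prepared, Complex.star_def, Complex.conj_ofReal]

theorem braket_ket_self (s : Wire a d b B S → Bool) : braket (ket s) (ket s) = 1 := by
  rw [braket_ket_left, ket_apply, if_pos rfl]

theorem braket_prepared_self :
    braket (prepared O i j : State (Wire a d b B S)) (prepared O i j) = 1 := by
  rw [prepared, braket_run_run, braket_ket_self]

/-- The unit vector orthogonal to the target in the plane of the walk. -/
noncomputable def rest (O : Oracles (Sizes.mk a d b)) (i j : Fin a → Bool)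
    (g : State (Wire a d b B S)) (θ : ℝ) : State (Wire a d b B S) :=
  ((Real.cos θ : ℂ)⁻¹) • (prepared O i j - (Real.sin θ : ℂ) • g)

/-- The vectors of the plane of the walk. -/
noncomputable def planeVec (O : Oracles (Sizes.mk a d b)) (i j : Fin a → Bool)
    (g : State (Wire a d b B S)) (θ φ : ℝ) : State (Wire a d b B S) :=
  (Real.sin φ : ℂ) • g + (Real.cos φ : ℂ) • rest O i j g θ

theorem sin_sq_add_cos_sq_complex (θ : ℝ) :
    (Real.sin θ : ℂ) * Real.sin θ + (Real.cos θ : ℂ) * Real.cos θ = 1 := by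
  have h := Real.sin_sq_add_cos_sq θ
  rw [sq, sq] at h
  exact_mod_cast h

theorem IsTarget.braket_prepared_sub (h : IsTarget O i j g θ) :
    braket (prepared O i j) (prepared O i j - (Real.sin θ : ℂ) • g) =
      (Real.cos θ : ℂ) * Real.cos θ := by
  rw [braket_sub_right, braket_smul_right, braket_prepared_self, h.prepared_braket]
  linear_combination -sin_sq_add_cos_sq_complex θ

/-- If $\cos\theta=0$, the inverse in `rest` is zero by convention; the claim persists because
$p-\sin\theta\, g$, with $p$ the prepared state, has squared norm $\cos^2\theta=0$. -/
theorem IsTarget.planeVec_self (h : IsTarget O i j g θ) :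
    planeVec O i j g θ θ = prepared O i j := by
  rw [planeVec, rest]
  by_cases hc : (Real.cos θ : ℂ) = 0
  · have h0 : prepared O i j - (Real.sin θ : ℂ) • g = 0 := by
      apply eq_zero_of_braket_self
      have h1 : braket g (prepared O i j - (Real.sin θ : ℂ) • g) = 0 := by
        rw [braket_sub_right, braket_smul_right, h.braket_prepared, h.braket_self]
        ring
      have h2 := h.braket_prepared_sub
      rw [hc, mul_zero] at h2
      rw [braket_sub_left, braket_smul_left, h1, h2]
      simp
    rw [h0, smul_zero, smul_zero, add_zero, sub_eq_zero.mp h0]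
  · rw [smul_smul, mul_inv_cancel₀ hc, one_smul, add_sub_cancel]

theorem IsTarget.run_walk_target (h : IsTarget O i j g θ) (hS : 2 * a + b + 2 * B + 4 + d < S) :
    Circuit.run O walk g = g - (2 * Real.sin θ : ℂ) • prepared O i j := by
  classical
  have h1 : Circuit.run O (reflect checked) g = -g := by
    funext s
    rw [run_reflect O (by rw [length_checked]; omega) scr_notMem_checked
      (supported_mono (fun s hs => hs.1) h.mem_block), Pi.neg_apply]
    by_cases hs : Good i j s
    · rw [if_pos hs.2]; ring
    · rw [apply_eq_zero_of_mem_supported h.mem hs]; simp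
  rw [run_walk_of_reflect O hS (Submodule.neg_mem _ h.mem_block) h1, ← neg_one_smul ℂ g,
    braket_smul_right, h.prepared_braket]
  module

theorem IsTarget.run_walk_rest (h : IsTarget O i j g θ) (hS : 2 * a + b + 2 * B + 4 + d < S) :
    Circuit.run O walk (rest O i j g θ) =
      (2 * Real.cos θ : ℂ) • prepared O i j - rest O i j g θ := by
  classical
  have hmem : prepared O i j - (Real.sin θ : ℂ) • g ∈ supported (InBlock i j false) :=
    Submodule.sub_mem _ (prepared_mem O i j) (Submodule.smul_mem _ _ h.mem_block)
  have h1 : Circuit.run O (reflect checked) (prepared O i j - (Real.sin θ : ℂ) • g) =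
      prepared O i j - (Real.sin θ : ℂ) • g := by
    funext s
    rw [run_reflect O (by rw [length_checked]; omega) scr_notMem_checked
      (supported_mono (fun s hs => hs.1) hmem)]
    by_cases hb : InBlock i j false s
    · by_cases hs : ∀ q ∈ (checked : List (Wire a d b B S)), s q = false
      · rw [Pi.sub_apply, Pi.smul_apply, h.apply s ⟨hb, hs⟩, smul_eq_mul, sub_self, mul_zero]
      · rw [if_neg hs, one_mul]
    · rw [apply_eq_zero_of_mem_supported hmem hb, mul_zero]
  rw [rest, Circuit.run_smul, run_walk_of_reflect O hS hmem h1, h.braket_prepared_sub, smul_sub,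
    smul_smul]
  congr 2
  -- Both scalars vanish in the degenerate case, since $0^{-1}=0$.
  by_cases hc : (Real.cos θ : ℂ) = 0
  · rw [hc]; simp
  · field_simp

/-- The images of the two spanning vectors are expressed through the prepared state, the plane
vector at angle $\theta$; the addition formulas finish. No independence of the spanning vectors is
needed, so the degenerate case is included. -/
theorem IsTarget.run_walk_planeVec (h : IsTarget O i j g θ)
    (hS : 2 * a + b + 2 * B + 4 + d < S) (φ : ℝ) :
    Circuit.run O walk (planeVec O i j g θ φ) = planeVec O i j g θ (φ + 2 * θ) := by
  have hplane := h.planeVec_self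
  rw [planeVec] at hplane
  rw [planeVec, planeVec, Circuit.run_add, Circuit.run_smul, Circuit.run_smul,
    h.run_walk_target hS, h.run_walk_rest hS, ← hplane, Real.sin_add, Real.cos_add,
    Real.sin_two_mul, Real.cos_two_mul']
  push_cast
  have hsc := sin_sq_add_cos_sq_complex θ
  push_cast at hsc
  match_scalars
  · linear_combination (-Complex.sin φ) * hsc
  · linear_combination (Complex.cos φ) * hsc

/-- Quantum signal processing with the walk. -/
noncomputable def signalCircuit (R₀ : Matrix.unitaryGroup Bool ℂ) :
    List (Matrix.unitaryGroup Bool ℂ) → Circuit (Sizes.mk a d b) (Wire a d b B S)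
  | [] => [Gate.single (work .anc) R₀]
  | R :: Rs => signalCircuit R₀ Rs ++ walk ++ [Gate.single (work .anc) R]

/-- The walk as a linear map. -/
noncomputable def walkMap (O : Oracles (Sizes.mk a d b)) :
    Module.End ℂ (State (Wire a d b B S)) := Matrix.mulVecLin (Circuit.mat O walk)

theorem walkMap_apply (ψ : State (Wire a d b B S)) : walkMap O ψ = Circuit.run O walk ψ := by
  rw [walkMap, Matrix.mulVecLin_apply, Circuit.run_eq_mulVec]

open Polynomial

theorem aeval_walkMap_mem (hS : 2 * a + b + 2 * B + 4 + d < S) (P : ℂ[X])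
    {ψ : State (Wire a d b B S)} (hψ : ψ ∈ supported (InBlock i j false)) :
    aeval (walkMap O) P ψ ∈ supported (InBlock i j false) := by
  have hpow : ∀ k : ℕ, (walkMap O ^ k) ψ ∈ supported (InBlock i j false) := by
    intro k
    induction k with
    | zero => exact hψ
    | succ k ih =>
      rw [pow_succ', Module.End.mul_apply, walkMap_apply]
      exact run_walk_mem O hS ih
  rw [aeval_eq_sum_range, LinearMap.sum_apply]
  exact Submodule.sum_mem _ fun k _ => Submodule.smul_mem _ _ (hpow k)

theorem run_flip_mem {ψ : State (Wire a d b B S)} (hψ : ψ ∈ supported (InBlock i j false)) :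
    Circuit.run O [Gate.single (work .anc) pauliX] ψ ∈ supported (InBlock i j true) := by
  refine run_pauliX_mem_supported O (fun s hs => ?_) hψ
  refine ⟨⟨?_, fun r => ?_⟩, fun r => ?_, fun r => ?_⟩
  · have := hs.1.1
    rw [Function.update_self] at this
    simpa using this
  · have := hs.1.2 r
    rwa [Function.update_of_ne (by simp)] at this
  · have := hs.2.1 r
    rwa [Function.update_of_ne (by simp)] at this
  · have := hs.2.2 r
    rwa [Function.update_of_ne (by simp)] at this

/-- On the signal qubit the walk is $\mathrm{diag}(W,1)$, which is $D(z)$ with $z$ replaced by $W$.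
The recursion of `signalPair` therefore holds verbatim for polynomials in $W$. -/
theorem run_signalCircuit (hS : 2 * a + b + 2 * B + 4 + d < S)
    (R₀ : Matrix.unitaryGroup Bool ℂ) (Rs : List (Matrix.unitaryGroup Bool ℂ))
    {ψ : State (Wire a d b B S)} (hψ : ψ ∈ supported (InBlock i j false)) :
    Circuit.run O (signalCircuit R₀ Rs) ψ = aeval (walkMap O) (signalPair R₀ Rs).1 ψ +
      Circuit.run O [Gate.single (work .anc) pauliX]
        (aeval (walkMap O) (signalPair R₀ Rs).2 ψ) := by
  have hanc : ∀ P : ℂ[X], aeval (walkMap O) P ψ ∈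
      supported fun s : Wire a d b B S → Bool => s (work .anc) = false := fun P =>
    supported_mono (fun s hs => hs.1.1) (aeval_walkMap_mem hS P hψ)
  induction Rs with
  | nil =>
    rw [signalCircuit, signalPair, run_single_of_mem_supported O _ _
      (supported_mono (fun s hs => hs.1.1) hψ)]
    simp [aeval_C, Algebra.algebraMap_eq_smul_one, Circuit.run_smul]
  | cons R Rs ih =>
    have hflip := run_flip_mem (O := O) (aeval_walkMap_mem (O := O) hS (signalPair R₀ Rs).2 hψ)
    rw [signalCircuit, Circuit.run_append, Circuit.run_append, ih, Circuit.run_add,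
      run_walk_of_clean_true O hS (supported_mono (fun s hs => hs.1) hflip), ← walkMap_apply,
      ← Module.End.mul_apply]
    have hX : walkMap (B := B) (S := S) O * aeval (walkMap O) (signalPair R₀ Rs).1 =
        aeval (walkMap O) (X * (signalPair R₀ Rs).1) := by
      rw [map_mul, aeval_X]
    rw [hX, Circuit.run_add, run_single_of_mem_supported O _ _ (hanc _),
      run_single_pauliX_of_mem_supported O _ _ (hanc _), signalPair]
    simp only [map_add, map_mul, LinearMap.add_apply, Circuit.run_add, aeval_C,
      Algebra.algebraMap_eq_smul_one, smul_mul_assoc, one_mul, LinearMap.smul_apply,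
      Circuit.run_smul]
    abel

end Wire

end QAlg


namespace QAlg

/-! ### Amplification of the encoded difference -/

namespace Wire

variable {a d b B S : ℕ}

/-- Powers of the inverse walk. -/
noncomputable def unwalk : ℕ → Circuit (Sizes.mk a d b) (Wire a d b B S)
  | 0 => []
  | n + 1 => Circuit.inv walk ++ unwalk n

/-- The algorithm: preparation, followed by amplitude amplification with a polynomial of degree `2 n`
in the walk. -/
noncomputable def amplify (n : ℕ) (R₀ : Matrix.unitaryGroup Bool ℂ)
    (Rs : List (Matrix.unitaryGroup Bool ℂ)) : Circuit (Sizes.mk a d b) (Wire a d b B S) :=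
  combine ++ (unwalk n ++ signalCircuit R₀ Rs)

variable {O : Oracles (Sizes.mk a d b)} {i j : Fin a → Bool} {g : State (Wire a d b B S)} {θ : ℝ}

theorem IsTarget.run_inv_walk_planeVec (h : IsTarget O i j g θ)
    (hS : 2 * a + b + 2 * B + 4 + d < S) (φ : ℝ) :
    Circuit.run O (Circuit.inv walk) (planeVec O i j g θ φ) = planeVec O i j g θ (φ - 2 * θ) := by
  have h1 := h.run_walk_planeVec hS (φ - 2 * θ)
  rw [sub_add_cancel] at h1
  rw [← h1, Circuit.run_inv_run]

theorem IsTarget.run_unwalk_planeVec (h : IsTarget O i j g θ)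
    (hS : 2 * a + b + 2 * B + 4 + d < S) (n : ℕ) (φ : ℝ) :
    Circuit.run O (unwalk n) (planeVec O i j g θ φ) = planeVec O i j g θ (φ - 2 * n * θ) := by
  induction n generalizing φ with
  | zero => simp [unwalk, Circuit.run]
  | succ n ih =>
    rw [unwalk, Circuit.run_append, h.run_inv_walk_planeVec hS, ih]
    congr 1
    push_cast
    ring

theorem IsTarget.walkMap_pow_planeVec (h : IsTarget O i j g θ)
    (hS : 2 * a + b + 2 * B + 4 + d < S) (n : ℕ) (φ : ℝ) :
    (walkMap O ^ n) (planeVec O i j g θ φ) = planeVec O i j g θ (φ + 2 * n * θ) := by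
  induction n generalizing φ with
  | zero => simp
  | succ n ih =>
    rw [pow_succ, Module.End.mul_apply, walkMap_apply, h.run_walk_planeVec hS, ih]
    congr 1
    push_cast
    ring

theorem IsTarget.rest_mem (h : IsTarget O i j g θ) :
    rest O i j g θ ∈ supported (InBlock i j false) :=
  Submodule.smul_mem _ _ (Submodule.sub_mem _ (prepared_mem O i j)
    (Submodule.smul_mem _ _ h.mem_block))

theorem IsTarget.planeVec_mem (h : IsTarget O i j g θ) (φ : ℝ) :
    planeVec O i j g θ φ ∈ supported (InBlock i j false) :=
  Submodule.add_mem _ (Submodule.smul_mem _ _ h.mem_block) (Submodule.smul_mem _ _ h.rest_mem)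

open Polynomial

/-- The inverse walks start the plane at $\theta-2n\theta$, so the term of degree $m$ sits at the
angle $(2m+1-2n)\theta$: the sines collect on `g`, the cosines on `rest`. The polynomial `Q` only
feeds the branch with signal qubit `1`. -/
theorem IsTarget.run_amplify (h : IsTarget O i j g θ) (hS : 2 * a + b + 2 * B + 4 + d < S)
    {n : ℕ} {P Q : ℂ[X]} (hP : P.natDegree ≤ 2 * n) {R₀ : Matrix.unitaryGroup Bool ℂ}
    {Rs : List (Matrix.unitaryGroup Bool ℂ)} (hR : signalPair R₀ Rs = (P, Q)) {s : ℝ}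
    (hsin : ∑ m ∈ Finset.range (2 * n + 1),
      P.coeff m * (Real.sin ((2 * m + 1 - 2 * n) * θ) : ℂ) = s)
    (hcos : ∑ m ∈ Finset.range (2 * n + 1),
      P.coeff m * (Real.cos ((2 * m + 1 - 2 * n) * θ) : ℂ) = 0) :
    ∃ f ∈ supported (InBlock i j true),
      Circuit.run O (amplify n R₀ Rs) (ket (start i j)) = (s : ℂ) • g + f := by
  have hmem := h.planeVec_mem (θ - 2 * n * θ)
  refine ⟨_, run_flip_mem (O := O) (aeval_walkMap_mem (O := O) hS Q hmem), ?_⟩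
  have hstart : Circuit.run O combine (ket (start i j)) = planeVec O i j g θ θ :=
    h.planeVec_self.symm
  rw [amplify, Circuit.run_append, Circuit.run_append, hstart, h.run_unwalk_planeVec hS,
    run_signalCircuit hS R₀ Rs hmem, hR]
  congr 1
  rw [aeval_eq_sum_range' (Nat.lt_succ_of_le hP), LinearMap.sum_apply]
  have hterm : ∀ m : ℕ, (P.coeff m • walkMap O ^ m) (planeVec O i j g θ (θ - 2 * n * θ)) =
      (P.coeff m * (Real.sin ((2 * m + 1 - 2 * n) * θ) : ℂ)) • g +
        (P.coeff m * (Real.cos ((2 * m + 1 - 2 * n) * θ) : ℂ)) • rest O i j g θ := by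
    intro m
    rw [LinearMap.smul_apply, h.walkMap_pow_planeVec hS, planeVec, smul_add, smul_smul, smul_smul]
    congr 5 <;> ring
  rw [Finset.sum_congr rfl fun m _ => hterm m, Finset.sum_add_distrib, ← Finset.sum_smul,
    ← Finset.sum_smul, hsin, hcos, zero_smul, add_zero]

/-- Two unit vectors with real inner product $s$ are at squared distance $2-2s$; about `f` only its
orthogonality to `g` is needed. -/
theorem IsTarget.amplify_sub (h : IsTarget O i j g θ) (hS : 2 * a + b + 2 * B + 4 + d < S)
    {n : ℕ} {P Q : ℂ[X]} (hP : P.natDegree ≤ 2 * n) {R₀ : Matrix.unitaryGroup Bool ℂ}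
    {Rs : List (Matrix.unitaryGroup Bool ℂ)} (hR : signalPair R₀ Rs = (P, Q)) {s : ℝ}
    (hsin : ∑ m ∈ Finset.range (2 * n + 1),
      P.coeff m * (Real.sin ((2 * m + 1 - 2 * n) * θ) : ℂ) = s)
    (hcos : ∑ m ∈ Finset.range (2 * n + 1),
      P.coeff m * (Real.cos ((2 * m + 1 - 2 * n) * θ) : ℂ) = 0) :
    stateNorm (Circuit.run O (amplify n R₀ Rs) (ket (start i j)) - g) ^ 2 = 2 - 2 * s ∧
      Circuit.run O (amplify n R₀ Rs) (ket (start i j)) - g ∈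
        supported fun u => (∀ r, u (fst r) = i r) ∧ ∀ r, u (snd r) = j r := by
  obtain ⟨f, hf, hrun⟩ := h.run_amplify hS hP hR hsin hcos
  constructor
  · have hgf : braket g f = 0 := braket_eq_zero_of_disjoint
      (fun u hu hu' => by
        have h1 := hu.1.1
        have h2 := hu'.1.1
        rw [h1] at h2
        exact absurd h2 (by simp)) h.mem_block hf
    have hself : braket (Circuit.run O (amplify n R₀ Rs) (ket (start i j : Wire a d b B S → Bool)))
        (Circuit.run O (amplify n R₀ Rs) (ket (start i j))) = 1 := by
      rw [braket_run_run, braket_ket_self]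
    have h1 : braket g (Circuit.run O (amplify n R₀ Rs) (ket (start i j))) = s := by
      rw [hrun, braket_add_right, braket_smul_right, h.braket_self, hgf]
      ring
    apply stateNorm_sq_of_braket
    rw [braket_sub_left, braket_sub_right, braket_sub_right, hself, h1, h.braket_self,
      ← star_braket, h1, Complex.star_def, Complex.conj_ofReal]
    push_cast
    ring
  · rw [hrun]
    refine Submodule.sub_mem _ (Submodule.add_mem _ (Submodule.smul_mem _ _ ?_) ?_) ?_
    · exact supported_mono (fun u hu => hu.2) h.mem_block
    · exact supported_mono (fun u hu => hu.2) hf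
    · exact supported_mono (fun u hu => hu.2) h.mem_block

theorem bits_injOn {d k l : ℕ} (hk : k < 2 ^ d) (hl : l < 2 ^ d) (h : bits d k = bits d l) :
    k = l := by
  refine Nat.eq_of_testBit_eq fun t => ?_
  by_cases ht : t < d
  · exact congrFun h ⟨t, ht⟩
  · rw [Nat.testBit_lt_two_pow (hk.trans_le (Nat.pow_le_pow_right two_pos (not_lt.mp ht))),
      Nat.testBit_lt_two_pow (hl.trans_le (Nat.pow_le_pow_right two_pos (not_lt.mp ht)))]

/-- The vector `v` in the vector register, with indices `i` and `j`. -/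
noncomputable def encode {n : ℕ} (i j : Fin a → Bool) (v : EuclideanSpace ℂ (Fin n)) :
    State (Wire a d b B S) :=
  ∑ k : Fin n, v k • ket (state i j (bits d k) zero zero zero zero false false)

theorem good_state (i j : Fin a → Bool) (v : Fin d → Bool) :
    Good i j (state i j v zero zero zero zero false false : Wire a d b B S → Bool) := by
  refine ⟨⟨⟨rfl, fun _ => rfl⟩, fun _ => rfl, fun _ => rfl⟩, fun q hq => ?_⟩
  rcases q with q | q | q | q
  · simp [checked] at hq
  · simp [checked] at hq
  · simp [checked] at hq
  · cases q <;> rfl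

theorem Good.eq_state {s : Wire a d b B S → Bool} (h : Good i j s) :
    s = state i j (fun r => s (vec r)) zero zero zero zero false false := by
  funext q
  rcases q with q | q | q | q
  · exact h.1.2.1 q
  · exact h.1.2.2 q
  · rfl
  · by_cases hq : ∃ r, q = .scr r
    · obtain ⟨r, rfl⟩ := hq
      exact h.1.1.2 r
    · rw [h.2 _ (work_mem_checked fun r hr => hq ⟨r, hr⟩)]
      cases q <;> rfl

theorem encode_mem {n : ℕ} (v : EuclideanSpace ℂ (Fin n)) :
    (encode i j v : State (Wire a d b B S)) ∈ supported (Good i j) :=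
  Submodule.sum_mem _ fun _ _ => Submodule.smul_mem _ _ (ket_mem_supported (good_state i j _))

theorem encode_apply {n : ℕ} (v : EuclideanSpace ℂ (Fin n)) (w : Fin d → Bool) :
    (encode i j v : State (Wire a d b B S)) (state i j w zero zero zero zero false false) =
      ∑ k : Fin n, v k * (if w = bits d k then 1 else 0) := by
  rw [encode, Finset.sum_apply]
  refine Finset.sum_congr rfl fun k _ => ?_
  rw [Pi.smul_apply, ket_apply, smul_eq_mul]
  congr 1
  simp [state_inj]

theorem encode_sub {n : ℕ} (v v' : EuclideanSpace ℂ (Fin n)) :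
    (encode i j (v - v') : State (Wire a d b B S)) = encode i j v - encode i j v' := by
  simp only [encode, ← Finset.sum_sub_distrib, PiLp.sub_apply, sub_smul]

theorem braket_encode_self {n : ℕ} (hn : n ≤ 2 ^ d) (v : EuclideanSpace ℂ (Fin n)) :
    braket (encode i j v : State (Wire a d b B S)) (encode i j v) = ((‖v‖ ^ 2 : ℝ) : ℂ) := by
  have hk : ∀ k : Fin n, (k : ℕ) < 2 ^ d := fun k => k.2.trans_le hn
  have h1 : ∀ k : Fin n, (encode i j v : State (Wire a d b B S))
      (state i j (bits d k) zero zero zero zero false false) = v k := by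
    intro k
    rw [encode_apply, Finset.sum_eq_single k, if_pos rfl, mul_one]
    · intro l _ hl
      rw [if_neg fun h => hl (Fin.ext (bits_injOn (hk k) (hk l) h).symm), mul_zero]
    · simp
  have h2 : braket (encode i j v : State (Wire a d b B S)) (encode i j v) =
      ∑ k : Fin n, star (v k) * v k := by
    conv_lhs => enter [1]; rw [encode]
    rw [braket_sum_left]
    refine Finset.sum_congr rfl fun k _ => ?_
    rw [braket_smul_left, braket_ket_left, h1]
  rw [h2, EuclideanSpace.norm_sq_eq]
  push_cast
  exact Finset.sum_congr rfl fun k _ => Complex.conj_mul' (v k)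

theorem stateNorm_encode {n : ℕ} (hn : n ≤ 2 ^ d) (v : EuclideanSpace ℂ (Fin n)) :
    stateNorm (encode i j v : State (Wire a d b B S)) = ‖v‖ :=
  (sq_eq_sq₀ (stateNorm_nonneg _) (norm_nonneg _)).mp
    (stateNorm_sq_of_braket (braket_encode_self hn v))

/-- By `run_combine_apply` the good part of the prepared state is $v/2^{B+1}$. Its norm is at most
one by the triangle inequality, hence the sine of an angle. -/
theorem isTarget_encode {n : ℕ} (hn : n ≤ 2 ^ d) (hB : B ≤ b) {ux uy : EuclideanSpace ℂ (Fin n)}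
    {rx ry : ℕ} (hO : ActsAt O i j ux uy rx ry) (hrx : rx < 2 ^ B) (hry : ry < 2 ^ B)
    (hux : ‖ux‖ = 1) (huy : ‖uy‖ = 1) {v : EuclideanSpace ℂ (Fin n)}
    (hv : v = (rx : ℂ) • ux - (ry : ℂ) • uy) (hv0 : v ≠ 0) :
    IsTarget O i j (encode i j (((‖v‖⁻¹ : ℝ) : ℂ) • v) : State (Wire a d b B S))
      (Real.arcsin (‖v‖ / 2 ^ (B + 1))) := by
  have hpos : 0 < ‖v‖ := norm_pos_iff.mpr hv0
  have hle : ‖v‖ ≤ 2 ^ (B + 1) := by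
    calc ‖v‖ ≤ ‖(rx : ℂ) • ux‖ + ‖(ry : ℂ) • uy‖ := hv ▸ norm_sub_le _ _
      _ = rx + ry := by rw [norm_smul, norm_smul, hux, huy]; simp
      _ ≤ 2 ^ B + 2 ^ B := add_le_add (by exact_mod_cast hrx.le) (by exact_mod_cast hry.le)
      _ = 2 ^ (B + 1) := by ring
  have hsin : Real.sin (Real.arcsin (‖v‖ / 2 ^ (B + 1))) = ‖v‖ / 2 ^ (B + 1) :=
    Real.sin_arcsin (le_trans (by norm_num) (by positivity : (0 : ℝ) ≤ ‖v‖ / 2 ^ (B + 1)))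
      ((div_le_one (by positivity)).mpr hle)
  refine ⟨encode_mem _, ?_, fun s hs => ?_⟩
  · rw [braket_encode_self hn, norm_smul, Complex.norm_real, norm_inv, norm_norm,
      inv_mul_cancel₀ hpos.ne']
    simp
  · have hc : (‖v‖ : ℂ) ≠ 0 := by exact_mod_cast hpos.ne'
    rw [hs.eq_state, encode_apply, hsin, prepared, start, run_combine_apply hB hO hrx hry,
      Finset.mul_sum, Finset.mul_sum]
    refine Finset.sum_congr rfl fun k _ => ?_
    have hvk : v k = rx * ux k - ry * uy k := by rw [hv]; rfl
    rw [PiLp.smul_apply, smul_eq_mul, hvk]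
    push_cast
    rw [div_pow, one_pow]
    field_simp

end Wire

end QAlg


namespace QAlg

/-! ### Transfer to numbered work qubits -/

section Relabel

variable {σ : Sizes} {Q Q' : Type} [Fintype Q] [DecidableEq Q] [Fintype Q'] [DecidableEq Q']

/-- A gate on relabelled qubits. -/
def Gate.relabel (e : Q ≃ Q') : Gate σ Q → Gate σ Q'
  | .single q U => .single (e q) U
  | .cnot c t hne => .cnot (e c) (e t) (e.injective.ne hne)
  | .query o w inverse control => .query o (w.trans e.toEmbedding) inverse
      (control.map fun q : {q : Q // q ∉ Set.range w} => ⟨e q.1, by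
        rintro ⟨i, hi⟩
        exact q.2 ⟨i, e.injective hi⟩⟩)

/-- A state of relabelled qubits in terms of the original labels. -/
def State.relabel (e : Q ≃ Q') (ψ : State Q') : State Q := fun s => ψ (s ∘ e.symm)

theorem Gate.op_relabel (O : Oracles σ) (e : Q ≃ Q') (g : Gate σ Q) (s t : Q → Bool) :
    (g.relabel e).op O (s ∘ e.symm) (t ∘ e.symm) = g.op O s t := by
  classical
  have hinj : Function.Injective fun u : Q → Bool => u ∘ e.symm := e.symm.surjective.injective_comp_right
  cases g with
  | single q U =>
    simp only [Gate.relabel, Gate.op, singleOp, Matrix.of_apply, Function.comp_apply,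
      Equiv.symm_apply_apply]
    refine if_congr ⟨fun h r hr => ?_, fun h r hr => h _ fun h' => hr (by simp [← h'])⟩ rfl rfl
    simpa using h (e r) (e.injective.ne hr)
  | cnot c t' hne =>
    simp only [Gate.relabel, Gate.op, cnotOp, Matrix.of_apply, Function.comp_apply,
      Equiv.symm_apply_apply]
    have h1 : Function.update (t ∘ e.symm) (e t') (xor (t t') (t c)) =
        Function.update t t' (xor (t t') (t c)) ∘ e.symm := by
      rw [Function.update_comp_equiv, Equiv.symm_symm]
    rw [h1]
    exact if_congr hinj.eq_iff rfl rfl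
  | query o w inverse control =>
    have hlift : ∀ U, liftOp (w.trans e.toEmbedding) U (s ∘ e.symm) (t ∘ e.symm) = liftOp w U s t := by
      intro U
      simp only [liftOp, Matrix.of_apply]
      have h1 : ∀ u : Q → Bool, (u ∘ e.symm) ∘ (w.trans e.toEmbedding) = u ∘ w := by
        intro u; funext k; simp
      rw [h1, h1]
      have h2 : (∀ q, q ∉ Set.range (w.trans e.toEmbedding) → (s ∘ e.symm) q = (t ∘ e.symm) q) ↔
          ∀ q, q ∉ Set.range w → s q = t q := by
        refine ⟨fun h q hq => ?_, fun h q hq => ?_⟩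
        · have := h (e q) fun ⟨k, hk⟩ => hq ⟨k, e.injective hk⟩
          simpa using this
        · exact h _ fun ⟨k, hk⟩ => hq ⟨k, by simp [hk]⟩
      by_cases h : ∀ q, q ∉ Set.range w → s q = t q
      · rw [if_pos h, if_pos (h2.mpr h)]
      · rw [if_neg h, if_neg (mt h2.mp h)]
    cases control with
    | none => exact hlift _
    | some q =>
      simp only [Gate.relabel, Gate.op, Option.map_some, controlOp, Matrix.of_apply,
        Function.comp_apply, Equiv.symm_apply_apply, hlift, Matrix.one_apply, hinj.eq_iff]

/-- This carries the analysis with named work qubits over to a layout where they are merely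
numbered. -/
theorem Circuit.run_relabel (O : Oracles σ) (e : Q ≃ Q') (𝒜 : Circuit σ Q) (ψ : State Q') :
    State.relabel e (Circuit.run O (𝒜.map (Gate.relabel e)) ψ) =
      Circuit.run O 𝒜 (State.relabel e ψ) := by
  induction 𝒜 generalizing ψ with
  | nil => rfl
  | cons g 𝒜 ih =>
    rw [List.map_cons, Circuit.run, Circuit.run, ih]
    congr 1
    funext s
    refine (Fintype.sum_equiv (e.arrowCongr (Equiv.refl Bool)) _ _ fun t => ?_).symm
    change _ = (g.relabel e).op O (s ∘ e.symm) (t ∘ e.symm) * ψ (t ∘ e.symm)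
    rw [Gate.op_relabel]
    rfl

theorem State.stateNorm_relabel (e : Q ≃ Q') (ψ : State Q') :
    stateNorm (State.relabel e ψ) = stateNorm ψ := by
  refine (sq_eq_sq₀ (stateNorm_nonneg _) (stateNorm_nonneg _)).mp ?_
  rw [stateNorm_sq_eq_sum, stateNorm_sq_eq_sum]
  exact Fintype.sum_equiv (e.arrowCongr (Equiv.refl Bool)) _ _ fun t => rfl

theorem State.relabel_ket (e : Q ≃ Q') (s : Q' → Bool) : State.relabel e (ket s) = ket (s ∘ e) := by
  funext t
  rw [State.relabel, ket_apply, ket_apply]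
  refine if_congr ⟨?_, ?_⟩ rfl rfl
  · rintro rfl
    funext q; simp
  · rintro rfl
    funext q; simp

theorem State.relabel_smul (e : Q ≃ Q') (c : ℂ) (ψ : State Q') :
    State.relabel e (c • ψ) = c • State.relabel e ψ := rfl

theorem State.relabel_sum {ι : Type*} (e : Q ≃ Q') (t : Finset ι) (ψ : ι → State Q') :
    State.relabel e (∑ k ∈ t, ψ k) = ∑ k ∈ t, State.relabel e (ψ k) := by
  funext s
  simp [State.relabel]

/-- Pythagoras: states with disjoint supports are orthogonal. -/
theorem stateNorm_sum_sq_of_disjoint {ι : Type*} [Fintype ι] {p : ι → (Q → Bool) → Prop}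
    (hp : ∀ k l, k ≠ l → ∀ s, p k s → ¬p l s) {f : ι → State Q} (hf : ∀ k, f k ∈ supported (p k)) :
    stateNorm (∑ k, f k) ^ 2 = ∑ k, stateNorm (f k) ^ 2 := by
  classical
  apply stateNorm_sq_of_braket
  rw [braket_sum_left]
  push_cast
  refine Finset.sum_congr rfl fun k _ => ?_
  rw [braket_sum_right, Finset.sum_eq_single k, braket_self]
  · push_cast; rfl
  · exact fun l _ hl => braket_eq_zero_of_disjoint (hp k l hl.symm) (hf k) (hf l)
  · simp

end Relabel

/-! ### Oracle specifications, input and output in the named layout -/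

namespace Wire

variable {a d b B S : ℕ}

theorem actsAt_vec {n : ℕ} {M : Matrix (Fin a ⊕ Fin d → Bool) (Fin a ⊕ Fin d → Bool) ℂ} {i : ℕ}
    {u : EuclideanSpace ℂ (Fin n)}
    (h : M *ᵥ tensor (ketNat a i) (ketNat d 0) = tensor (ketNat a i) (ketVec d u)) :
    M *ᵥ ket (Sum.elim (bits a i) zero) = ∑ k, u k • ket (Sum.elim (bits a i) (bits d k)) := by
  simp only [ketNat, ketVec, tensor_sum_right, tensor_smul_right, tensor_ket_ket, bits_zero] at h
  exact h

theorem actsAt_num {M : Matrix (Fin a ⊕ Fin b → Bool) (Fin a ⊕ Fin b → Bool) ℂ} {i r : ℕ}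
    (h : M *ᵥ tensor (ketNat a i) (ketNat b 0) = tensor (ketNat a i) (ketNat b r)) :
    M *ᵥ ket (Sum.elim (bits a i) zero) =
      ∑ _k : Unit, (1 : ℂ) • ket (Sum.elim (bits a i) (bits b r)) := by
  simp only [ketNat, tensor_ket_ket, bits_zero] at h
  rw [h]
  simp

/-- The numbering of the work qubits. -/
noncomputable def layoutEquiv (a d b B S : ℕ) :
    Wire a d b B S ≃ Fin a ⊕ (Fin a ⊕ (Fin d ⊕ Fin (Fintype.card (Work a b B S)))) :=
  Equiv.sumCongr (Equiv.refl _) (Equiv.sumCongr (Equiv.refl _)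
    (Equiv.sumCongr (Equiv.refl _) (Fintype.equivFin _)))

theorem relabel_ket_layout (i j : Fin a → Bool) (v : Fin d → Bool) :
    State.relabel (layoutEquiv a d b B S) (ket (Sum.elim i (Sum.elim j (Sum.elim v zero)))) =
      ket (state i j v zero zero zero zero false false) := by
  rw [State.relabel_ket]
  congr 1
  funext q
  rcases q with q | q | q | q
  · rfl
  · rfl
  · rfl
  · cases q <;> rfl

theorem relabel_inputState {m n : ℕ} (p : Fin m → Fin m → ℝ) :
    State.relabel (layoutEquiv (Nat.clog 2 m) (Nat.clog 2 n) b B S) (inputState n _ p) =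
      ∑ i : Fin m, ∑ j : Fin m, (Real.sqrt (p i j) : ℂ) • ket (start (bits _ i) (bits _ j)) := by
  simp only [inputState, State.relabel_sum, State.relabel_smul, ketNat, tensor_ket_ket, bits_zero,
    relabel_ket_layout, start]

theorem relabel_outputState {m n : ℕ} (p : Fin m → Fin m → ℝ)
    (x y : Fin m → EuclideanSpace ℂ (Fin n)) :
    State.relabel (layoutEquiv (Nat.clog 2 m) (Nat.clog 2 n) b B S) (outputState _ p x y) =
      ∑ i : Fin m, ∑ j : Fin m, (Real.sqrt (p i j) : ℂ) •
        encode (bits _ i) (bits _ j) (((‖x i - y j‖⁻¹ : ℝ) : ℂ) • (x i - y j)) := by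
  have htensor : ∀ (i j : ℕ) (v : EuclideanSpace ℂ (Fin n)),
      State.relabel (layoutEquiv (Nat.clog 2 m) (Nat.clog 2 n) b B S)
        (tensor (ketNat _ i) (tensor (ketNat _ j) (tensor (ketVec _ v) (ketNat _ 0)))) =
      encode (bits _ i) (bits _ j) v := by
    intro i j v
    have h1 : tensor (ketVec (Nat.clog 2 n) v) (ketNat (Fintype.card (Work (Nat.clog 2 m) b B S)) 0) =
        ∑ k : Fin n, v k • ket (Sum.elim (bits (Nat.clog 2 n) k) zero) := by
      rw [← bits_zero]
      funext s
      simp only [tensor, ketVec, Finset.sum_apply, Pi.smul_apply, smul_eq_mul, Finset.sum_mul,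
        ketNat, ← tensor_ket_ket, mul_assoc]
    rw [h1]
    simp only [ketNat, tensor_sum_right, tensor_smul_right, tensor_ket_ket, State.relabel_sum,
      State.relabel_smul, relabel_ket_layout, encode]
  simp only [outputState, State.relabel_sum, State.relabel_smul, htensor]

end Wire

end QAlg


namespace QAlg

/-! ### Choice of parameters and the error for one pair of indices -/

/-- Write the difference as $(v-z)/\|z\|+(\|v\|^{-1}-\|z\|^{-1})v$; each summand has norm at most
$\|v-z\|/\|z\|$. -/
theorem norm_normalize_sub_normalize_le {E : Type*} [NormedAddCommGroup E] [NormedSpace ℂ E]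
    {v z : E} (hv : v ≠ 0) (hz : z ≠ 0) :
    ‖((‖v‖⁻¹ : ℝ) : ℂ) • v - ((‖z‖⁻¹ : ℝ) : ℂ) • z‖ ≤ 2 * ‖v - z‖ / ‖z‖ := by
  have hv' : 0 < ‖v‖ := norm_pos_iff.mpr hv
  have hz' : 0 < ‖z‖ := norm_pos_iff.mpr hz
  have h1 : ((‖v‖⁻¹ : ℝ) : ℂ) • v - ((‖z‖⁻¹ : ℝ) : ℂ) • z =
      ((‖z‖⁻¹ : ℝ) : ℂ) • (v - z) + ((‖v‖⁻¹ - ‖z‖⁻¹ : ℝ) : ℂ) • v := by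
    push_cast
    module
  have h2 : |‖v‖⁻¹ - ‖z‖⁻¹| * ‖v‖ = |‖z‖ - ‖v‖| / ‖z‖ := by
    rw [inv_sub_inv hv'.ne' hz'.ne', abs_div, abs_of_pos (mul_pos hv' hz')]
    field_simp
  rw [h1]
  refine (norm_add_le _ _).trans ?_
  rw [norm_smul, norm_smul, Complex.norm_real, Complex.norm_real, Real.norm_eq_abs,
    Real.norm_eq_abs, h2, abs_of_pos (inv_pos.mpr hz')]
  have h3 : |‖z‖ - ‖v‖| ≤ ‖v - z‖ := by
    rw [abs_sub_comm]
    exact abs_norm_sub_norm_le v z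
  calc ‖z‖⁻¹ * ‖v - z‖ + |‖z‖ - ‖v‖| / ‖z‖ ≤ ‖z‖⁻¹ * ‖v - z‖ + ‖v - z‖ / ‖z‖ := by gcongr
    _ = 2 * ‖v - z‖ / ‖z‖ := by ring

theorem normalize_smul {E : Type*} [NormedAddCommGroup E] [NormedSpace ℂ E] {c : ℝ} (hc : 0 < c)
    (v : E) : ((‖(c : ℂ) • v‖⁻¹ : ℝ) : ℂ) • (c : ℂ) • v = ((‖v‖⁻¹ : ℝ) : ℂ) • v := by
  rw [smul_smul, norm_smul, Complex.norm_real, Real.norm_eq_abs, abs_of_pos hc, ← Complex.ofReal_mul,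
    mul_inv, mul_right_comm, inv_mul_cancel₀ hc.ne', one_mul]

namespace Wire

variable {a d b B S : ℕ}

theorem length_reflect_le (L : List (Wire a d b B S)) : (reflect L).length ≤ 18 * L.length + 3 :=
  length_reflection_le _ _ _

theorem length_walk_le (hB : B ≤ b) :
    (walk : Circuit (Sizes.mk a d b) (Wire a d b B S)).length ≤ 219 * (a + b + d + 1) := by
  have h1 := length_combine_le (a := a) (d := d) (S := S) hB
  have h2 := length_reflect_le (checked : List (Wire a d b B S))
  have h3 := length_reflect_le (checked ++ vecs : List (Wire a d b B S))
  rw [length_checked] at h2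
  rw [length_checked_vecs] at h3
  simp only [walk, List.length_append, Circuit.length_inv, List.length_singleton]
  omega

theorem length_unwalk (n : ℕ) :
    (unwalk n : Circuit (Sizes.mk a d b) (Wire a d b B S)).length =
      n * (walk : Circuit (Sizes.mk a d b) (Wire a d b B S)).length := by
  induction n with
  | zero => simp [unwalk]
  | succ n ih =>
    rw [unwalk, List.length_append, Circuit.length_inv, ih]
    ring

theorem length_signalCircuit (R₀ : Matrix.unitaryGroup Bool ℂ)
    (Rs : List (Matrix.unitaryGroup Bool ℂ)) :
    (signalCircuit R₀ Rs : Circuit (Sizes.mk a d b) (Wire a d b B S)).length =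
      Rs.length * ((walk : Circuit (Sizes.mk a d b) (Wire a d b B S)).length + 1) + 1 := by
  induction Rs with
  | nil => simp [signalCircuit]
  | cons R Rs ih =>
    rw [signalCircuit, List.length_append, List.length_append, ih, List.length_singleton,
      List.length_cons]
    ring

theorem length_amplify_le (hB : B ≤ b) {n : ℕ} (R₀ : Matrix.unitaryGroup Bool ℂ)
    {Rs : List (Matrix.unitaryGroup Bool ℂ)} (hR : Rs.length = 2 * n) :
    (amplify n R₀ Rs : Circuit (Sizes.mk a d b) (Wire a d b B S)).length ≤
      (3 * n + 1) * (220 * (a + b + d + 1)) := by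
  have h1 := length_combine_le (a := a) (d := d) (S := S) hB
  have h2 := length_walk_le (a := a) (d := d) (S := S) hB
  rw [amplify, List.length_append, List.length_append, length_unwalk, length_signalCircuit, hR]
  have h3 := Nat.mul_le_mul_left n h2
  have h4 := Nat.mul_le_mul_left (2 * n) (Nat.succ_le_succ h2)
  nlinarith

/-- The comparison register must be large enough for the norms, but not larger. -/
theorem exists_key_size (b : ℕ) {M : ℝ} :
    ∃ B ≤ b, (∀ r : ℕ, r < 2 ^ b → (r : ℝ) ≤ M → r < 2 ^ B) ∧
      (B = 0 ∨ (2 : ℝ) ^ (B + 1) ≤ 4 * M) := by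
  classical
  -- The least such `B` is taken; failure at `B - 1` gives $2^{B-1}\le M$, hence the factor `4`.
  have hex : ∃ B, b ≤ B ∨ M < 2 ^ B := ⟨b, .inl le_rfl⟩
  refine ⟨Nat.find hex, Nat.find_min' hex (.inl le_rfl), fun r hr hrM => ?_, ?_⟩
  · rcases Nat.find_spec hex with h | h
    · exact hr.trans_le (Nat.pow_le_pow_right two_pos h)
    · exact_mod_cast hrM.trans_lt h
  · rcases Nat.eq_zero_or_pos (Nat.find hex) with h | h
    · exact .inl h
    · right
      obtain ⟨B, hB⟩ := Nat.exists_eq_succ_of_ne_zero h.ne'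
      have h1 := Nat.find_min hex (m := B) (by omega)
      push Not at h1
      rw [hB, pow_succ, pow_succ]
      linarith [h1.2]

theorem norm_difference_sub_le {n : ℕ} {x y ux uy : EuclideanSpace ℂ (Fin n)} {rx ry : ℕ} {c η : ℝ}
    (hux : ‖ux‖ = 1) (huy : ‖uy‖ = 1) (hx : (‖x‖ : ℂ) • ux = x) (hy : (‖y‖ : ℂ) • uy = y)
    (hrx : |rx * c - ‖x‖| ≤ η) (hry : |ry * c - ‖y‖| ≤ η) :
    ‖(c : ℂ) • ((rx : ℂ) • ux - (ry : ℂ) • uy) - (x - y)‖ ≤ 2 * η := by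
  have h1 : (c : ℂ) • ((rx : ℂ) • ux - (ry : ℂ) • uy) - (x - y) =
      ((rx * c - ‖x‖ : ℝ) : ℂ) • ux - ((ry * c - ‖y‖ : ℝ) : ℂ) • uy := by
    conv_lhs => rw [← hx, ← hy]
    push_cast
    module
  rw [h1]
  refine (norm_sub_le _ _).trans ?_
  rw [norm_smul, norm_smul, Complex.norm_real, Complex.norm_real, Real.norm_eq_abs,
    Real.norm_eq_abs, hux, huy]
  linarith

theorem exists_circuit (a d b : ℕ) (s : ℤ) {h ε₀ ε : ℝ} (hh : 0 < h) (hε₀ : 0 < ε₀) (hε : 0 < ε)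
    (hε1 : ε < 1) :
    ∃ (B S : ℕ) (𝒜 : Circuit (Sizes.mk a d b) (Wire a d b B S)),
      (𝒜.length : ℝ) ≤ h / ε₀ * (1 + Real.log (1 / ε)) * (2000000 * (a + b + d + 1)) ∧
      ∀ (n : ℕ) (O : Oracles (Sizes.mk a d b)) (i j : Fin a → Bool)
        (x y ux uy : EuclideanSpace ℂ (Fin n)) (rx ry : ℕ) (η : ℝ), n ≤ 2 ^ d →
        ActsAt O i j ux uy rx ry → rx < 2 ^ b → ry < 2 ^ b → ‖ux‖ = 1 → ‖uy‖ = 1 →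
        (‖x‖ : ℂ) • ux = x → (‖y‖ : ℂ) • uy = y → |(rx : ℝ) * (2 : ℝ) ^ (-s) - ‖x‖| ≤ η →
        |(ry : ℝ) * (2 : ℝ) ^ (-s) - ‖y‖| ≤ η → ‖x‖ ≤ h → ‖y‖ ≤ h → ε₀ ≤ ‖x - y‖ → η < ε₀ / 4 →
        stateNorm (Circuit.run O 𝒜 (ket (start i j)) -
          encode i j (((‖x - y‖⁻¹ : ℝ) : ℂ) • (x - y))) ≤ ε + 8 * η / ε₀ ∧
        Circuit.run O 𝒜 (ket (start i j)) - encode i j (((‖x - y‖⁻¹ : ℝ) : ℂ) • (x - y)) ∈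
          supported fun u => (∀ r, u (fst r) = i r) ∧ ∀ r, u (snd r) = j r := by
  have hlog : 0 ≤ Real.log (1 / ε) := Real.log_nonneg (by rw [le_div_iff₀ hε]; linarith)
  -- No admissible vectors exist in this case, so the empty circuit serves. Otherwise
  -- $\varepsilon_0\le 2h$, which is used for the constants below.
  by_cases hfar : 2 * h < ε₀
  · refine ⟨0, 0, [], by simp only [List.length_nil, Nat.cast_zero]; positivity, ?_⟩
    intro n O i j x y ux uy rx ry η _ _ _ _ _ _ _ _ _ _ hx hy hxy
    linarith [norm_sub_le x y]
  push Not at hfar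
  set c : ℝ := (2 : ℝ) ^ (-s) with hcdef
  have hc : 0 < c := by positivity
  -- In units of $c=2^{-s}$, returned norms are at most $h+\eta\le\frac32h$, since
  -- $\eta<\varepsilon_0/4\le h/2$.
  obtain ⟨B, hBb, hB, hBle⟩ := exists_key_size b (M := 3 / 2 * h / c)
  -- The ratio of the bounds $\varepsilon_0/2\le c\|v\|$ and $2^{B+1}c\le 6h$ gives $\theta_0$; the
  -- choice of $\delta$ gives $2-2s\le2\delta=\varepsilon^2$.
  obtain ⟨n₀, P, hn₀, hPd, hP1, hP⟩ := exists_amplifying_polynomial (θ₀ := ε₀ / (12 * h))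
    (δ := ε ^ 2 / 2) (by positivity) (by rw [div_le_one (by positivity)]; linarith) (by positivity)
    (by nlinarith)
  obtain ⟨Q, hQd, hPQ⟩ := exists_complement hPd hP1
  obtain ⟨R₀, Rs, hlen, hR⟩ := exists_signalPair (2 * n₀) P Q hPd hQd hPQ
  refine ⟨B, 2 * a + b + 2 * B + 5 + d, amplify n₀ R₀ Rs, ?_, ?_⟩
  · have h1 : (((amplify n₀ R₀ Rs : Circuit (Sizes.mk a d b)
        (Wire a d b B (2 * a + b + 2 * B + 5 + d))).length : ℕ) : ℝ) ≤
        (3 * n₀ + 1) * (220 * (a + b + d + 1)) := by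
      exact_mod_cast length_amplify_le hBb R₀ hlen
    have h2 : Real.log (1 / (ε ^ 2 / 2)) = Real.log 2 + 2 * Real.log (1 / ε) := by
      rw [show (1 / (ε ^ 2 / 2) : ℝ) = 2 * (1 / ε) ^ 2 by field_simp,
        Real.log_mul two_ne_zero (by positivity), Real.log_pow]
      norm_num
    have h3 : (1 : ℝ) / 2 ≤ h / ε₀ := by rw [le_div_iff₀ hε₀]; linarith
    have h4 : (64 : ℝ) / (ε₀ / (12 * h)) = 768 * (h / ε₀) := by field_simp; ring
    have h5 : (n₀ : ℝ) ≤ 768 * (h / ε₀) * (2 * (1 + Real.log (1 / ε))) := by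
      rw [h2, h4] at hn₀
      refine hn₀.trans (mul_le_mul_of_nonneg_left ?_ (by positivity))
      linarith [Real.log_two_lt_d9]
    have h6 : (1 : ℝ) / 2 ≤ h / ε₀ * (1 + Real.log (1 / ε)) := by nlinarith
    have h7 : (3 * n₀ + 1 : ℝ) * 220 ≤ h / ε₀ * (1 + Real.log (1 / ε)) * 2000000 := by
      nlinarith
    calc _ ≤ _ := h1
      _ = (3 * n₀ + 1 : ℝ) * 220 * (a + b + d + 1) := by ring
      _ ≤ h / ε₀ * (1 + Real.log (1 / ε)) * 2000000 * (a + b + d + 1) := by gcongr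
      _ = _ := by ring
  · intro n O i j x y ux uy rx ry η hn hO hrxb hryb hux huy hx hy hrx hry hxh hyh hxy hη
    have hbound : ∀ (r : ℕ) (t : ℝ), |r * c - t| ≤ η → t ≤ h → r < 2 ^ b → r < 2 ^ B := by
      intro r t hr ht hrb
      refine hB r hrb ?_
      rw [le_div_iff₀ hc]
      linarith [(abs_le.mp hr).2]
    have hrxB := hbound rx _ hrx hxh hrxb
    have hryB := hbound ry _ hry hyh hryb
    have hdiff := norm_difference_sub_le hux huy hx hy hrx hry
    set v := (rx : ℂ) • ux - (ry : ℂ) • uy with hv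
    have hcv : ε₀ / 2 ≤ ‖(c : ℂ) • v‖ := by
      have := norm_sub_norm_le (x - y) ((c : ℂ) • v)
      rw [norm_sub_rev (x - y)] at this
      linarith
    have hcv0 : (c : ℂ) • v ≠ 0 := norm_pos_iff.mp (by linarith)
    have hv0 : v ≠ 0 := fun h0 => hcv0 (by rw [h0, smul_zero])
    have hz0 : x - y ≠ 0 := norm_pos_iff.mp (by linarith)
    have htarget := isTarget_encode (S := 2 * a + b + 2 * B + 5 + d) hn hBb hO hrxB hryB hux huy
      hv hv0
    have hpow : (2 : ℝ) ^ (B + 1) ≤ 6 * h / c := by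
      rcases hBle with h0 | h0
      -- With no key bits both returned norms would be zero, contradicting `v ≠ 0`.
      · rw [h0, pow_zero, Nat.lt_one_iff] at hrxB hryB
        exact absurd (by rw [hv, hrxB, hryB]; simp) hv0
      · calc _ ≤ _ := h0
          _ = 6 * h / c := by ring
    have hratio : ε₀ / (12 * h) ≤ ‖v‖ / 2 ^ (B + 1) := by
      rw [norm_smul, Complex.norm_real, Real.norm_eq_abs, abs_of_pos hc] at hcv
      rw [le_div_iff₀ hc] at hpow
      rw [div_le_div_iff₀ (by positivity) (by positivity)]
      have h1 : ε₀ * (2 ^ (B + 1) * c) ≤ ‖v‖ * (12 * h) * c := by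
        calc ε₀ * (2 ^ (B + 1) * c) ≤ ε₀ * (6 * h) := by gcongr
          _ = (ε₀ / 2) * (12 * h) := by ring
          _ ≤ (c * ‖v‖) * (12 * h) := by gcongr
          _ = _ := by ring
      rw [← mul_assoc] at h1
      exact le_of_mul_le_mul_right h1 hc
    have hθ : ε₀ / (12 * h) ≤ Real.arcsin (‖v‖ / 2 ^ (B + 1)) := by
      -- An angle is at least its sine, so a lower bound for the amplitude is one for the angle.
      have h1 := Real.sin_le (Real.arcsin_nonneg.mpr
        (show 0 ≤ ‖v‖ / 2 ^ (B + 1) by positivity))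
      have h2 : ‖v‖ / 2 ^ (B + 1) ≤ 1 := by
        rw [div_le_one (by positivity)]
        calc ‖v‖ ≤ ‖(rx : ℂ) • ux‖ + ‖(ry : ℂ) • uy‖ := hv ▸ norm_sub_le _ _
          _ = rx + ry := by rw [norm_smul, norm_smul, hux, huy]; simp
          _ ≤ 2 ^ B + 2 ^ B := add_le_add (by exact_mod_cast hrxB.le) (by exact_mod_cast hryB.le)
          _ = 2 ^ (B + 1) := by ring
      rw [Real.sin_arcsin (le_trans (by norm_num) (by positivity : (0 : ℝ) ≤ ‖v‖ / 2 ^ (B + 1)))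
        h2] at h1
      exact hratio.trans h1
    obtain ⟨t, ht, hsin, hcos⟩ := hP _ hθ (Real.arcsin_le_pi_div_two _)
    obtain ⟨hnorm, hmem⟩ := htarget.amplify_sub (by omega) hPd hR hsin hcos
    have hsplit : Circuit.run O (amplify n₀ R₀ Rs) (ket (start i j)) -
        encode i j (((‖x - y‖⁻¹ : ℝ) : ℂ) • (x - y)) =
        (Circuit.run O (amplify n₀ R₀ Rs)
          (ket (start i j : Wire a d b B (2 * a + b + 2 * B + 5 + d) → Bool)) -
          encode i j (((‖v‖⁻¹ : ℝ) : ℂ) • v)) +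
        encode i j (((‖v‖⁻¹ : ℝ) : ℂ) • v - ((‖x - y‖⁻¹ : ℝ) : ℂ) • (x - y)) := by
      rw [encode_sub]
      abel
    rw [hsplit]
    constructor
    · have h1 : stateNorm (Circuit.run O (amplify n₀ R₀ Rs)
          (ket (start i j : Wire a d b B (2 * a + b + 2 * B + 5 + d) → Bool)) -
          encode i j (((‖v‖⁻¹ : ℝ) : ℂ) • v)) ≤ ε := by
        refine (sq_le_sq₀ (stateNorm_nonneg _) hε.le).mp ?_
        rw [hnorm]
        linarith
      have h2 : ‖((‖v‖⁻¹ : ℝ) : ℂ) • v - ((‖x - y‖⁻¹ : ℝ) : ℂ) • (x - y)‖ ≤ 8 * η / ε₀ := by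
        rw [← normalize_smul hc v]
        have hη0 : 0 ≤ η := (abs_nonneg _).trans hrx
        calc _ ≤ 2 * ‖(c : ℂ) • v - (x - y)‖ / ‖x - y‖ := norm_normalize_sub_normalize_le hcv0 hz0
          _ ≤ 2 * (2 * η) / ε₀ := by gcongr
          -- Here $4\eta/\varepsilon_0$ would do; the constant $8$ is needed only for large $\eta$.
          _ ≤ 8 * η / ε₀ := div_le_div_of_nonneg_right (by linarith) hε₀.le
      refine (stateNorm_add_le _ _).trans (add_le_add h1 ?_)
      rwa [stateNorm_encode hn]
    · exact Submodule.add_mem _ hmem (supported_mono (fun u hu => hu.1.2) (encode_mem _))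

end Wire

end QAlg


namespace QAlg

/-! ### Running time, superposition over the indices, and conclusion -/

theorem clog_two_le {m : ℕ} (hm : 0 < m) : (Nat.clog 2 m : ℝ) ≤ 1 + 2 * Real.log m := by
  have hlog : 0 ≤ Real.log m := Real.log_nonneg (by exact_mod_cast hm)
  rcases Nat.eq_zero_or_pos (Nat.clog 2 m) with h0 | h0
  · rw [h0, Nat.cast_zero]
    linarith
  have hlt : 2 ^ (Nat.clog 2 m - 1) < m := by
    refine (Nat.lt_clog_iff_pow_lt one_lt_two).mp ?_
    omega
  have h1 : ((Nat.clog 2 m - 1 : ℕ) : ℝ) * Real.log 2 ≤ Real.log m := by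
    rw [← Real.log_pow]
    exact Real.log_le_log (by positivity) (by exact_mod_cast hlt.le)
  rw [Nat.cast_sub h0, Nat.cast_one] at h1
  have h2 : (1 : ℝ) ≤ Nat.clog 2 m := by exact_mod_cast h0
  nlinarith [Real.log_two_gt_d9]

theorem polylog_le {C z z' : ℝ} {k k' : ℕ} (hz : 1 ≤ z) (hzz' : z ≤ z') (hk : k ≤ k') :
    polylog C k z ≤ |C| * (1 + Real.log z') ^ k' := by
  have h1 : 0 ≤ Real.log z := Real.log_nonneg hz
  have h2 : Real.log z ≤ Real.log z' := Real.log_le_log (by linarith) hzz'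
  calc C * (1 + Real.log z) ^ k ≤ |C| * (1 + Real.log z) ^ k := by
        gcongr
        exact le_abs_self C
    _ ≤ |C| * (1 + Real.log z') ^ k := by gcongr
    _ ≤ |C| * (1 + Real.log z') ^ k' := by
        refine mul_le_mul_of_nonneg_left (pow_le_pow_right₀ ?_ hk) (abs_nonneg C)
        linarith

/-- The running time in terms of the number of steps. -/
theorem time_le_polylog {C₀ : ℝ} {k₀ m n b T l : ℕ} {q ε : ℝ} (hm : 0 < m) (hn : 0 < n) (hq : 0 ≤ q)
    (hε : 0 < ε) (hε1 : ε < 1) (hT : (T : ℝ) ≤ polylog C₀ k₀ (m * n))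
    (hb : (b : ℝ) ≤ polylog C₀ k₀ (m * n))
    (hl : (l : ℝ) ≤ q * (1 + Real.log (1 / ε)) *
      (2000000 * (Nat.clog 2 m + Nat.clog 2 n + b + 1))) :
    (l : ℝ) * (T + 1) ≤ q * polylog (2000000 * (7 + |C₀|) * (1 + |C₀|)) (2 * k₀ + 3) (m * n / ε) := by
  have hm' : (1 : ℝ) ≤ m := by exact_mod_cast hm
  have hn' : (1 : ℝ) ≤ n := by exact_mod_cast hn
  have hmn : (1 : ℝ) ≤ m * n := one_le_mul_of_one_le_of_one_le hm' hn'
  have hz : (m * n : ℝ) ≤ m * n / ε := by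
    rw [le_div_iff₀ hε]
    nlinarith
  have hlm := Real.log_nonneg hm'
  have hln := Real.log_nonneg hn'
  have hlε : 0 ≤ Real.log (1 / ε) := Real.log_nonneg (by rw [le_div_iff₀ hε]; linarith)
  have hsplit : Real.log (m * n / ε) = Real.log m + Real.log n + Real.log (1 / ε) := by
    rw [div_eq_mul_one_div, Real.log_mul (by positivity) (by positivity),
      Real.log_mul (by positivity) (by positivity)]
  set L := 1 + Real.log (m * n / ε) with hL
  have hL1 : 1 ≤ L := by rw [hL, hsplit]; linarith
  have hLp : ∀ k, L ≤ L ^ (k + 1) := fun k => le_self_pow₀ hL1 (Nat.succ_ne_zero k)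
  have hT' : (T : ℝ) + 1 ≤ (1 + |C₀|) * L ^ (k₀ + 1) := by
    have h1 := polylog_le (C := C₀) hmn hz (k' := k₀ + 1) (Nat.le_succ k₀)
    have h2 := hLp k₀
    rw [← hL] at h1
    rw [add_mul]
    linarith
  have hsize : (Nat.clog 2 m + Nat.clog 2 n + b + 1 : ℝ) ≤ (7 + |C₀|) * L ^ (k₀ + 1) := by
    have h1 := polylog_le (C := C₀) hmn hz (k' := k₀ + 1) (Nat.le_succ k₀)
    have h2 := hLp k₀
    have h3 := clog_two_le hm
    have h4 := clog_two_le hn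
    rw [← hL] at h1
    have h5 : Real.log m ≤ L - 1 := by rw [hL, hsplit]; linarith
    have h6 : Real.log n ≤ L - 1 := by rw [hL, hsplit]; linarith
    rw [add_mul]
    linarith
  have hε' : 1 + Real.log (1 / ε) ≤ L := by rw [hL, hsplit]; linarith
  -- The exponent $2k_0+3$ collects one factor $L$ from the precision and $L^{k_0+1}$ each from the
  -- register sizes and the query time.
  calc (l : ℝ) * (T + 1)
      ≤ (q * (1 + Real.log (1 / ε)) *
          (2000000 * (Nat.clog 2 m + Nat.clog 2 n + b + 1))) * ((1 + |C₀|) * L ^ (k₀ + 1)) := by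
        gcongr
    _ ≤ (q * L * (2000000 * ((7 + |C₀|) * L ^ (k₀ + 1)))) * ((1 + |C₀|) * L ^ (k₀ + 1)) := by
        gcongr
    _ = q * (2000000 * (7 + |C₀|) * (1 + |C₀|) * L ^ (2 * k₀ + 3)) := by ring

namespace Wire

variable {a d b B S : ℕ} {m : ℕ}

/-- The basis states with indices `i` and `j`. -/
def HasIndices (k : Fin m × Fin m) (u : Wire (Nat.clog 2 m) d b B S → Bool) : Prop :=
  (∀ r, u (fst r) = bits _ k.1 r) ∧ ∀ r, u (snd r) = bits _ k.2 r

/-- Since $m\le2^{\lceil\log_2m\rceil}$, the bits determine the index. -/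
theorem HasIndices.disjoint (k l : Fin m × Fin m) (hkl : k ≠ l)
    (u : Wire (Nat.clog 2 m) d b B S → Bool) (hk : HasIndices k u) : ¬HasIndices l u := by
  intro hl
  have hlt : ∀ i : Fin m, (i : ℕ) < 2 ^ Nat.clog 2 m := fun i =>
    i.2.trans_le (Nat.le_pow_clog one_lt_two m)
  refine hkl (Prod.ext (Fin.ext ?_) (Fin.ext ?_))
  · exact bits_injOn (hlt _) (hlt _) (funext fun r => (hk.1 r).symm.trans (hl.1 r))
  · exact bits_injOn (hlt _) (hlt _) (funext fun r => (hk.2 r).symm.trans (hl.2 r))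

/-- Blocks with different indices are orthogonal, so the squared error is the average of the squared
block errors with weights $p_{ij}$; no factor depending on $m$ is lost. -/
theorem stateNorm_superposition_le {p : Fin m → Fin m → ℝ} (hp : ∀ i j, 0 ≤ p i j)
    (hp1 : ∑ i, ∑ j, p i j = 1) {f : Fin m → Fin m → State (Wire (Nat.clog 2 m) d b B S)}
    (hf : ∀ i j, f i j ∈ supported (HasIndices (i, j))) {D : ℝ} (hD : 0 ≤ D)
    (hfD : ∀ i j, stateNorm (f i j) ≤ D) :
    stateNorm (∑ i, ∑ j, (Real.sqrt (p i j) : ℂ) • f i j) ≤ D := by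
  refine (sq_le_sq₀ (stateNorm_nonneg _) hD).mp ?_
  rw [← Fintype.sum_prod_type' fun i j => (Real.sqrt (p i j) : ℂ) • f i j,
    stateNorm_sum_sq_of_disjoint (p := HasIndices) HasIndices.disjoint
      fun k => Submodule.smul_mem _ _ (hf k.1 k.2)]
  have hterm : ∀ k : Fin m × Fin m, stateNorm ((Real.sqrt (p k.1 k.2) : ℂ) • f k.1 k.2) ^ 2 ≤
      p k.1 k.2 * D ^ 2 := by
    intro k
    have h1 : stateNorm ((Real.sqrt (p k.1 k.2) : ℂ) • f k.1 k.2) ^ 2 =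
        p k.1 k.2 * stateNorm (f k.1 k.2) ^ 2 := by
      rw [stateNorm_sq_eq_sum, stateNorm_sq_eq_sum, Finset.mul_sum]
      refine Finset.sum_congr rfl fun s _ => ?_
      rw [Pi.smul_apply, smul_eq_mul, norm_mul, mul_pow, Complex.norm_real, Real.norm_eq_abs, sq_abs,
        Real.sq_sqrt (hp _ _)]
    rw [h1]
    exact mul_le_mul_of_nonneg_left (pow_le_pow_left₀ (stateNorm_nonneg _) (hfD _ _) 2) (hp _ _)
  refine (Finset.sum_le_sum fun k _ => hterm k).trans ?_
  rw [← Finset.sum_mul, Fintype.sum_prod_type' p, hp1, one_mul]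

theorem stateNorm_ket (s : Wire a d b B S → Bool) : stateNorm (ket s) = 1 := by
  refine (sq_eq_sq₀ (stateNorm_nonneg _) zero_le_one).mp ?_
  rw [stateNorm_sq_of_braket (r := 1) (by rw [braket_ket_self]; simp)]
  simp

end Wire

end QAlg

open QAlg QAlg.Wire in
theorem lemma2 (C₀ : ℝ) (k₀ : ℕ) :
    ∃ (C : ℝ) (k : ℕ), ∀ (m n b T : ℕ) (s : ℤ) (h ε₀ ε : ℝ),
      0 < m → 0 < n → 0 < h → 0 < ε₀ → 0 < ε → ε < 1 →
      (T : ℝ) ≤ QAlg.polylog C₀ k₀ (m * n) → (b : ℝ) ≤ QAlg.polylog C₀ k₀ (m * n) →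
      ∃ (w : ℕ) (𝒜 : QAlg.Circuit (QAlg.sizes m n b) (QAlg.Layout m n w)),
        (QAlg.Circuit.time T 𝒜 : ℝ) ≤ (h / ε₀) * QAlg.polylog C k (m * n / ε) ∧
        ∀ (x y : Fin m → EuclideanSpace ℂ (Fin n)) (η : ℝ) (O : QAlg.Oracles (QAlg.sizes m n b))
          (p : Fin m → Fin m → ℝ),
          (∀ i, ‖x i‖ ≤ h) → (∀ j, ‖y j‖ ≤ h) → (∀ i j, ε₀ ≤ ‖x i - y j‖) →
          QAlg.GivesAccess s η O x y →
          (∀ i j, 0 ≤ p i j) → (∑ i, ∑ j, p i j = 1) →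
          QAlg.stateNorm
            (QAlg.Circuit.run O 𝒜 (QAlg.inputState n w p) - QAlg.outputState w p x y)
            ≤ ε + 8 * η / ε₀ := by
  refine ⟨2000000 * (7 + |C₀|) * (1 + |C₀|), 2 * k₀ + 3, ?_⟩
  intro m n b T s h ε₀ ε hm hn hh hε₀ hε hε1 hT hb
  obtain ⟨B, S, 𝒜, hlen, h𝒜⟩ :=
    exists_circuit (Nat.clog 2 m) (Nat.clog 2 n) b s hh hε₀ hε hε1
  refine ⟨_, 𝒜.map (Gate.relabel (layoutEquiv _ _ b B S)), ?_, ?_⟩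
  · have h1 := Circuit.time_le_length_mul T (𝒜.map (Gate.relabel (layoutEquiv _ _ b B S)))
    rw [List.length_map] at h1
    refine le_trans (b := (𝒜.length : ℝ) * (T + 1)) (by exact_mod_cast h1) ?_
    refine time_le_polylog hm hn (by positivity) hε hε1 hT hb (hlen.trans_eq ?_)
    ring
  · intro x y η O p hx hy hxy hO hp hp1
    have hn2 : n ≤ 2 ^ Nat.clog 2 n := Nat.le_pow_clog one_lt_two n
    -- The norm bound at the index `0`, which exists because `m > 0`, forces this.
    have hη : 0 ≤ η := by
      obtain ⟨r, -, hr, -⟩ := hO.normX ⟨0, hm⟩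
      exact (abs_nonneg _).trans hr
    have hD : 0 ≤ ε + 8 * η / ε₀ := by positivity
    have hencode : ∀ i j : Fin m, (encode (bits _ i) (bits _ j)
        (((‖x i - y j‖⁻¹ : ℝ) : ℂ) • (x i - y j)) : State (Wire (Nat.clog 2 m) (Nat.clog 2 n) b B S)) ∈
        supported (HasIndices (i, j)) := fun i j =>
      supported_mono (fun u hu => hu.1.2) (encode_mem _)
    have hsum : ∀ O' : Oracles (Sizes.mk (Nat.clog 2 m) (Nat.clog 2 n) b),
        (η < ε₀ / 4 → ∀ i j : Fin m, stateNorm (Circuit.run O' 𝒜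
          (ket (start (bits _ i) (bits _ j))) - encode (bits _ i) (bits _ j)
            (((‖x i - y j‖⁻¹ : ℝ) : ℂ) • (x i - y j))) ≤ ε + 8 * η / ε₀ ∧
          Circuit.run O' 𝒜 (ket (start (bits _ i) (bits _ j))) - encode (bits _ i) (bits _ j)
            (((‖x i - y j‖⁻¹ : ℝ) : ℂ) • (x i - y j)) ∈ supported (HasIndices (i, j))) →
        stateNorm (Circuit.run O' 𝒜
          (∑ i : Fin m, ∑ j : Fin m, (Real.sqrt (p i j) : ℂ) • ket (start (bits _ i) (bits _ j))) -
          ∑ i : Fin m, ∑ j : Fin m, (Real.sqrt (p i j) : ℂ) •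
            encode (bits _ i) (bits _ j) (((‖x i - y j‖⁻¹ : ℝ) : ℂ) • (x i - y j))) ≤
          ε + 8 * η / ε₀ := by
      intro O' hblock
      -- For large $\eta$ the claim is trivial: two states of norm at most one differ by at most
      -- $2\le8\eta/\varepsilon_0$.
      by_cases hlarge : ε₀ / 4 ≤ η
      · refine (stateNorm_sub_le _ _).trans ?_
        rw [stateNorm_run]
        have h1 := stateNorm_superposition_le hp hp1 (d := Nat.clog 2 n) (b := b) (B := B) (S := S)
          (f := fun i j => ket (start (bits _ i) (bits _ j)))
          (fun i j => ket_mem_supported (inBlock_start _ _).2) zero_le_one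
          fun i j => (stateNorm_ket _).le
        have h2 := stateNorm_superposition_le hp hp1 hencode zero_le_one fun i j => by
          rw [stateNorm_encode hn2, norm_smul, Complex.norm_real, norm_inv, norm_norm,
            inv_mul_cancel₀ (by linarith [hxy i j])]
        have h3 : 2 ≤ 8 * η / ε₀ := by
          rw [le_div_iff₀ hε₀]
          linarith
        linarith
      · simp only [Circuit.run_sum, Circuit.run_smul, ← Finset.sum_sub_distrib, ← smul_sub]
        have hblock := hblock (not_le.mp hlarge)
        exact stateNorm_superposition_le hp hp1 (fun i j => (hblock i j).2) hD
          fun i j => (hblock i j).1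
    have hrelabel : State.relabel (layoutEquiv _ _ b B S)
        (Circuit.run O (𝒜.map (Gate.relabel (layoutEquiv _ _ b B S))) (inputState n _ p) -
          outputState _ p x y) =
        Circuit.run (σ := Sizes.mk (Nat.clog 2 m) (Nat.clog 2 n) b) O 𝒜
          (∑ i : Fin m, ∑ j : Fin m, (Real.sqrt (p i j) : ℂ) • ket (start (bits _ i) (bits _ j))) -
        ∑ i : Fin m, ∑ j : Fin m, (Real.sqrt (p i j) : ℂ) •
          encode (bits _ i) (bits _ j) (((‖x i - y j‖⁻¹ : ℝ) : ℂ) • (x i - y j)) :=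
      congrArg₂ (· - ·) ((Circuit.run_relabel _ _ _ _).trans
        (congrArg _ (relabel_inputState p))) (relabel_outputState p x y)
    refine (State.stateNorm_relabel (layoutEquiv _ _ b B S) _).symm.trans_le
      ((congrArg stateNorm hrelabel).trans_le (hsum O fun hsmall i j => ?_))
    obtain ⟨ux, hux, hxu, hOx⟩ := hO.vecX i
    obtain ⟨uy, huy, hyu, hOy⟩ := hO.vecY j
    obtain ⟨rx, hrx, hrxη, hOrx⟩ := hO.normX i
    obtain ⟨ry, hry, hryη, hOry⟩ := hO.normY j
    exact h𝒜 n O _ _ (x i) (y j) ux uy rx ry η hn2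
      ⟨actsAt_vec hOx, actsAt_vec hOy, actsAt_num hOrx, actsAt_num hOry⟩ hrx hry hux huy hxu hyu
      hrxη hryη (hx i) (hy j) (hxy i j) hsmall
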